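/- Let $\mathcal X_1,\mathcal X_2,\mathcal Y$ be finite sets and $Q(y|x_1,x_2)$ the transition matrix of a two-user discrete memoryless multiple-access channel. All logarithms, entropies and divergences are to base 2. **Codes.** An $(M_1,M_2,N)$ variable-length code (VLC) with feedback consists of independent messages $W_i$ uniform on $\{1,\dots,M_i\}$, encoders $X_{i,t}=e_{i,t}(W_i,Y^{t-1})\in\mathcal X_i$ ($i=1,2$), decoders $d_t:\mathcal Y^t\to\{1,\dots,M_1\}\times\{1,\dots,M_2\}$ and a stopping time $1\le T\le N$ of the output filtration $\mathcal F_t=\sigma(Y^t)$; the outputs are generated by $Q$, and $P_e=\mathbb P\big(d_T(Y^T)\ne(W_1,W_2)\big)$. A triple $(E,R_1,R_2)$ is achievable if there is a fixed integer $m$ such that for all $\varepsilon\in(0,1)$ and $M\in\mathbb N$, for all sufficiently large $n$ there is an $(M_1,M_2,N)$-VLC with $N\le n^m$, $M_1,M_2\ge M$, $$-\frac{\log P_e}{\mathbb E[T]}\ge E-\varepsilon,\qquad \frac{\log M_i}{\mathbb E[T]}\ge R_i-\varepsilon\quad(i=1,2).$$ The reliability function $E(R_1,R_2)$ is the supremum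 of all $E$ for which $(E,R_1,R_2)$ is achievable. **Feedback distributions.** For $N\in\mathbb N$ let $\mathcal P^N_{MAC}$ be the set of all distributions on $\mathcal X_1^N\times\mathcal X_2^N\times\mathcal Y^N$ of the form $$P=\prod_{\ell=1}^N P_{1,\ell}(x_{1,\ell}|x_1^{\ell-1},y^{\ell-1})\,P_{2,\ell}(x_{2,\ell}|x_2^{\ell-1},y^{\ell-1})\,Q(y_\ell|x_{1,\ell},x_{2,\ell}),$$ let $\mathcal P_{MAC}=\bigcup_N\mathcal P^N_{MAC}$, and write $N_P$ for the number of letters of $P$. For $P\in\mathcal P_{MAC}$ and stopping times $T_1,T_2,T_3\ge 1$ of $(\mathcal F_t)$ define $$I^1(P)=\frac1{\mathbb E[T_1]}\mathbb E\Big[\sum_{t=1}^{T_1}I(X_1^t;Y_t\,|\,X_2^t,Y^{t-1}=y^{t-1})\Big],\qquad I^2(P)=\frac1{\mathbb E[T_2]}\mathbb E\Big[\sum_{t=1}^{T_2}I(X_2^t;Y_t\,|\,X_1^t,Y^{t-1}=y^{t-1})\Big],$$ $$I^3(P)=\frac1{\mathbb E[T_3]}\mathbb E\Big[\sum_{t=1}^{T_3}I(X_1^t,X_2^t;Y_t\,|\,Y^{t-1}=y^{t-1})\Big],$$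 the expectations being over the realization $y^{t-1}$ of the past outputs. For $i\in\{1,2\}$ and $j=3-i$ put $$D^i_r(y^{r-1})=\max_{x_i,x_i'}\ \sup_{p}\ D_{KL}\Big(P_{Y_r|X_{i,r},Y^{r-1}}(\cdot\,|x_i,y^{r-1})\ \Big\|\ \sum_{x_j}p(x_j)\,Q(\cdot\,|x_i',x_j)\Big),$$ where $x_i$ ranges over the inputs with $P(x_{i,r}=x_i\,|\,y^{r-1})>0$, $x'_i$ over $\mathcal X_i$ and $p$ over all distributions on $\mathcal X_j$ (the arguments of $Q$ being put in the right order). For a stopping time $T\ge T_i$ let $$D^i(P)=\frac1{\mathbb E[T-T_i]}\mathbb E\Big[\sum_{r=T_i+1}^{T}D^i_r(Y^{r-1})\Big]\quad(i=1,2),\qquad D^3(P)=D^3=\max_{x_1,x_1',x_2,x_2'}D_{KL}\big(Q(\cdot|x_1,x_2)\,\|\,Q(\cdot|x_1',x_2')\big).$$ **Theorem.** Suppose that $D^3<\infty$, let $R_1,R_2\ge0$ be such that $E(R_1,R_2)>0$, and let $R_3=R_1+R_2$. Then $$E(R_1,R_2)\ \le\ E^{ub}(R_1,R_2):=\sup_{P\in\mathcal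 P_{MAC}}\ \sup_{T\le N_P}\ \sup_{T_1,T_2,T_3\le T}\ \min_{i\in\{1,2,3\}}D^i(P)\Big(1-\frac{R_i}{I^i(P)}\Big),$$ where $T,T_1,T_2,T_3$ are stopping times with values in $\{1,2,\dots\}$ and the supremum is over those choices for which the quotients make sense, that is, $\mathbb E[T-T_1]$, $\mathbb E[T-T_2]$, $I^1(P)$, $I^2(P)$ and $I^3(P)$ are positive. -/

import Mathlib

open scoped ENNReal BigOperators

noncomputable section

namespace MAC

/-! ### Finite probability: laws are real weights on a finite sample space -/

/-- The first `r` terms of a sequence of length `N`. -/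
def past {N : ℕ} {α : Type*} (s : Fin N → α) (r : ℕ) (h : r ≤ N) : Fin r → α :=
  fun i => s (Fin.castLE h i)

open Classical in
/-- Probability of the event `A` under the law `p`. -/
def pr {Ω : Type*} [Fintype Ω] (p : Ω → ℝ) (A : Ω → Prop) : ℝ :=
  ∑ ω, if A ω then p ω else 0

open Classical in
/-- The law `p` conditioned on the event `A`. -/
def condLaw {Ω : Type*} [Fintype Ω] (p : Ω → ℝ) (A : Ω → Prop) : Ω → ℝ :=
  fun ω => if A ω then p ω / pr p A else 0

/-- Expectation of a real random variable. -/
def expect {Ω : Type*} [Fintype Ω] (p : Ω → ℝ) (f : Ω → ℝ) : ℝ :=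
  ∑ ω, p ω * f ω

/-- Shannon entropy (in bits) of the random variable `U` under the law `p`. -/
def entropy {Ω α : Type*} [Fintype Ω] [Fintype α] (p : Ω → ℝ) (U : Ω → α) : ℝ :=
  -∑ a, pr p (fun ω => U ω = a) * Real.logb 2 (pr p (fun ω => U ω = a))

/-- Mutual information `I(U; V)` in bits. -/
def mutualInfo {Ω α β : Type*} [Fintype Ω] [Fintype α] [Fintype β]
    (p : Ω → ℝ) (U : Ω → α) (V : Ω → β) : ℝ :=
  entropy p U + entropy p V - entropy p (fun ω => (U ω, V ω))

/-- Conditional mutual information `I(U; V | W)` in bits. -/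
def condMutualInfo {Ω α β γ : Type*} [Fintype Ω] [Fintype α] [Fintype β] [Fintype γ]
    (p : Ω → ℝ) (U : Ω → α) (V : Ω → β) (W : Ω → γ) : ℝ :=
  entropy p (fun ω => (U ω, W ω)) + entropy p (fun ω => (V ω, W ω))
    - entropy p (fun ω => (U ω, V ω, W ω)) - entropy p W

open Classical in
/-- Kullback-Leibler divergence (in bits) of two probability vectors; it is `∞` when the first
is not absolutely continuous with respect to the second. -/
def relEntropy {Y : Type*} [Fintype Y] (p q : Y → ℝ) : ℝ≥0∞ :=
  if ∀ y, q y = 0 → p y = 0 then ENNReal.ofReal (∑ y, p y * Real.logb 2 (p y / q y)) else ⊤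

/-! ### Stopping times of the output sequence -/

/-- The filtration generated by the output sequence: at time `t` the first `t` outputs are
known. -/
def outputFiltration (Y : Type*) (N : ℕ) :
    MeasureTheory.Filtration ℕ (⊤ : MeasurableSpace (Fin N → Y)) where
  seq t := MeasurableSpace.comap (fun y (i : {i : Fin N // (i : ℕ) < t}) => y i) ⊤
  mono' := by
    intro s t hst
    rintro A ⟨B, -, rfl⟩
    exact ⟨(fun z (i : {i : Fin N // (i : ℕ) < s}) => z ⟨i.1, lt_of_lt_of_le i.2 hst⟩) ⁻¹' B,
      trivial, rfl⟩
  le' _ := le_top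

/-- `T` is a stopping time of the output sequence, with values in `{1, 2, …}`. -/
structure IsStop {Y : Type*} {N : ℕ} (T : (Fin N → Y) → ℕ) : Prop where
  one_le : ∀ y, 1 ≤ T y
  stopping : MeasureTheory.IsStoppingTime (outputFiltration Y N) (fun y => (T y : WithTop ℕ))

/-! ### Variable-length codes and the reliability function -/

/-- An `(M₁, M₂, N)` variable-length code with feedback. The encoders at time `t + 1` see the
`t` past outputs; the decoder at time `t` sees the first `t` outputs. -/
structure VLC (X₁ X₂ Y : Type*) (M₁ M₂ N : ℕ) where
  enc₁ : (t : ℕ) → Fin M₁ → (Fin t → Y) → X₁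
  enc₂ : (t : ℕ) → Fin M₂ → (Fin t → Y) → X₂
  dec : (t : ℕ) → (Fin t → Y) → Fin M₁ × Fin M₂
  T : (Fin N → Y) → ℕ
  isStop : IsStop T
  le_N : ∀ y, T y ≤ N

namespace VLC

variable {X₁ X₂ Y : Type*} {M₁ M₂ N : ℕ}

/-- Joint law of the messages (independent, uniform) and of the outputs of the channel `Q`. -/
def law (c : VLC X₁ X₂ Y M₁ M₂ N) (Q : X₁ → X₂ → Y → ℝ) :
    (Fin M₁ × Fin M₂) × (Fin N → Y) → ℝ :=
  fun ω => 1 / ((M₁ : ℝ) * (M₂ : ℝ)) *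
    ∏ t : Fin N, Q (c.enc₁ t ω.1.1 (past ω.2 t t.2.le)) (c.enc₂ t ω.1.2 (past ω.2 t t.2.le)) (ω.2 t)

/-- The decoded pair of messages. -/
def decoded (c : VLC X₁ X₂ Y M₁ M₂ N) (y : Fin N → Y) : Fin M₁ × Fin M₂ :=
  c.dec (c.T y) (past y (c.T y) (c.le_N y))

/-- The probability of error. -/
def errorProb [Fintype Y] (c : VLC X₁ X₂ Y M₁ M₂ N) (Q : X₁ → X₂ → Y → ℝ) : ℝ :=
  pr (c.law Q) (fun ω => c.decoded ω.2 ≠ ω.1)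

/-- The expected decoding time. -/
def meanT [Fintype Y] (c : VLC X₁ X₂ Y M₁ M₂ N) (Q : X₁ → X₂ → Y → ℝ) : ℝ :=
  expect (c.law Q) (fun ω => (c.T ω.2 : ℝ))

open Classical in
/-- The error exponent `-log₂ Pₑ / 𝔼[T]`, equal to `∞` if the error probability is zero. -/
def errorExponent [Fintype Y] (c : VLC X₁ X₂ Y M₁ M₂ N) (Q : X₁ → X₂ → Y → ℝ) : EReal :=
  if c.errorProb Q = 0 then ⊤ else ((-Real.logb 2 (c.errorProb Q) / c.meanT Q : ℝ) : EReal)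

/-- The rate of the first user. -/
def rate₁ [Fintype Y] (c : VLC X₁ X₂ Y M₁ M₂ N) (Q : X₁ → X₂ → Y → ℝ) : ℝ :=
  Real.logb 2 M₁ / c.meanT Q

/-- The rate of the second user. -/
def rate₂ [Fintype Y] (c : VLC X₁ X₂ Y M₁ M₂ N) (Q : X₁ → X₂ → Y → ℝ) : ℝ :=
  Real.logb 2 M₂ / c.meanT Q

end VLC

/-- The triple `(E, R₁, R₂)` is achievable. -/
def Achievable {X₁ X₂ Y : Type*} [Fintype Y] (Q : X₁ → X₂ → Y → ℝ) (E R₁ R₂ : ℝ) : Prop :=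
  ∃ m : ℕ, ∀ ε : ℝ, 0 < ε → ε < 1 → ∀ M : ℕ, ∀ᶠ n : ℕ in Filter.atTop,
    ∃ (M₁ M₂ N : ℕ) (c : VLC X₁ X₂ Y M₁ M₂ N),
      N ≤ n ^ m ∧ M ≤ M₁ ∧ M ≤ M₂ ∧
      ((E - ε : ℝ) : EReal) ≤ c.errorExponent Q ∧
      R₁ - ε ≤ c.rate₁ Q ∧ R₂ - ε ≤ c.rate₂ Q

/-- The reliability function `E(R₁, R₂)`. -/
def reliability {X₁ X₂ Y : Type*} [Fintype Y] (Q : X₁ → X₂ → Y → ℝ) (R₁ R₂ : ℝ) : EReal :=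
  sSup ((fun E : ℝ => (E : EReal)) '' {E : ℝ | Achievable Q E R₁ R₂})

/-! ### Multi-letter feedback distributions -/

/-- Sample space of input and output sequences of length `N`. -/
abbrev Traj (X₁ X₂ Y : Type*) (N : ℕ) := (Fin N → X₁) × (Fin N → X₂) × (Fin N → Y)

/-- The `N`-letter distributions
`∏ P₁(x₁ₗ | x₁^{l-1} y^{l-1}) P₂(x₂ₗ | x₂^{l-1} y^{l-1}) Q(yₗ | x₁ₗ x₂ₗ)`. -/
def feedbackLaws {X₁ X₂ Y : Type*} [Fintype X₁] [Fintype X₂]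
    (Q : X₁ → X₂ → Y → ℝ) (N : ℕ) : Set (Traj X₁ X₂ Y N → ℝ) :=
  {P | ∃ (P₁ : (l : ℕ) → (Fin l → X₁) → (Fin l → Y) → X₁ → ℝ)
         (P₂ : (l : ℕ) → (Fin l → X₂) → (Fin l → Y) → X₂ → ℝ),
      (∀ l x y, P₁ l x y ∈ stdSimplex ℝ X₁) ∧ (∀ l x y, P₂ l x y ∈ stdSimplex ℝ X₂) ∧
      ∀ ω, P ω = ∏ l : Fin N,
        P₁ l (past ω.1 l l.2.le) (past ω.2.2 l l.2.le) (ω.1 l) *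
        P₂ l (past ω.2.1 l l.2.le) (past ω.2.2 l l.2.le) (ω.2.1 l) *
        Q (ω.1 l) (ω.2.1 l) (ω.2.2 l)}

/-! ### Variable-length directed information

The index `r : Fin N` stands for time `r + 1`; the condition `r < T` therefore means that this
time is at most `T`. -/

section Directed

variable {Ω α β γ : Type*} [Fintype Ω] [Fintype α] [Fintype β] [Fintype γ] {N : ℕ}

open Classical in
/-- `I(A^T → B^T ‖ C^T) = 𝔼 ∑_{t ≤ T} I(A^t ; B_t | C^t, B^{t-1} = b^{t-1})`. -/
def directedInfoCausal (P : Ω → ℝ) (A : Ω → Fin N → α) (B : Ω → Fin N → β) (C : Ω → Fin N → γ)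
    (T : (Fin N → β) → ℕ) : ℝ :=
  expect P fun ω => ∑ r : Fin N, if (r : ℕ) < T (B ω) then
    condMutualInfo (condLaw P fun ω' => past (B ω') r r.2.le = past (B ω) r r.2.le)
      (fun ω' => past (A ω') (r + 1) r.2) (fun ω' => B ω' r) (fun ω' => past (C ω') (r + 1) r.2)
    else 0

open Classical in
/-- `I(A^T → B^T) = 𝔼 ∑_{t ≤ T} I(A^t ; B_t | B^{t-1} = b^{t-1})`. -/
def directedInfo (P : Ω → ℝ) (A : Ω → Fin N → α) (B : Ω → Fin N → β)
    (T : (Fin N → β) → ℕ) : ℝ :=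
  expect P fun ω => ∑ r : Fin N, if (r : ℕ) < T (B ω) then
    mutualInfo (condLaw P fun ω' => past (B ω') r r.2.le = past (B ω) r r.2.le)
      (fun ω' => past (A ω') (r + 1) r.2) (fun ω' => B ω' r)
    else 0

/-! ### Divergences of the effective channels -/

/-- The largest divergence, at time `r + 1` and given the past outputs `h`, between the effective
channel `P(B_r = · | A_r = a, h)` of a user with input sequence `A` and an effective channel of
that user in which the input of the other user has an arbitrary law `q`. The first argument of
the divergence ranges over the inputs `a` that have positive probability given `h`. In `K a b y`
the first argument is the input of the user under consideration. -/
def effDiv (K : α → β → γ → ℝ) (P : Ω → ℝ) (A : Ω → Fin N → α) (B : Ω → Fin N → γ)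
    (r : Fin N) (h : Fin r → γ) : ℝ≥0∞ :=
  ⨆ (a : α) (_ : 0 < pr P fun ω => A ω r = a ∧ past (B ω) r r.2.le = h)
    (a' : α) (q : β → ℝ) (_ : q ∈ stdSimplex ℝ β),
    relEntropy
      (fun y => pr P (fun ω => B ω r = y ∧ A ω r = a ∧ past (B ω) r r.2.le = h) /
        pr P (fun ω => A ω r = a ∧ past (B ω) r r.2.le = h))
      (fun y => ∑ b, q b * K a' b y)

open Classical in
/-- `𝔼[∑_{S < t ≤ T} D_t(B^{t-1})] / 𝔼[T - S]`. -/
def avgEffDiv (K : α → β → γ → ℝ) (P : Ω → ℝ) (A : Ω → Fin N → α) (B : Ω → Fin N → γ)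
    (S T : (Fin N → γ) → ℕ) : ℝ≥0∞ :=
  (∑ ω, ENNReal.ofReal (P ω) * ∑ r : Fin N, if S (B ω) ≤ r ∧ (r : ℕ) < T (B ω) then
      effDiv K P A B r (past (B ω) r r.2.le) else 0) /
    ENNReal.ofReal (expect P fun ω => (T (B ω) : ℝ) - (S (B ω) : ℝ))

end Directed

/-! ### The upper bound -/

section Bound

variable {X₁ X₂ Y : Type*} [Fintype X₁] [Fintype X₂] [Fintype Y] {N : ℕ}

/-- Expectation of a function of the outputs. -/
def meanOut (P : Traj X₁ X₂ Y N → ℝ) (f : (Fin N → Y) → ℝ) : ℝ :=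
  expect P fun ω => f ω.2.2

/-- `I¹(P) = I(X₁^S → Y^S ‖ X₂^S) / 𝔼[S]`. -/
def I₁ (P : Traj X₁ X₂ Y N → ℝ) (S : (Fin N → Y) → ℕ) : ℝ :=
  directedInfoCausal P (fun ω => ω.1) (fun ω => ω.2.2) (fun ω => ω.2.1) S /
    meanOut P fun y => (S y : ℝ)

/-- `I²(P) = I(X₂^S → Y^S ‖ X₁^S) / 𝔼[S]`. -/
def I₂ (P : Traj X₁ X₂ Y N → ℝ) (S : (Fin N → Y) → ℕ) : ℝ :=
  directedInfoCausal P (fun ω => ω.2.1) (fun ω => ω.2.2) (fun ω => ω.1) S /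
    meanOut P fun y => (S y : ℝ)

/-- `I³(P) = I(X₁^S X₂^S → Y^S) / 𝔼[S]`. -/
def I₃ (P : Traj X₁ X₂ Y N → ℝ) (S : (Fin N → Y) → ℕ) : ℝ :=
  directedInfo P (fun ω i => (ω.1 i, ω.2.1 i)) (fun ω => ω.2.2) S /
    meanOut P fun y => (S y : ℝ)

/-- `D¹(P)`: the average, over the times after `S` up to `T`, of the first user's `D_r`. -/
def D₁ (Q : X₁ → X₂ → Y → ℝ) (P : Traj X₁ X₂ Y N → ℝ) (S T : (Fin N → Y) → ℕ) : ℝ≥0∞ :=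
  avgEffDiv Q P (fun ω => ω.1) (fun ω => ω.2.2) S T

/-- `D²(P)`: the average, over the times after `S` up to `T`, of the second user's `D_r`. -/
def D₂ (Q : X₁ → X₂ → Y → ℝ) (P : Traj X₁ X₂ Y N → ℝ) (S T : (Fin N → Y) → ℕ) : ℝ≥0∞ :=
  avgEffDiv (fun x₂ x₁ => Q x₁ x₂) P (fun ω => ω.2.1) (fun ω => ω.2.2) S T

/-- `D³`: the largest divergence between two rows of the channel. -/
def D₃ (Q : X₁ → X₂ → Y → ℝ) : ℝ≥0∞ :=
  ⨆ (x₁ : X₁) (x₁' : X₁) (x₂ : X₂) (x₂' : X₂), relEntropy (Q x₁ x₂) (Q x₁' x₂')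

/-- The term `D (1 - R / I)`. -/
def slope (D : ℝ≥0∞) (R I : ℝ) : EReal := (D : EReal) * ((1 - R / I : ℝ) : EReal)

/-- The choices over which the supremum is taken: a feedback distribution `P`, a stopping time
`T ≤ N` and stopping times `T₁, T₂, T₃ ≤ T`, such that all the denominators occurring in the
bound are positive. -/
structure Admissible (Q : X₁ → X₂ → Y → ℝ) (P : Traj X₁ X₂ Y N → ℝ)
    (T T₁ T₂ T₃ : (Fin N → Y) → ℕ) : Prop where
  law : P ∈ feedbackLaws Q N
  isStop : IsStop T
  isStop₁ : IsStop T₁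
  isStop₂ : IsStop T₂
  isStop₃ : IsStop T₃
  le_N : ∀ y, T y ≤ N
  le₁ : ∀ y, T₁ y ≤ T y
  le₂ : ∀ y, T₂ y ≤ T y
  le₃ : ∀ y, T₃ y ≤ T y
  gap₁ : 0 < meanOut P fun y => (T y : ℝ) - (T₁ y : ℝ)
  gap₂ : 0 < meanOut P fun y => (T y : ℝ) - (T₂ y : ℝ)
  info₁ : 0 < I₁ P T₁
  info₂ : 0 < I₂ P T₂
  info₃ : 0 < I₃ P T₃

/-- The upper bound `E^{ub}(R₁, R₂)`. -/
def upperBound (Q : X₁ → X₂ → Y → ℝ) (R₁ R₂ : ℝ) : EReal :=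
  sSup {v : EReal | ∃ (N : ℕ) (P : Traj X₁ X₂ Y N → ℝ) (T T₁ T₂ T₃ : (Fin N → Y) → ℕ),
    Admissible Q P T T₁ T₂ T₃ ∧
    v = min (slope (D₁ Q P T₁ T) R₁ (I₁ P T₁))
        (min (slope (D₂ Q P T₂ T) R₂ (I₂ P T₂)) (slope (D₃ Q) (R₁ + R₂) (I₃ P T₃)))}

end Bound

end MAC

end

/-! The proof is Burnashev's converse followed by a padding argument.

Finiteness of `D₃` makes all rows of the channel have the same support (`eq_zero_of_D₃_lt_top`). The
positive entries are then bounded below by a single `lam > 0`, and no output sequence ever excludes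
a message.

Take a code with exponent close to E, mean decoding time τ and error probability pe. Let S be the
first time in {1, 2, …} at which some message pair has posterior probability above 1 - δ, or the
decoding time if that comes earlier, and let σ be the mean of S.

Before S, information is acquired. The best guess at S is wrong with probability at most δ + pe
(`pr_concMessage_ne_le`), so by Fano nearly all of log M₁ (given W₂), of log M₂ (given W₁) and of
log M₁M₂ has been learnt. What is learnt is at most the corresponding directed information
(`condMutualInfo_ge`, `information_ge`). Hence, up to small errors, R_i τ ≤ σ I^i for all three i,
with the same S.

After S, the guess is confirmed. The quantity -log(1 - posterior of the true pair) is bounded at S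
(`expect_logOdds_concTime_le`), its mean must be about -log pe at the decoding time
(`le_expect_logOdds`), and its mean increase per step is at most D³ (`sum_mul_logb_drift_le`). Hence
E τ ≤ (τ - σ) D³ up to small errors. Eliminating σ/τ gives E ≤ D³ (1 - R_i / I^i) for each i.

It remains to replace D³ by D¹ and D². The final time T in the bound need not be the decoding time,
so the code, of length N, is followed by n further letters in which the users send constants x₁, x₂,
where the rows at (x₁, x₂) and some (x₁', x₂') attain D³. In this tail each user's effective channel
is the row at (x₁, x₂), and the law of the other user's input may be a point mass, so every D_r is
at least D³. With T = N + n and n much larger than N, D¹ and D² are at least n D³ / (N + n), which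
is nearly D³ (`le_D₁_extend`, `le_D₂_extend`). Decoding is unchanged, so the converse applies to the
padded code, with T₁ = T₂ = T₃ = S.

The errors vanish because many messages force τ to be large (`meanT_large`), and a large τ forces pe
to be small. -/

noncomputable section

namespace MAC

/-! ### Finite probability -/

section Probability

variable {Ω α β γ : Type*} [Fintype Ω] [Fintype α] [Fintype β] [Fintype γ]

/-- Gibbs' inequality in the form used below. -/
theorem sum_mul_logb_nonneg {p x : Ω → ℝ} (hp : ∀ ω, 0 ≤ p ω) (hx : ∀ ω, 0 < p ω → 0 < x ω)
    (h : ∑ ω, p ω / x ω ≤ ∑ ω, p ω) : 0 ≤ ∑ ω, p ω * Real.logb 2 (x ω) := by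
  have hl : 0 < Real.log 2 := Real.log_pos one_lt_two
  have key : ∀ ω, (p ω - p ω / x ω) / Real.log 2 ≤ p ω * Real.logb 2 (x ω) := by
    intro ω
    rcases (hp ω).eq_or_lt with h0 | h0
    · simp [← h0]
    · have := Real.one_sub_inv_le_log_of_pos (hx ω h0)
      rw [Real.logb, ← mul_div_assoc]
      gcongr
      rw [div_eq_mul_inv]
      nlinarith
  calc (0 : ℝ) ≤ (∑ ω, p ω - ∑ ω, p ω / x ω) / Real.log 2 :=
        div_nonneg (sub_nonneg.2 h) hl.le
    _ = ∑ ω, (p ω - p ω / x ω) / Real.log 2 := by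
        rw [← Finset.sum_sub_distrib, Finset.sum_div]
    _ ≤ _ := Finset.sum_le_sum fun ω _ => key ω

theorem pr_nonneg {p : Ω → ℝ} (hp : ∀ ω, 0 ≤ p ω) (A : Ω → Prop) : 0 ≤ pr p A :=
  Finset.sum_nonneg fun ω _ => by split_ifs <;> simp [hp]

theorem le_pr {p : Ω → ℝ} (hp : ∀ ω, 0 ≤ p ω) {A : Ω → Prop} {ω : Ω} (h : A ω) :
    p ω ≤ pr p A := by
  classical
  have := Finset.single_le_sum (f := fun ω => if A ω then p ω else 0)
    (fun ω _ => by split_ifs <;> simp [hp]) (Finset.mem_univ ω)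
  simpa [pr, h] using this

theorem pr_congr {p : Ω → ℝ} {A B : Ω → Prop} (h : ∀ ω, A ω ↔ B ω) : pr p A = pr p B := by
  rw [funext fun ω => propext (h ω)]

/-- Writing entropy as an expectation over the sample space lets the four entropies in a conditional
mutual information be compared pointwise in one sum. -/
theorem entropy_eq_sum (p : Ω → ℝ) (U : Ω → α) :
    entropy p U = -∑ ω, p ω * Real.logb 2 (pr p fun ω' => U ω' = U ω) := by
  classical
  unfold entropy
  congr 1
  have : ∀ a, pr p (fun ω => U ω = a) * Real.logb 2 (pr p fun ω => U ω = a) =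
      ∑ ω, if U ω = a then p ω * Real.logb 2 (pr p fun ω' => U ω' = a) else 0 := by
    intro a
    generalize Real.logb 2 (pr p fun ω => U ω = a) = c
    rw [pr, Finset.sum_mul]
    refine Finset.sum_congr rfl fun ω _ => ?_
    split_ifs <;> simp
  simp only [this]
  rw [Finset.sum_comm]
  simp

theorem entropy_congr {Ω' : Type*} [Fintype Ω'] {p : Ω → ℝ} {p' : Ω' → ℝ} {U : Ω → α}
    {U' : Ω' → α} (h : ∀ a, pr p (fun ω => U ω = a) = pr p' fun ω => U' ω = a) :
    entropy p U = entropy p' U' := by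
  simp only [entropy, h]

theorem entropy_comp_injective (p : Ω → ℝ) (U : Ω → α) {f : α → β} (hf : Function.Injective f) :
    entropy p (fun ω => f (U ω)) = entropy p U := by
  simp only [entropy_eq_sum, hf.eq_iff]

theorem mutualInfo_eq_condMutualInfo_unit {p : Ω → ℝ} (hp : ∑ ω, p ω = 1) (U : Ω → α)
    (V : Ω → β) : mutualInfo p U V = condMutualInfo p U V fun _ => () := by
  have h0 : entropy p (fun _ => ()) = 0 := by
    simp [entropy, pr, hp]
  have h1 : entropy p (fun ω => (U ω, ())) = entropy p U :=
    entropy_comp_injective p U (f := fun a => (a, ())) fun a b h => by simpa using h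
  have h2 : entropy p (fun ω => (V ω, ())) = entropy p V :=
    entropy_comp_injective p V (f := fun a => (a, ())) fun a b h => by simpa using h
  have h3 : entropy p (fun ω => (U ω, V ω, ())) = entropy p (fun ω => (U ω, V ω)) :=
    entropy_comp_injective p (fun ω => (U ω, V ω)) (f := fun a => (a.1, a.2, ()))
      fun a b h => by simpa [Prod.ext_iff] using h
  rw [mutualInfo, condMutualInfo, h0, h1, h2, h3, sub_zero]

open Classical in
/-- The sum of `f` over the fibre of `m` through `w`. -/
def fiberSum {W ι : Type*} [Fintype W] (m : W → ι) (f : W → ℝ) (w : W) : ℝ :=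
  ∑ v, if m v = m w then f v else 0

theorem fiberSum_nonneg {W ι : Type*} [Fintype W] (m : W → ι) {f : W → ℝ} (hf : ∀ w, 0 ≤ f w)
    (w : W) : 0 ≤ fiberSum m f w :=
  Finset.sum_nonneg fun v _ => by split_ifs <;> simp [hf]

theorem le_fiberSum {W ι : Type*} [Fintype W] (m : W → ι) {f : W → ℝ} (hf : ∀ w, 0 ≤ f w)
    (w : W) : f w ≤ fiberSum m f w := by
  classical
  have := Finset.single_le_sum (f := fun v => if m v = m w then f v else 0)
    (fun ω _ => by split_ifs <;> simp [hf]) (Finset.mem_univ w)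
  simpa [fiberSum] using this

theorem fiberSum_div {W ι : Type*} [Fintype W] (m : W → ι) (f : W → ℝ) (c : ℝ)
    (w : W) : fiberSum m (fun v => f v / c) w = fiberSum m f w / c := by
  simp only [fiberSum, Finset.sum_div, ite_div, zero_div]

/-- Weighting each point by the ratio of a fibre sum of `h` to that of `f` does not increase
the mass of `h`. -/
theorem sum_mul_fiberSum_div_le {W ι : Type*} [Fintype W] (m : W → ι) {f h : W → ℝ}
    (hh : ∀ w, 0 ≤ h w) :
    ∑ w, f w * (fiberSum m h w / fiberSum m f w) ≤ ∑ w, h w := by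
  classical
  have e : ∀ w, f w * (fiberSum m h w / fiberSum m f w) =
      ∑ v, h v * (if m w = m v then f w / fiberSum m f v else 0) := by
    intro w
    conv_lhs => rw [fiberSum, Finset.sum_div, Finset.mul_sum]
    refine Finset.sum_congr rfl fun v _ => ?_
    by_cases hv : m v = m w
    · have : fiberSum m f w = fiberSum m f v := by simp only [fiberSum, hv]
      rw [if_pos hv, if_pos hv.symm, this]; ring
    · rw [if_neg hv, if_neg (Ne.symm hv)]; simp
  simp only [e]
  rw [Finset.sum_comm]
  refine Finset.sum_le_sum fun v _ => ?_
  rw [← Finset.mul_sum]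
  refine mul_le_of_le_one_right (hh v) ?_
  have : ∑ w, (if m w = m v then f w / fiberSum m f v else 0)
      = fiberSum m f v / fiberSum m f v :=
    fiberSum_div m f (fiberSum m f v) v
  rw [this]
  exact div_self_le_one _

/-- A lower bound on the conditional mutual information between the input and the output of a
channel, where the conditioning variable `C` is a function of the label `m`. -/
theorem condMutualInfo_ge {W ι : Type*} [Fintype W] {π : W → ℝ} {k : W → β → ℝ}
    (κ : α → γ → β → ℝ) (U : W → α) (C : W → γ) (m : W → ι) (hC : ∀ v w, m v = m w → C v = C w)
    (hk : ∀ w b, k w b = κ (U w) (C w) b) (hπ : ∀ w, 0 ≤ π w) (hk0 : ∀ w b, 0 ≤ k w b)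
    (hk1 : ∀ w, ∑ b, k w b = 1) :
    ∑ w, ∑ b, π w * k w b *
        Real.logb 2 (k w b * fiberSum m π w / fiberSum m (fun v => π v * k v b) w) ≤
      condMutualInfo (fun x : W × β => π x.1 * k x.1 x.2) (fun x => U x.1) (fun x => x.2)
        (fun x => C x.1) := by
  classical
  set μ : W × β → ℝ := fun x => π x.1 * k x.1 x.2 with hμ
  have hμ0 : ∀ x, 0 ≤ μ x := fun x => mul_nonneg (hπ _) (hk0 _ _)
  have hpr : ∀ (A : W → Prop) (b : β) , pr μ (fun x => A x.1 ∧ x.2 = b) =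
      ∑ w, if A w then π w * k w b else 0 := by
    intro A b
    rw [pr, Fintype.sum_prod_type]
    refine Finset.sum_congr rfl fun w _ => ?_
    by_cases hA : A w <;> simp [hA, hμ]
  have hpr1 : ∀ (A : W → Prop) , pr μ (fun x => A x.1) = ∑ w, if A w then π w else 0 := by
    intro A
    rw [pr, Fintype.sum_prod_type]
    refine Finset.sum_congr rfl fun w _ => ?_
    by_cases hA : A w <;> simp [hA, hμ, ← Finset.mul_sum, hk1]
  set pUC : W × β → ℝ := fun x => pr μ fun x' => (U x'.1, C x'.1) = (U x.1, C x.1)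
  set pVC : W × β → ℝ := fun x => pr μ fun x' => (x'.2, C x'.1) = (x.2, C x.1)
  set pUVC : W × β → ℝ :=
    fun x => pr μ fun x' => (U x'.1, x'.2, C x'.1) = (U x.1, x.2, C x.1)
  set pC : W × β → ℝ := fun x => pr μ fun x' => C x'.1 = C x.1
  -- The output depends on `w` only through `(U, C)`, so its law given `(U, C)` is the channel row
  -- itself.
  have e1 : ∀ x, pUVC x = k x.1 x.2 * pUC x := by
    intro x
    have h1 : pUVC x = pr μ (fun x' => (U x'.1 = U x.1 ∧ C x'.1 = C x.1) ∧ x'.2 = x.2) :=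
      pr_congr fun x' => by simp only [Prod.mk.injEq]; tauto
    have h2 : pUC x = pr μ (fun x' => (U x'.1 = U x.1 ∧ C x'.1 = C x.1)) :=
      pr_congr fun x' => by simp only [Prod.mk.injEq]
    rw [h1, h2, hpr (fun w => U w = U x.1 ∧ C w = C x.1),
      hpr1 (fun w => U w = U x.1 ∧ C w = C x.1), Finset.mul_sum]
    refine Finset.sum_congr rfl fun w _ => ?_
    split_ifs with h
    · rw [hk w, hk x.1, h.1, h.2, mul_comm]
    · simp
  have eVC : ∀ x, pVC x = fiberSum C (fun v => π v * k v x.2) x.1 := by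
    intro x
    have h1 : pVC x = pr μ (fun x' => (C x'.1 = C x.1) ∧ x'.2 = x.2) :=
      pr_congr fun x' => by simp only [Prod.mk.injEq]; tauto
    rw [h1, hpr (fun w => C w = C x.1), fiberSum]
  have eC : ∀ x, pC x = fiberSum C π x.1 := fun x => hpr1 (fun w => C w = C x.1)
  -- The logarithm is that of p(b | m) / p(b | C), so this is a conditional divergence. It is the
  -- amount by which the entropy of the output drops when the conditioning is refined from `C` to
  -- `m`, and exactly the gap in the claimed inequality.
  have hkey : 0 ≤ ∑ x, μ x * Real.logb 2
      (pC x * fiberSum m (fun v => π v * k v x.2) x.1 / (pVC x * fiberSum m π x.1)) := by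
    refine sum_mul_logb_nonneg hμ0 (fun x hx => ?_) ?_
    · have hπx : 0 < π x.1 := (hπ _).lt_of_ne fun h => by simp [hμ, ← h] at hx
      have a1 : 0 < pC x := hx.trans_le (le_pr hμ0 rfl)
      have a2 : 0 < pVC x := hx.trans_le (le_pr hμ0 rfl)
      have a3 := hx.trans_le (le_fiberSum m (f := fun v => π v * k v x.2)
        (fun v => mul_nonneg (hπ v) (hk0 v _)) x.1)
      have a4 := hπx.trans_le (le_fiberSum m hπ x.1)
      positivity
    · have s1 : ∑ x, μ x = ∑ w, π w := by
        rw [Fintype.sum_prod_type]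
        simp [hμ, ← Finset.mul_sum, hk1]
      have s2 : ∀ x, μ x / (pC x * fiberSum m (fun v => π v * k v x.2) x.1 /
          (pVC x * fiberSum m π x.1)) =
          μ x * (fiberSum m (fun v => π v * (fiberSum C (fun u => π u * k u x.2) v /
            fiberSum C π v)) x.1 / fiberSum m (fun v => π v * k v x.2) x.1) := by
        intro x
        have : fiberSum m (fun v => π v * (fiberSum C (fun u => π u * k u x.2) v /
            fiberSum C π v)) x.1 = fiberSum m π x.1 * (pVC x / pC x) := by
          rw [eVC, eC]
          unfold fiberSum
          rw [Finset.sum_mul]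
          refine Finset.sum_congr rfl fun v _ => ?_
          split_ifs with h
          · simp only [hC _ _ h]
          · simp
        rw [this, div_div_eq_mul_div, ← mul_div_assoc, ← mul_div_assoc,
          ← mul_div_assoc, div_div, mul_comm (fiberSum m π x.1)]
      rw [s1]
      simp only [s2]
      rw [Fintype.sum_prod_type_right]
      calc _ ≤ ∑ b, ∑ v, π v * (fiberSum C (fun u => π u * k u b) v / fiberSum C π v) := by
            refine Finset.sum_le_sum fun b _ => ?_
            have hb : ∀ v, 0 ≤ π v * k v b := fun v => mul_nonneg (hπ v) (hk0 v _)
            exact sum_mul_fiberSum_div_le m (f := fun v => π v * k v b)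
              (h := fun v => π v * (fiberSum C (fun u => π u * k u b) v / fiberSum C π v))
              fun v => mul_nonneg (hπ v)
                (div_nonneg (fiberSum_nonneg C hb v) (fiberSum_nonneg C hπ v))
        _ = ∑ v, π v * (fiberSum C π v / fiberSum C π v) := by
            rw [Finset.sum_comm]
            refine Finset.sum_congr rfl fun v _ => ?_
            rw [← Finset.mul_sum, ← Finset.sum_div]
            congr 2
            unfold fiberSum
            rw [Finset.sum_comm]
            refine Finset.sum_congr rfl fun u _ => ?_
            split_ifs
            · rw [← Finset.mul_sum, hk1, mul_one]
            · simp
        _ ≤ _ := Finset.sum_le_sum fun v _ =>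
            mul_le_of_le_one_right (hπ v) (div_self_le_one _)
  have e2 : condMutualInfo μ (fun x => U x.1) (fun x => x.2) (fun x => C x.1) =
      ∑ x, μ x * Real.logb 2 (k x.1 x.2 * fiberSum m π x.1 /
        fiberSum m (fun v => π v * k v x.2) x.1) + ∑ x, μ x * Real.logb 2
      (pC x * fiberSum m (fun v => π v * k v x.2) x.1 / (pVC x * fiberSum m π x.1)) := by
    rw [condMutualInfo, entropy_eq_sum, entropy_eq_sum, entropy_eq_sum, entropy_eq_sum]
    change -∑ x, μ x * Real.logb 2 (pUC x) + -∑ x, μ x * Real.logb 2 (pVC x) -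
      -∑ x, μ x * Real.logb 2 (pUVC x) - -∑ x, μ x * Real.logb 2 (pC x) = _
    rw [← sub_eq_zero]
    simp only [← Finset.sum_neg_distrib, ← Finset.sum_add_distrib, ← Finset.sum_sub_distrib]
    refine Finset.sum_eq_zero fun x _ => ?_
    rcases (hμ0 x).eq_or_lt with h0 | hx
    · simp [← h0]
    · have hπx : 0 < π x.1 := (hπ _).lt_of_ne fun h => by simp [hμ, ← h] at hx
      have hkx : 0 < k x.1 x.2 := (hk0 _ _).lt_of_ne fun h => by simp [hμ, ← h] at hx
      have a1 : 0 < pC x := hx.trans_le (le_pr hμ0 rfl)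
      have a2 : 0 < pVC x := hx.trans_le (le_pr hμ0 rfl)
      have a5 : 0 < pUC x := hx.trans_le (le_pr hμ0 rfl)
      have a3 := hx.trans_le (le_fiberSum m (f := fun v => π v * k v x.2)
        (fun v => mul_nonneg (hπ v) (hk0 v _)) x.1)
      have a4 := hπx.trans_le (le_fiberSum m hπ x.1)
      rw [e1, Real.logb_div (by positivity) (by positivity),
        Real.logb_div (by positivity) (by positivity), Real.logb_mul hkx.ne' a5.ne',
        Real.logb_mul hkx.ne' a4.ne', Real.logb_mul a1.ne' a3.ne', Real.logb_mul a2.ne' a4.ne']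
      ring
  rw [e2, Fintype.sum_prod_type]
  exact le_add_of_nonneg_right hkey

end Probability

/-! ### Stopping rules -/

/-- The first `t` terms of `y` and `y'` coincide. -/
def Agree {Y : Type*} {L : ℕ} (t : ℕ) (y y' : Fin L → Y) : Prop :=
  ∀ i : Fin L, (i : ℕ) < t → y i = y' i

/-- Whether `S` has occurred is determined by the terms seen up to then. -/
def IsStopRule {Y : Type*} {L : ℕ} (S : (Fin L → Y) → ℕ) : Prop :=
  ∀ y y', Agree (S y) y y' → S y' = S y

section Agree

variable {Y : Type*} {L : ℕ}

theorem Agree.symm {t : ℕ} {y y' : Fin L → Y} (h : Agree t y y') : Agree t y' y :=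
  fun i hi => (h i hi).symm

theorem Agree.mono {s t : ℕ} (hst : s ≤ t) {y y' : Fin L → Y} (h : Agree t y y') :
    Agree s y y' :=
  fun i hi => h i (hi.trans_le hst)

theorem agree_update [DecidableEq (Fin L)] (r : Fin L) (y : Fin L → Y) (b : Y) :
    Agree r y (Function.update y r b) := fun i hi => by
  rw [Function.update_of_ne]
  rintro rfl
  exact lt_irrefl _ hi

theorem IsStopRule.le_iff {S : (Fin L → Y) → ℕ} (hS : IsStopRule S) {t : ℕ} {y y' : Fin L → Y}
    (h : Agree t y y') : S y ≤ t ↔ S y' ≤ t := by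
  constructor
  · intro hy; rw [hS y y' (h.mono hy)]; exact hy
  · intro hy; rw [hS y' y (h.symm.mono hy)]; exact hy

/-- Galmarino's test: the event `S ≤ S y` is the preimage of a set of prefixes of length `S y`, so a
sequence with the same prefix belongs to it as well. -/
theorem IsStop.isStopRule {S : (Fin L → Y) → ℕ} (hS : IsStop S) : IsStopRule S := by
  have key : ∀ y y' : Fin L → Y, Agree (S y) y y' → S y' ≤ S y := by
    intro y y' h
    obtain ⟨B, -, hB⟩ := hS.stopping (S y)
    have e : (fun i : {i : Fin L // (i : ℕ) < S y} => y i) =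
        fun i : {i : Fin L // (i : ℕ) < S y} => y' i := funext fun i => h i.1 i.2
    have hmem : ∀ z : Fin L → Y, (fun i : {i : Fin L // (i : ℕ) < S y} => z i) ∈ B ↔
        S z ≤ S y := fun z => (Set.ext_iff.1 hB z).trans WithTop.coe_le_coe
    exact (hmem y').1 (e ▸ (hmem y).2 le_rfl)
  intro y y' h
  have h1 := key y y' h
  exact le_antisymm h1 (key y' y (h.symm.mono h1))

theorem IsStopRule.isStop {S : (Fin L → Y) → ℕ} (hS : IsStopRule S) (h1 : ∀ y, 1 ≤ S y) :
    IsStop S := by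
  refine ⟨h1, fun t => ?_⟩
  refine ⟨(fun (y : Fin L → Y) (i : {i : Fin L // (i : ℕ) < t}) => y i) '' {y | S y ≤ t},
    trivial, ?_⟩
  ext y
  simp only [Set.mem_preimage, Set.mem_image, Set.mem_ofPred_eq]
  constructor
  · rintro ⟨y', hy', e⟩
    exact WithTop.coe_le_coe.2 ((hS.le_iff (t := t) fun i hi => congrFun e ⟨i, hi⟩).1 hy')
  · intro hy
    exact ⟨y, WithTop.coe_le_coe.1 hy, rfl⟩

theorem past_eq_past_iff {r : ℕ} (hr : r ≤ L) (y y' : Fin L → Y) :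
    past y r hr = past y' r hr ↔ Agree r y y' := by
  constructor
  · intro h i hi
    exact congrFun h ⟨i, hi⟩
  · intro h
    funext i
    exact h _ i.2

end Agree

/-! ### Channels with feedback, used with a uniform message -/

/-- The transition probabilities of the output at each time, given the message and the past
outputs. -/
structure FeedbackKernel (W Y : Type*) [Fintype Y] (L : ℕ) where
  k : W → Fin L → (Fin L → Y) → Y → ℝ
  nonneg : ∀ w r y b, 0 ≤ k w r y b
  sum_eq_one : ∀ w r y, ∑ b, k w r y b = 1
  predictable : ∀ w (r : Fin L) y y', Agree r y y' → k w r y = k w r y'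

/-- Exchanging the letter at `r` with the free letter is an involution of the pairs (sequence,
letter). -/
theorem sum_update {Y : Type*} [Fintype Y] {L : ℕ} (r : Fin L) (F : (Fin L → Y) → ℝ) :
    ∑ y, ∑ b, F (Function.update y r b) = Fintype.card Y * ∑ y, F y := by
  classical
  let e : (Fin L → Y) × Y → (Fin L → Y) × Y := fun x => (Function.update x.1 r x.2, x.1 r)
  have he : Function.Involutive e := fun x => by simp [e]
  calc ∑ y, ∑ b, F (Function.update y r b) = ∑ x : (Fin L → Y) × Y, F (e x).1 := by
        rw [Fintype.sum_prod_type]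
    _ = ∑ x : (Fin L → Y) × Y, F x.1 :=
        Equiv.sum_comp (he.toPerm e) (fun x : (Fin L → Y) × Y => F x.1)
    _ = _ := by
        rw [Fintype.sum_prod_type]
        simp [Finset.mul_sum]

theorem sum_ite_sub_eq {L S T : ℕ} (hST : S ≤ T) (hT : T ≤ L) (f : ℕ → ℝ) :
    (∑ r : Fin L, if S ≤ (r : ℕ) ∧ (r : ℕ) < T then f (r + 1) - f r else 0) = f T - f S := by
  rw [Fin.sum_univ_eq_sum_range (fun r => if S ≤ r ∧ r < T then f (r + 1) - f r else 0),
    ← Finset.sum_filter]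
  have : (Finset.range L).filter (fun r => S ≤ r ∧ r < T) = Finset.Ico S T := by
    ext r; simp only [Finset.mem_filter, Finset.mem_range, Finset.mem_Ico]; omega
  rw [this, Finset.sum_Ico_eq_sub _ hST, Finset.sum_range_sub, Finset.sum_range_sub]
  ring

namespace FeedbackKernel

variable {W Y : Type*} [Fintype Y] {L : ℕ} (K : FeedbackKernel W Y L)

/-- The likelihood of the first `t` outputs. -/
def lk (t : ℕ) (w : W) (y : Fin L → Y) : ℝ :=
  ∏ s : Fin L, if (s : ℕ) < t then K.k w s y (y s) else 1

theorem lk_nonneg (t : ℕ) (w : W) (y : Fin L → Y) : 0 ≤ K.lk t w y :=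
  Finset.prod_nonneg fun s _ => by split_ifs <;> simp [K.nonneg]

@[simp] theorem lk_zero (w : W) (y : Fin L → Y) : K.lk 0 w y = 1 := by simp [lk]

theorem lk_succ (r : Fin L) (w : W) (y : Fin L → Y) :
    K.lk (r + 1) w y = K.lk r w y * K.k w r y (y r) := by
  classical
  have : K.k w r y (y r) = ∏ s : Fin L, if s = r then K.k w s y (y s) else 1 := by simp
  rw [this, lk, lk, ← Finset.prod_mul_distrib]
  refine Finset.prod_congr rfl fun s _ => ?_
  rcases lt_trichotomy s r with h | h | h
  · have h' : (s : ℕ) < r := h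
    simp [h', h'.trans (Nat.lt_succ_self _), h.ne]
  · subst h; simp
  · have h' : (r : ℕ) < s := h
    simp [h'.not_gt, h.ne', h'.not_ge]

theorem lk_congr {t : ℕ} {y y' : Fin L → Y} (h : Agree t y y') (w : W) :
    K.lk t w y = K.lk t w y' := by
  refine Finset.prod_congr rfl fun s _ => ?_
  split_ifs with hs
  · rw [K.predictable w s y y' (h.mono hs.le), h s hs]
  · rfl

theorem lk_succ_update (r : Fin L) (w : W) (y : Fin L → Y) (b : Y) :
    K.lk (r + 1) w (Function.update y r b) = K.lk r w y * K.k w r y b := by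
  rw [lk_succ, ← K.lk_congr (agree_update r y b), ← K.predictable w r _ _ (agree_update r y b),
    Function.update_self]

theorem k_pos_of_lk_pos {t : ℕ} {w : W} {y : Fin L → Y} (h : 0 < K.lk t w y) {s : Fin L}
    (hs : (s : ℕ) < t) : 0 < K.k w s y (y s) := by
  refine (K.nonneg _ _ _ _).lt_of_ne' ?_
  have := Finset.prod_ne_zero_iff.1 h.ne' s (Finset.mem_univ s)
  simpa [hs] using this

theorem lk_pos_of_le {t T : ℕ} (htT : t ≤ T) {w : W} {y : Fin L → Y} (h : 0 < K.lk T w y) :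
    0 < K.lk t w y := by
  refine Finset.prod_pos fun s _ => ?_
  split_ifs with hs
  · exact K.k_pos_of_lk_pos h (hs.trans_le htT)
  · exact one_pos

theorem k_le_one (w : W) (r : Fin L) (y : Fin L → Y) (b : Y) : K.k w r y b ≤ 1 := by
  rw [← K.sum_eq_one w r y]
  exact Finset.single_le_sum (fun b _ => K.nonneg w r y b) (Finset.mem_univ b)

theorem lk_le_one (t : ℕ) (w : W) (y : Fin L → Y) : K.lk t w y ≤ 1 := by
  refine Finset.prod_le_one (fun s _ => ?_) fun s _ => ?_
  · split_ifs <;> simp [K.nonneg]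
  · split_ifs <;> simp [K.k_le_one]

/-- The mass, under the uniform law, of a string of length `t`. -/
def cyl (_K : FeedbackKernel W Y L) (t : ℕ) : ℝ :=
  (Fintype.card Y : ℝ) ^ t / (Fintype.card Y : ℝ) ^ L

theorem cyl_nonneg (t : ℕ) : 0 ≤ K.cyl t := by unfold cyl; positivity

theorem cyl_succ_mul_sum (r : Fin L) (w : W) (G : (Fin L → Y) → ℝ) :
    K.cyl (r + 1) * ∑ y, K.lk (r + 1) w y * G y =
      K.cyl r * ∑ y, K.lk r w y * ∑ b, K.k w r y b * G (Function.update y r b) := by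
  rw [cyl, cyl, pow_succ, mul_div_right_comm, mul_assoc, ← sum_update r]
  congr 1
  refine Finset.sum_congr rfl fun y _ => ?_
  rw [Finset.mul_sum]
  refine Finset.sum_congr rfl fun b _ => ?_
  rw [lk_succ_update, mul_assoc]

/-- Each string of length `t` has `1 / cyl t` extensions to length `L`, so the left side is a sum
over strings of length `t`. The later outputs are summed out one at a time, starting from the last.
-/
theorem cyl_mul_sum [Nonempty Y] {t : ℕ} (ht : t ≤ L) (w : W) (G : (Fin L → Y) → ℝ)
    (hG : ∀ y y', Agree t y y' → G y = G y') :
    K.cyl t * ∑ y, K.lk t w y * G y = ∑ y, K.lk L w y * G y := by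
  induction ht using Nat.decreasingInduction with
  | self =>
    rw [cyl, div_self (by positivity), one_mul]
  | of_succ t ht ih =>
    have h1 := K.cyl_succ_mul_sum ⟨t, ht⟩ w G
    rw [← ih fun y y' h => hG y y' (h.mono t.le_succ)]
    refine Eq.trans ?_ h1.symm
    congr 1
    refine Finset.sum_congr rfl fun y _ => ?_
    have : ∀ b, G (Function.update y ⟨t, ht⟩ b) = G y := fun b =>
      (hG _ _ (agree_update ⟨t, ht⟩ y b)).symm
    simp only [this, ← Finset.sum_mul, K.sum_eq_one, one_mul]

/-- The tower property: the output at `r` may be redrawn from its law given the message and the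
past. -/
theorem sum_lk_step [Nonempty Y] (r : Fin L) (w : W) (G : (Fin L → Y) → ℝ)
    (hG : ∀ y y', Agree (r + 1) y y' → G y = G y') :
    ∑ y, K.lk L w y * G y =
      ∑ y, K.lk L w y * ∑ b, K.k w r y b * G (Function.update y r b) := by
  rw [← K.cyl_mul_sum (Nat.succ_le_of_lt r.2) w G hG, ← K.cyl_mul_sum r.2.le,
    K.cyl_succ_mul_sum r w G]
  intro y y' h
  refine Finset.sum_congr rfl fun b _ => ?_
  rw [K.predictable w r y y' h]
  congr 1
  refine hG _ _ fun i hi => ?_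
  by_cases hir : i = r
  · subst hir; simp
  · rw [Function.update_of_ne hir, Function.update_of_ne hir]
    refine h i (lt_of_le_of_ne (Nat.lt_succ_iff.1 hi) fun h => hir (Fin.ext h))

/-- Split according to the value of `S`: both the event `S y = t` and `G` on it depend on the first
`t` outputs only, so `cyl_mul_sum` applies to each piece. -/
theorem sum_lk_stopped [Nonempty Y] {S : (Fin L → Y) → ℕ} (hS : IsStopRule S)
    (hSL : ∀ y, S y ≤ L) (w : W) (G : (Fin L → Y) → ℝ)
    (hG : ∀ y y', Agree (S y) y y' → G y = G y') :
    ∑ y, K.lk L w y * G y = ∑ y, K.cyl (S y) * (K.lk (S y) w y * G y) := by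
  classical
  have split : ∀ (F : ℕ → (Fin L → Y) → ℝ), ∑ y, F (S y) y =
      ∑ t ∈ Finset.range (L + 1), ∑ y, if S y = t then F t y else 0 := by
    intro F
    rw [Finset.sum_comm]
    refine Finset.sum_congr rfl fun y _ => ?_
    rw [Finset.sum_ite_eq, if_pos (Finset.mem_range.2 (Nat.lt_succ_of_le (hSL y)))]
  rw [split fun _ y => K.lk L w y * G y, split fun t y => K.cyl t * (K.lk t w y * G y)]
  refine Finset.sum_congr rfl fun t ht => ?_
  have := K.cyl_mul_sum (Nat.lt_succ_iff.1 (Finset.mem_range.1 ht)) w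
    (fun y => if S y = t then G y else 0) ?_
  · simp only [mul_ite, mul_zero] at this
    rw [← this, Finset.mul_sum]
    simp only [mul_ite, mul_zero]
  · intro y y' h
    have : S y = t ↔ S y' = t := by
      constructor
      · intro e; rw [hS y y' (e ▸ h), e]
      · intro e; rw [hS y' y (e ▸ h.symm), e]
    by_cases e : S y = t
    · rw [if_pos e, if_pos (this.1 e)]
      exact hG y y' (e ▸ h)
    · rw [if_neg e, if_neg (fun h => e (this.2 h))]

theorem sum_lk [Nonempty Y] (w : W) : ∑ y, K.lk L w y = 1 := by
  have := K.cyl_mul_sum (Nat.zero_le L) w (fun _ => 1) (fun _ _ _ => rfl)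
  simp only [mul_one] at this
  rw [← this]
  simp [cyl]

variable [Fintype W]

/-- The joint law of a uniform message and of the outputs. -/
def law (ω : W × (Fin L → Y)) : ℝ := (Fintype.card W : ℝ)⁻¹ * K.lk L ω.1 ω.2

theorem law_nonneg (ω : W × (Fin L → Y)) : 0 ≤ K.law ω :=
  mul_nonneg (by positivity) (K.lk_nonneg _ _ _)

theorem lk_pos_of_law_pos {ω : W × (Fin L → Y)} (h : 0 < K.law ω) : 0 < K.lk L ω.1 ω.2 :=
  (K.lk_nonneg _ _ _).lt_of_ne' fun h0 => by simp [law, h0] at h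

theorem expect_law (G : W → (Fin L → Y) → ℝ) :
    expect K.law (fun ω => G ω.1 ω.2) =
      (Fintype.card W : ℝ)⁻¹ * ∑ w, ∑ y, K.lk L w y * G w y := by
  simp only [expect, law, Fintype.sum_prod_type, Finset.mul_sum, mul_assoc]

theorem sum_law [Nonempty Y] [Nonempty W] : ∑ ω, K.law ω = 1 := by
  have := K.expect_law fun _ _ => 1
  simp only [expect, mul_one, sum_lk] at this
  rw [this]; simp

theorem expect_law_step [Nonempty Y] (r : Fin L) (G : W → (Fin L → Y) → ℝ)
    (hG : ∀ w y y', Agree (r + 1) y y' → G w y = G w y') :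
    expect K.law (fun ω => G ω.1 ω.2) = expect K.law fun ω =>
      ∑ b, K.k ω.1 r ω.2 b * G ω.1 (Function.update ω.2 r b) := by
  rw [expect_law, K.expect_law fun w y => ∑ b, K.k w r y b * G w (Function.update y r b)]
  congr 1
  exact Finset.sum_congr rfl fun w _ => K.sum_lk_step r w (G w) (hG w)

theorem expect_law_stopped [Nonempty Y] {S : (Fin L → Y) → ℕ} (hS : IsStopRule S)
    (hSL : ∀ y, S y ≤ L) (G : W → (Fin L → Y) → ℝ)
    (hG : ∀ w y y', Agree (S y) y y' → G w y = G w y') :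
    expect K.law (fun ω => G ω.1 ω.2) = (Fintype.card W : ℝ)⁻¹ *
      ∑ y, K.cyl (S y) * ∑ w, K.lk (S y) w y * G w y := by
  rw [expect_law]
  congr 1
  simp only [Finset.mul_sum]
  refine Eq.trans (Finset.sum_congr rfl fun w _ => K.sum_lk_stopped hS hSL w (G w) (hG w)) ?_
  rw [Finset.sum_comm]

/-- This plays the role of conditioning on the outputs up to `S`: it suffices to compare `G` and `H`
under the unnormalised posterior law of the message at that time. -/
theorem expect_law_le_of_stopped [Nonempty Y] {S : (Fin L → Y) → ℕ} (hS : IsStopRule S)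
    (hSL : ∀ y, S y ≤ L) (G H : W → (Fin L → Y) → ℝ)
    (hG : ∀ w y y', Agree (S y) y y' → G w y = G w y')
    (hH : ∀ w y y', Agree (S y) y y' → H w y = H w y')
    (h : ∀ y, ∑ w, K.lk (S y) w y * G w y ≤ ∑ w, K.lk (S y) w y * H w y) :
    expect K.law (fun ω => G ω.1 ω.2) ≤ expect K.law fun ω => H ω.1 ω.2 := by
  rw [K.expect_law_stopped hS hSL G hG, K.expect_law_stopped hS hSL H hH]
  exact mul_le_mul_of_nonneg_left (Finset.sum_le_sum fun y _ =>
    mul_le_mul_of_nonneg_left (h y) (K.cyl_nonneg _)) (by positivity)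

end FeedbackKernel

/-! ### The converse: drift of the log-likelihood ratio and Fano's inequality -/

/-- The quantity `-log (1 - posterior)` of a message increases on average by at most the largest
divergence between two transition laws. -/
theorem sum_mul_logb_drift_le {W Y : Type*} [Fintype W] [Fintype Y] {a : W → ℝ}
    {k : W → Y → ℝ} {D : ℝ} (ha : ∀ v, 0 < a v) (hk0 : ∀ v b, 0 ≤ k v b)
    (hk1 : ∀ v, ∑ b, k v b = 1) (hsupp : ∀ v v' b, 0 < k v b → 0 < k v' b) (w : W)
    (hw : ∃ v, v ≠ w) (hD : ∀ v, ∑ b, k w b * Real.logb 2 (k w b / k v b) ≤ D) :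
    ∑ b, k w b * (Real.logb 2 ((∑ v, a v * k v b) / ((∑ v, a v * k v b) - a w * k w b)) -
      Real.logb 2 ((∑ v, a v) / ((∑ v, a v) - a w))) ≤ D := by
  classical
  obtain ⟨u, hu⟩ := hw
  -- The weights of the wrong messages; their total `R` is what is left after removing `a w` from
  -- `Z`.
  set p : W → ℝ := fun v => if v = w then 0 else a v with hp
  have hp0 : ∀ v, 0 ≤ p v := fun v => by
    simp only [hp]; split_ifs
    · exact le_rfl
    · exact (ha v).le
  set R := ∑ v, p v with hR
  set Z := ∑ v, a v with hZ
  have hsplit : ∀ f : W → ℝ, ∑ v, p v * f v = ∑ v, a v * f v - a w * f w := by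
    intro f
    rw [eq_sub_iff_add_eq, ← Finset.sum_erase_add _ _ (Finset.mem_univ w),
      ← Finset.sum_erase_add (Finset.univ) (fun v => a v * f v) (Finset.mem_univ w)]
    simp only [hp, if_true, zero_mul, add_zero]
    congr 1
    refine Finset.sum_congr rfl fun v hv => ?_
    rw [if_neg (Finset.ne_of_mem_erase hv)]
  have hRZ : Z - a w = R := by simpa using (hsplit fun _ => 1).symm
  have hRpos : 0 < R := by
    have := Finset.single_le_sum (f := p) (fun v _ => hp0 v) (Finset.mem_univ u)
    refine lt_of_lt_of_le ?_ this
    simp [hp, hu, ha]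
  have hZpos : 0 < Z := by linarith [ha w]
  have hm1 : ∑ b, ∑ v, a v * k v b = Z := by
    rw [Finset.sum_comm]
    simp [← Finset.mul_sum, hk1, hZ]
  have hG : 0 ≤ ∑ b, k w b * Real.logb 2 (k w b / ((∑ v, a v * k v b) / Z)) := by
    refine sum_mul_logb_nonneg (hk0 w) (fun b hb => ?_) ?_
    · have : 0 < ∑ v, a v * k v b :=
        Finset.sum_pos (fun v _ => mul_pos (ha v) (hsupp w v b hb)) ⟨w, Finset.mem_univ w⟩
      positivity
    · calc _ ≤ ∑ b, (∑ v, a v * k v b) / Z := by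
            refine Finset.sum_le_sum fun b _ => ?_
            have hnn : 0 ≤ (∑ v, a v * k v b) / Z :=
              div_nonneg (Finset.sum_nonneg fun v _ => mul_nonneg (ha v).le (hk0 v b)) hZpos.le
            rw [div_div_eq_mul_div, mul_comm, mul_div_assoc]
            exact mul_le_of_le_one_right hnn (div_self_le_one _)
        _ = 1 := by rw [← Finset.sum_div, hm1, div_self hZpos.ne']
        _ = _ := (hk1 w).symm
  -- Summed over `b`, the left side is the divergence of `k w` from the mixture of the wrong rows
  -- minus its divergence from the mixture of all rows. Convexity (`hJ` below) bounds the first by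
  -- the average of the divergences from single rows; the second is nonnegative by `hG` and can be
  -- dropped.
  have hb : ∀ b, k w b * (Real.logb 2 ((∑ v, a v * k v b) / ((∑ v, a v * k v b) - a w * k w b)) -
      Real.logb 2 (Z / (Z - a w))) ≤
      ∑ v, p v / R * (k w b * Real.logb 2 (k w b / k v b)) -
        k w b * Real.logb 2 (k w b / ((∑ v, a v * k v b) / Z)) := by
    intro b
    rcases (hk0 w b).eq_or_lt with h0 | h0
    · simp [← h0]
    have hkp : ∀ v, 0 < k v b := fun v => hsupp w v b h0
    have hm : 0 < ∑ v, a v * k v b :=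
      Finset.sum_pos (fun v _ => mul_pos (ha v) (hkp v)) ⟨w, Finset.mem_univ w⟩
    rw [hRZ, ← hsplit fun v => k v b]
    set r := ∑ v, p v * k v b with hr
    have hrpos : 0 < r := by
      have := Finset.single_le_sum (f := fun v => p v * k v b)
        (fun v _ => mul_nonneg (hp0 v) (hkp v).le) (Finset.mem_univ u)
      refine lt_of_lt_of_le ?_ this
      simp [hp, hu, ha, hkp]
    have hJ : 0 ≤ ∑ v, p v / R * Real.logb 2 (r / (R * k v b)) := by
      refine sum_mul_logb_nonneg (fun v => div_nonneg (hp0 v) hRpos.le)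
        (fun v _ => div_pos hrpos (mul_pos hRpos (hkp v))) (le_of_eq ?_)
      have : ∀ v, p v / R / (r / (R * k v b)) = p v * k v b / r := fun v => by
        have := (hkp v).ne'
        field_simp
      simp only [this]
      rw [← Finset.sum_div, ← Finset.sum_div, ← hr, ← hR, div_self hrpos.ne',
        div_self hRpos.ne']
    have hJ' : ∑ v, p v / R * Real.logb 2 (r / (R * k v b)) =
        ∑ v, p v / R * Real.logb 2 (k w b / k v b) - (Real.logb 2 (k w b) - Real.logb 2 r +
          Real.logb 2 R) := by
      have : ∀ v, p v / R * Real.logb 2 (r / (R * k v b)) =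
          p v / R * Real.logb 2 (k w b / k v b) - p v / R * (Real.logb 2 (k w b) -
          Real.logb 2 r + Real.logb 2 R) := fun v => by
        rw [Real.logb_div hrpos.ne' (mul_pos hRpos (hkp v)).ne', Real.logb_div h0.ne' (hkp v).ne',
          Real.logb_mul hRpos.ne' (hkp v).ne']
        ring
      simp only [this]
      rw [Finset.sum_sub_distrib, ← Finset.sum_mul, ← Finset.sum_div, ← hR, div_self hRpos.ne',
        one_mul]
    rw [hJ'] at hJ
    have e : ∑ v, p v / R * (k w b * Real.logb 2 (k w b / k v b)) =
        k w b * ∑ v, p v / R * Real.logb 2 (k w b / k v b) := by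
      rw [Finset.mul_sum]
      exact Finset.sum_congr rfl fun v _ => by ring
    rw [e, ← mul_sub, Real.logb_div h0.ne' (div_pos hm hZpos).ne', Real.logb_div hm.ne' hZpos.ne',
      Real.logb_div hm.ne' hrpos.ne', Real.logb_div hZpos.ne' hRpos.ne']
    refine mul_le_mul_of_nonneg_left ?_ h0.le
    linarith
  calc _ ≤ ∑ b, (∑ v, p v / R * (k w b * Real.logb 2 (k w b / k v b)) -
        k w b * Real.logb 2 (k w b / ((∑ v, a v * k v b) / Z))) := Finset.sum_le_sum fun b _ => hb b
    _ ≤ ∑ b, ∑ v, p v / R * (k w b * Real.logb 2 (k w b / k v b)) := by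
        rw [Finset.sum_sub_distrib]; linarith
    _ = ∑ v, p v / R * ∑ b, (k w b * Real.logb 2 (k w b / k v b)) := by
        rw [Finset.sum_comm]
        simp only [Finset.mul_sum]
    _ ≤ ∑ v, p v / R * D := Finset.sum_le_sum fun v _ =>
        mul_le_mul_of_nonneg_left (hD v) (div_nonneg (hp0 v) hRpos.le)
    _ = D := by rw [← Finset.sum_mul, ← Finset.sum_div, ← hR, div_self hRpos.ne', one_mul]

/-! ### Expectations under finite laws -/

section Expect

variable {Ω : Type*} [Fintype Ω] {p : Ω → ℝ}

theorem expect_mono (hp : ∀ ω, 0 ≤ p ω) {f g : Ω → ℝ} (h : ∀ ω, 0 < p ω → f ω ≤ g ω) :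
    expect p f ≤ expect p g := by
  refine Finset.sum_le_sum fun ω _ => ?_
  rcases (hp ω).eq_or_lt with h0 | h0
  · simp [← h0]
  · exact mul_le_mul_of_nonneg_left (h ω h0) h0.le

theorem expect_congr (hp : ∀ ω, 0 ≤ p ω) {f g : Ω → ℝ} (h : ∀ ω, 0 < p ω → f ω = g ω) :
    expect p f = expect p g :=
  le_antisymm (expect_mono hp fun ω hω => (h ω hω).le) (expect_mono hp fun ω hω => (h ω hω).ge)

theorem expect_add (f g : Ω → ℝ) : expect p (fun ω => f ω + g ω) = expect p f + expect p g := by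
  simp only [expect, mul_add, Finset.sum_add_distrib]

theorem expect_sub (f g : Ω → ℝ) : expect p (fun ω => f ω - g ω) = expect p f - expect p g := by
  simp only [expect, mul_sub, Finset.sum_sub_distrib]

theorem expect_mul_const (f : Ω → ℝ) (c : ℝ) :
    expect p (fun ω => f ω * c) = expect p f * c := by
  simp only [expect, Finset.sum_mul, mul_assoc]

theorem expect_const (hp : ∑ ω, p ω = 1) (c : ℝ) : expect p (fun _ => c) = c := by
  rw [expect, ← Finset.sum_mul, hp, one_mul]

theorem expect_sum {ι : Type*} (s : Finset ι) (f : ι → Ω → ℝ) :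
    expect p (fun ω => ∑ i ∈ s, f i ω) = ∑ i ∈ s, expect p (f i) := by
  simp only [expect, Finset.mul_sum]
  exact Finset.sum_comm

theorem pr_eq_expect (A : Ω → Prop) [DecidablePred A] :
    pr p A = expect p fun ω => if A ω then 1 else 0 := by
  refine Finset.sum_congr rfl fun ω _ => ?_
  by_cases h : A ω <;> simp [h]

end Expect

/-! ### Posterior odds of the message and Fano's inequality at stopping times -/

namespace FeedbackKernel

variable {W Y : Type*} [Fintype Y] {L : ℕ} (K : FeedbackKernel W Y L)

/-- All transition probabilities of an output are zero, or all are at least `lam`. -/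
def UniformSupport (lam : ℝ) : Prop := ∀ w v r y b, 0 < K.k w r y b → lam ≤ K.k v r y b

variable {K}

theorem UniformSupport.lk_pos {lam : ℝ} (hs : K.UniformSupport lam) (hl : 0 < lam) {t : ℕ} {w : W}
    {y : Fin L → Y} (h : 0 < K.lk t w y) (v : W) : 0 < K.lk t v y := by
  refine Finset.prod_pos fun s _ => ?_
  split_ifs with hst
  · exact hl.trans_le (hs w v s y _ (K.k_pos_of_lk_pos h hst))
  · exact one_pos

theorem UniformSupport.pow_le_lk {lam : ℝ} (hs : K.UniformSupport lam) (hl : 0 < lam) {w : W}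
    {y : Fin L → Y} (h : 0 < K.lk L w y) (v : W) {t : ℕ} (ht : t ≤ L) :
    lam ^ t ≤ K.lk t v y := by
  induction t with
  | zero => simp
  | succ t ih =>
    rw [K.lk_succ ⟨t, ht⟩, pow_succ]
    exact mul_le_mul (ih (Nat.le_of_succ_le ht))
      (hs w v _ y _ (K.k_pos_of_lk_pos h ht)) hl.le (K.lk_nonneg _ _ _)

variable (K) [Fintype W]

/-- The sum of the likelihoods of all messages. -/
def totalLk (t : ℕ) (y : Fin L → Y) : ℝ := ∑ w, K.lk t w y

theorem totalLk_congr {t : ℕ} {y y' : Fin L → Y} (h : Agree t y y') :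
    K.totalLk t y = K.totalLk t y' :=
  Finset.sum_congr rfl fun w _ => K.lk_congr h w

theorem lk_le_totalLk (t : ℕ) (w : W) (y : Fin L → Y) : K.lk t w y ≤ K.totalLk t y :=
  Finset.single_le_sum (fun v _ => K.lk_nonneg t v y) (Finset.mem_univ w)

/-- Minus the logarithm of the posterior probability that `w` is not the message. -/
def logOdds (t : ℕ) (w : W) (y : Fin L → Y) : ℝ :=
  Real.logb 2 (K.totalLk t y / (K.totalLk t y - K.lk t w y))

theorem logOdds_congr {t : ℕ} {y y' : Fin L → Y} (h : Agree t y y') (w : W) :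
    K.logOdds t w y = K.logOdds t w y' := by
  rw [logOdds, logOdds, K.totalLk_congr h, K.lk_congr h]

variable {K}

theorem totalLk_sub_pos {t : ℕ} {y : Fin L → Y} (h : ∀ v, 0 < K.lk t v y) {w : W}
    (hw : ∃ v, v ≠ w) : 0 < K.totalLk t y - K.lk t w y := by
  classical
  obtain ⟨u, hu⟩ := hw
  rw [totalLk, ← Finset.sum_erase_add _ _ (Finset.mem_univ w), add_sub_cancel_right]
  exact Finset.sum_pos (fun v _ => h v) ⟨u, by simp [hu]⟩

/-- The change from `S` to `T` is a telescoping sum. Whether time `r` lies in this range is known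
from the first `r` outputs, so each increment may first be averaged over the next output, where
`sum_mul_logb_drift_le` applies. -/
theorem expect_logOdds_le [Nonempty Y] [Nontrivial W] {lam D : ℝ} (hl : 0 < lam)
    (hs : K.UniformSupport lam)
    (hD : ∀ w v r y, ∑ b, K.k w r y b * Real.logb 2 (K.k w r y b / K.k v r y b) ≤ D)
    {S T : (Fin L → Y) → ℕ} (hS : IsStopRule S) (hT : IsStopRule T) (hST : ∀ y, S y ≤ T y)
    (hTL : ∀ y, T y ≤ L) :
    expect K.law (fun ω => K.logOdds (T ω.2) ω.1 ω.2) ≤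
      expect K.law (fun ω => K.logOdds (S ω.2) ω.1 ω.2) +
        expect K.law (fun ω => (T ω.2 : ℝ) - S ω.2) * D := by
  classical
  rw [← sub_le_iff_le_add', ← expect_sub, ← expect_mul_const]
  have e1 : ∀ ω : W × (Fin L → Y), K.logOdds (T ω.2) ω.1 ω.2 - K.logOdds (S ω.2) ω.1 ω.2 =
      ∑ r : Fin L, if S ω.2 ≤ (r : ℕ) ∧ (r : ℕ) < T ω.2 then
        K.logOdds (r + 1) ω.1 ω.2 - K.logOdds r ω.1 ω.2 else 0 := fun ω =>
    (sum_ite_sub_eq (hST _) (hTL _) fun t => K.logOdds t ω.1 ω.2).symm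
  have e2 : ∀ ω : W × (Fin L → Y), ((T ω.2 : ℝ) - S ω.2) * D =
      ∑ r : Fin L, if S ω.2 ≤ (r : ℕ) ∧ (r : ℕ) < T ω.2 then D else 0 := fun ω => by
    rw [← sum_ite_sub_eq (hST ω.2) (hTL ω.2) fun t => (t : ℝ), Finset.sum_mul]
    refine Finset.sum_congr rfl fun r _ => ?_
    split_ifs <;> simp
  simp only [e1, e2]
  rw [expect_sum, expect_sum]
  refine Finset.sum_le_sum fun r _ => ?_
  have hind : ∀ {y y' : Fin L → Y}, Agree r y y' →
      ((S y ≤ (r : ℕ) ∧ (r : ℕ) < T y) ↔ (S y' ≤ (r : ℕ) ∧ (r : ℕ) < T y')) := by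
    intro y y' h
    rw [hS.le_iff h, ← not_le, ← not_le, hT.le_iff h]
  rw [K.expect_law_step r fun w y => if S y ≤ (r : ℕ) ∧ (r : ℕ) < T y then
        K.logOdds (r + 1) w y - K.logOdds r w y else 0]
  · refine expect_mono K.law_nonneg fun ω hω => ?_
    have hu : ∀ b, Agree r ω.2 (Function.update ω.2 r b) := fun b => agree_update r ω.2 b
    simp only [← hind (hu _)]
    split_ifs with h
    · have hpos : ∀ v, 0 < K.lk r v ω.2 :=
        hs.lk_pos hl (K.lk_pos_of_le r.2.le (K.lk_pos_of_law_pos hω))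
      have := sum_mul_logb_drift_le hpos (fun v b => K.nonneg v r ω.2 b)
        (fun v => K.sum_eq_one v r ω.2) (fun v v' b h => hl.trans_le (hs v v' r ω.2 b h)) ω.1
        (exists_ne ω.1) (fun v => hD ω.1 v r ω.2)
      refine (le_of_eq ?_).trans this
      refine Finset.sum_congr rfl fun b _ => ?_
      rw [← K.logOdds_congr (hu b)]
      simp only [logOdds, totalLk, lk_succ_update]
    · simp
  · intro w y y' h
    simp only [hind (h.mono (Nat.le_succ _)), K.logOdds_congr h,
      K.logOdds_congr (h.mono (Nat.le_succ r))]

/-- Fano's inequality at a stopping time, for the part of the message not determined by the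
label `m`. -/
theorem expect_logb_fiber_ge [Nonempty Y] [Nonempty W] {lam : ℝ} (hl : 0 < lam)
    (hs : K.UniformSupport lam) {ι : Type*} (m : W → ι) {n : ℕ} (hn : 0 < n)
    (hfib : ∀ w, fiberSum m (fun _ => 1) w = n)
    {S : (Fin L → Y) → ℕ} (hS : IsStopRule S) (hSL : ∀ y, S y ≤ L) (d : (Fin L → Y) → W)
    (hd : ∀ y y', Agree (S y) y y' → d y = d y') :
    -1 - pr K.law (fun ω => d ω.2 ≠ ω.1) * Real.logb 2 n ≤ expect K.law fun ω =>
      Real.logb 2 (K.lk (S ω.2) ω.1 ω.2 / fiberSum m (fun v => K.lk (S ω.2) v ω.2) ω.1) := by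
  classical
  have hn' : (0 : ℝ) < n := Nat.cast_pos.2 hn
  set A : W → (Fin L → Y) → ℝ := fun w y => fiberSum m (fun v => K.lk (S y) v y) w
  -- Reference law for Gibbs' inequality: half its mass at the guess, half spread over the `n`
  -- messages of a fibre. Its mass on any fibre is at most one; it costs at most one bit if the
  -- guess is right and `1 + log n` bits otherwise.
  set ρ : W → (Fin L → Y) → ℝ := fun w y => (if d y = w then 1 / 2 else 0) + 1 / (2 * n)
  have hρ : ∀ w y, 0 < ρ w y := fun w y => by
    simp only [ρ]; split_ifs <;> positivity
  have hposS : ∀ ω, 0 < K.law ω → ∀ v, 0 < K.lk (S ω.2) v ω.2 := fun ω hω =>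
    hs.lk_pos hl (K.lk_pos_of_le (hSL _) (K.lk_pos_of_law_pos hω))
  have hA : ∀ ω, 0 < K.law ω → 0 < A ω.1 ω.2 := fun ω hω => (hposS ω hω ω.1).trans_le
    (le_fiberSum m (f := fun v => K.lk (S ω.2) v ω.2) (fun v => K.lk_nonneg _ _ _) ω.1)
  have hgibbs : 0 ≤ ∑ ω, K.law ω *
      Real.logb 2 (K.lk (S ω.2) ω.1 ω.2 / A ω.1 ω.2 / ρ ω.1 ω.2) := by
    refine sum_mul_logb_nonneg K.law_nonneg (fun ω hω => ?_) ?_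
    · have := hposS ω hω ω.1
      have := hA ω hω
      have := hρ ω.1 ω.2
      positivity
    · have h1 : ∑ ω, K.law ω / (K.lk (S ω.2) ω.1 ω.2 / A ω.1 ω.2 / ρ ω.1 ω.2) =
          expect K.law fun ω => (fun w y => ρ w y * A w y / K.lk (S y) w y) ω.1 ω.2 := by
        refine Finset.sum_congr rfl fun ω _ => ?_
        rw [div_div_eq_mul_div, div_div_eq_mul_div]
        ring
      have hlkS : ∀ {y y'}, Agree (S y) y y' → ∀ v, K.lk (S y') v y' = K.lk (S y) v y :=
        fun h v => by rw [hS _ _ h, K.lk_congr h]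
      have h2 : ∑ ω, K.law ω = expect K.law fun ω => (fun _ _ => (1 : ℝ)) ω.1 ω.2 := by
        simp [expect]
      rw [h1, h2]
      refine K.expect_law_le_of_stopped hS hSL
        (fun w y => ρ w y * A w y / K.lk (S y) w y) (fun _ _ => 1) ?_ (fun _ _ _ _ => rfl) fun y => ?_
      · intro w y y' h
        simp only [ρ, A, hlkS h, hd y y' h]
      · have h3 : ∀ w, K.lk (S y) w y * (ρ w y * A w y / K.lk (S y) w y) ≤ ρ w y * A w y := by
          intro w
          rw [mul_comm, div_mul_eq_mul_div, mul_div_assoc]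
          exact mul_le_of_le_one_right (mul_nonneg (hρ w y).le
            (fiberSum_nonneg m (fun v => K.lk_nonneg _ v y) w)) (div_self_le_one _)
        calc _ ≤ ∑ w, ρ w y * A w y := Finset.sum_le_sum fun w _ => h3 w
          _ = ∑ v, K.lk (S y) v y * ∑ w, if m v = m w then ρ w y else 0 := by
            simp only [A, fiberSum, Finset.mul_sum]
            rw [Finset.sum_comm]
            refine Finset.sum_congr rfl fun v _ => Finset.sum_congr rfl fun w _ => ?_
            split_ifs <;> simp [mul_comm]
          _ ≤ ∑ v, K.lk (S y) v y * 1 := by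
            refine Finset.sum_le_sum fun v _ => mul_le_mul_of_nonneg_left ?_ (K.lk_nonneg _ _ _)
            have h4 : ∀ w, (if m v = m w then ρ w y else 0) ≤ (if d y = w then 1 / 2 else 0) +
                1 / (2 * n) * (if m w = m v then 1 else 0) := by
              intro w
              by_cases h : m v = m w
              · rw [if_pos h, if_pos h.symm, mul_one]
              · rw [if_neg h, if_neg (Ne.symm h), mul_zero]
                split_ifs <;> simp
            refine (Finset.sum_le_sum fun w _ => h4 w).trans (le_of_eq ?_)
            have h5 : ∑ w, (if m w = m v then (1 : ℝ) else 0) = n := hfib v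
            rw [Finset.sum_add_distrib, ← Finset.mul_sum, h5]
            simp only [Finset.sum_ite_eq, Finset.mem_univ, if_true]
            field_simp
            norm_num
  have h6 : expect K.law (fun ω => (if d ω.2 ≠ ω.1 then 1 else 0) * -Real.logb 2 n) - 1 ≤
      expect K.law fun ω => Real.logb 2 (ρ ω.1 ω.2) := by
    rw [← expect_const K.sum_law 1, ← expect_sub, expect_const K.sum_law]
    refine expect_mono K.law_nonneg fun ω _ => ?_
    by_cases h : d ω.2 = ω.1
    · have : Real.logb 2 (1 / 2) ≤ Real.logb 2 (ρ ω.1 ω.2) := by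
        refine Real.logb_le_logb_of_le one_lt_two (by norm_num) ?_
        simp only [ρ, if_pos h]
        have : 0 < 1 / (2 * (n : ℝ)) := by positivity
        linarith
      rw [one_div, Real.logb_inv, Real.logb_self_eq_one one_lt_two] at this
      simpa [h] using this
    · have : ρ ω.1 ω.2 = (2 * (n : ℝ))⁻¹ := by simp [ρ, h]
      rw [this, Real.logb_inv, Real.logb_mul two_ne_zero hn'.ne',
        Real.logb_self_eq_one one_lt_two, if_pos h]
      linarith
  have h7 : ∑ ω, K.law ω * Real.logb 2 (K.lk (S ω.2) ω.1 ω.2 / A ω.1 ω.2 / ρ ω.1 ω.2) =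
      expect K.law (fun ω => Real.logb 2 (K.lk (S ω.2) ω.1 ω.2 / A ω.1 ω.2)) -
        expect K.law (fun ω => Real.logb 2 (ρ ω.1 ω.2)) := by
    rw [← expect_sub]
    refine expect_congr K.law_nonneg fun ω hω => ?_
    rw [Real.logb_div (div_pos (hposS ω hω ω.1) (hA ω hω)).ne' (hρ _ _).ne']
  rw [expect_mul_const, ← pr_eq_expect fun ω : W × (Fin L → Y) => d ω.2 ≠ ω.1] at h6
  rw [h7] at hgibbs
  linarith

/-- A decoder with error probability `pe` makes the posterior error probability small. -/
theorem le_expect_logOdds [Nonempty Y] [Nontrivial W] {lam : ℝ} (hl : 0 < lam)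
    (hs : K.UniformSupport lam) {T : (Fin L → Y) → ℕ} (hT : IsStopRule T) (hTL : ∀ y, T y ≤ L)
    (d : (Fin L → Y) → W) (hd : ∀ y y', Agree (T y) y y' → d y = d y') {pe : ℝ}
    (hpe : pr K.law (fun ω => d ω.2 ≠ ω.1) = pe) (hpe0 : 0 < pe) :
    (1 - pe) * -Real.logb 2 pe - 2 ≤
      expect K.law fun ω => K.logOdds (T ω.2) ω.1 ω.2 := by
  classical
  have hlog2 : (1 / 2 : ℝ) < Real.log 2 := by have := Real.log_two_gt_d9; linarith
  have hl2 : 0 < Real.log 2 := by linarith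
  -- The posterior probability that the decoder is wrong; its mean is at most `pe` by `hEx` below.
  set x : (Fin L → Y) → ℝ :=
    fun y => (K.totalLk (T y) y - K.lk (T y) (d y) y) / K.totalLk (T y) y with hx
  have hx0 : ∀ y, 0 ≤ x y := fun y => div_nonneg (sub_nonneg.2 (K.lk_le_totalLk _ _ _))
    (Finset.sum_nonneg fun v _ => K.lk_nonneg _ _ _)
  have hlkT : ∀ {y y'}, Agree (T y) y y' → ∀ v, K.lk (T y') v y' = K.lk (T y) v y :=
    fun h v => by rw [hT _ _ h, K.lk_congr h]
  have hEx : expect K.law (fun ω => x ω.2) ≤ pe := by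
    rw [← hpe, pr_eq_expect]
    refine K.expect_law_le_of_stopped hT hTL (fun _ y => x y)
      (fun w y => if d y ≠ w then 1 else 0) ?_ ?_ fun y => ?_
    · intro w y y' h
      simp only [hx, totalLk, hlkT h, hd y y' h]
    · intro w y y' h
      rw [hd y y' h]
    · rw [← Finset.sum_mul]
      have h1 : ∑ w, K.lk (T y) w y * (if d y ≠ w then 1 else 0) =
          K.totalLk (T y) y - K.lk (T y) (d y) y := by
        simp only [totalLk, ne_eq, ite_not, mul_ite, mul_zero, mul_one]
        rw [eq_sub_iff_add_eq]
        have : K.lk (T y) (d y) y = ∑ w, if d y = w then K.lk (T y) w y else 0 := by simp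
        rw [this, ← Finset.sum_add_distrib]
        refine Finset.sum_congr rfl fun w _ => ?_
        split_ifs <;> simp
      rw [h1, hx]
      change K.totalLk (T y) y * _ ≤ _
      rw [mul_comm, div_mul_eq_mul_div, mul_div_assoc]
      exact mul_le_of_le_one_right (sub_nonneg.2 (K.lk_le_totalLk _ _ _)) (div_self_le_one _)
  -- Where decoding is correct, the log-odds equal `-log x`, which lies above its tangent line at
  -- `pe`; elsewhere they are nonnegative. The linear term contributes at most `1 / log 2 ≤ 2`,
  -- whence the constant 2 in the statement.
  have hpt : ∀ ω, 0 < K.law ω →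
      -Real.logb 2 pe - (if d ω.2 ≠ ω.1 then 1 else 0) * -Real.logb 2 pe -
        x ω.2 * (1 / (pe * Real.log 2)) ≤ K.logOdds (T ω.2) ω.1 ω.2 := by
    intro ω hω
    have hlk : ∀ v, 0 < K.lk (T ω.2) v ω.2 :=
      hs.lk_pos hl (K.lk_pos_of_le (hTL _) (K.lk_pos_of_law_pos hω))
    have hsub := totalLk_sub_pos hlk (exists_ne ω.1)
    have htot : 0 < K.totalLk (T ω.2) ω.2 := by linarith [hlk ω.1]
    by_cases h : d ω.2 = ω.1
    · have e : K.logOdds (T ω.2) ω.1 ω.2 = -Real.logb 2 (x ω.2) := by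
        rw [logOdds, hx, ← Real.logb_inv, inv_div, h]
      have hxp : 0 < x ω.2 := by
        simp only [hx, h]; exact div_pos hsub htot
      rw [e]
      have h1 := Real.log_le_sub_one_of_pos (div_pos hxp hpe0)
      rw [Real.log_div hxp.ne' hpe0.ne'] at h1
      have h2 : Real.logb 2 (x ω.2) - Real.logb 2 pe ≤ x ω.2 * (1 / (pe * Real.log 2)) := by
        rw [Real.logb, Real.logb, ← sub_div, div_le_iff₀ hl2]
        have : x ω.2 * (1 / (pe * Real.log 2)) * Real.log 2 = x ω.2 / pe := by field_simp
        rw [this]; linarith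
      simp only [h, ne_eq, not_true_eq_false, if_false]
      linarith
    · have h1 : 0 ≤ K.logOdds (T ω.2) ω.1 ω.2 := by
        refine Real.logb_nonneg one_lt_two ?_
        rw [one_le_div hsub]; linarith [hlk ω.1]
      have h2 : 0 ≤ x ω.2 * (1 / (pe * Real.log 2)) := mul_nonneg (hx0 _) (by positivity)
      simp only [ne_eq, h, not_false_eq_true, if_true]
      linarith
  have := expect_mono K.law_nonneg hpt
  rw [expect_sub, expect_sub, expect_const K.sum_law, expect_mul_const, expect_mul_const,
    ← pr_eq_expect fun ω : W × (Fin L → Y) => d ω.2 ≠ ω.1, hpe] at this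
  have h3 : expect K.law (fun ω => x ω.2) * (1 / (pe * Real.log 2)) ≤ 2 := by
    have : pe * (1 / (pe * Real.log 2)) ≤ 2 := by
      have e : pe * (1 / (pe * Real.log 2)) = 1 / Real.log 2 := by field_simp
      rw [e, div_le_iff₀ hl2]; linarith
    exact (mul_le_mul_of_nonneg_right hEx (by positivity)).trans this
  linarith

end FeedbackKernel

/-! ### Averaging over the posterior law, and the gain of information per step -/

namespace FeedbackKernel

variable {W Y : Type*} [Fintype Y] {L : ℕ} (K : FeedbackKernel W Y L)

open Classical in
theorem sum_lk_agree {t : ℕ} (ht : t ≤ L) (w : W) (y₀ : Fin L → Y) :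
    ∑ y, (if Agree t y₀ y then K.lk L w y else 0) = K.lk t w y₀ := by
  induction ht using Nat.decreasingInduction generalizing y₀ with
  | self =>
    have : ∀ y, Agree L y₀ y ↔ y₀ = y :=
      fun y => ⟨fun h => funext fun i => h i i.2, fun h i _ => by rw [h]⟩
    simp [this]
  | of_succ t ht ih =>
    have e : ∀ y, (if Agree t y₀ y then K.lk L w y else 0) =
        ∑ b, if Agree (t + 1) (Function.update y₀ ⟨t, ht⟩ b) y then K.lk L w y else 0 := by
      intro y
      have h1 : ∀ b, Agree (t + 1) (Function.update y₀ ⟨t, ht⟩ b) y ↔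
          b = y ⟨t, ht⟩ ∧ Agree t y₀ y := by
        intro b
        constructor
        · intro h
          have h2 := h ⟨t, ht⟩ (Nat.lt_succ_self t)
          rw [Function.update_self] at h2
          exact ⟨h2, fun i hi => (agree_update ⟨t, ht⟩ y₀ b i hi).trans
            (h i (hi.trans (Nat.lt_succ_self t)))⟩
        · rintro ⟨rfl, h⟩ i hi
          by_cases hit : i = ⟨t, ht⟩
          · subst hit; simp
          · rw [Function.update_of_ne hit]
            exact h i (lt_of_le_of_ne (Nat.lt_succ_iff.1 hi) fun h' => hit (Fin.ext h'))
      simp only [h1, ite_and, Finset.sum_ite_eq', Finset.mem_univ, if_true]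
    simp only [e]
    rw [Finset.sum_comm]
    simp only [ih]
    have := fun b => K.lk_succ_update ⟨t, ht⟩ w y₀ b
    dsimp only at this
    simp only [this, ← Finset.mul_sum, K.sum_eq_one, mul_one]

open Classical in
theorem sum_lk_agree_mul [Nonempty Y] (r : Fin L) (w : W) (y₀ : Fin L → Y) (g : Y → ℝ) :
    ∑ y, (if Agree r y₀ y then K.lk L w y * g (y r) else 0) =
      K.lk r w y₀ * ∑ b, K.k w r y₀ b * g b := by
  have h1 := K.sum_lk_step r w (fun y => if Agree r y₀ y then g (y r) else 0) ?_
  · simp only [mul_ite, mul_zero] at h1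
    rw [h1, ← K.sum_lk_agree r.2.le, Finset.sum_mul]
    refine Finset.sum_congr rfl fun y _ => ?_
    have h2 : ∀ b, Agree r y₀ (Function.update y r b) ↔ Agree r y₀ y := fun b =>
      ⟨fun h i hi => (h i hi).trans (agree_update r y b i hi).symm,
        fun h i hi => (h i hi).trans (agree_update r y b i hi)⟩
    simp only [h2, Function.update_self]
    split_ifs with h
    · rw [K.predictable w r y₀ y h]
    · simp
  · intro y y' h
    have h2 : Agree r y₀ y ↔ Agree r y₀ y' :=
      ⟨fun h' i hi => (h' i hi).trans (h i (hi.trans (Nat.lt_succ_self _))),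
        fun h' i hi => (h' i hi).trans (h i (hi.trans (Nat.lt_succ_self _))).symm⟩
    simp only [h2, h r (Nat.lt_succ_self _)]

variable [Fintype W]

theorem totalLk_nonneg (t : ℕ) (y : Fin L → Y) : 0 ≤ K.totalLk t y :=
  Finset.sum_nonneg fun _ _ => K.lk_nonneg _ _ _

/-- Averaging over the posterior law of the message does not change expectations. -/
theorem expect_law_posterior [Nonempty Y] {t : ℕ} (ht : t ≤ L) (G : W → (Fin L → Y) → ℝ)
    (hG : ∀ w y y', Agree t y y' → G w y = G w y') :
    expect K.law (fun ω => G ω.1 ω.2) =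
      expect K.law fun ω => ∑ v, K.lk t v ω.2 / K.totalLk t ω.2 * G v ω.2 := by
  rw [K.expect_law_stopped (S := fun _ => t) (fun _ _ _ => rfl) (fun _ => ht) G hG,
    K.expect_law_stopped (S := fun _ => t) (fun _ _ _ => rfl) (fun _ => ht)
      fun _ y => ∑ v, K.lk t v y / K.totalLk t y * G v y]
  · congr 1
    refine Finset.sum_congr rfl fun y _ => ?_
    congr 1
    rw [← Finset.sum_mul, Finset.mul_sum]
    refine Finset.sum_congr rfl fun w _ => ?_
    rcases (K.totalLk_nonneg t y).eq_or_lt with h0 | h0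
    · have : K.lk t w y = 0 := le_antisymm (h0 ▸ K.lk_le_totalLk t w y) (K.lk_nonneg t w y)
      simp [this]
    · change _ = K.totalLk t y * _
      field_simp
  · intro _ y y' h
    refine Finset.sum_congr rfl fun v _ => ?_
    rw [K.lk_congr h, K.totalLk_congr h, hG v y y' h]

/-- The information gained about the message, given the label `m`, up to the stopping time `S`. -/
theorem logb_add_expect_le [Nonempty Y] [Nonempty W] {lam : ℝ} (hl : 0 < lam)
    (hs : K.UniformSupport lam) {ι : Type*} (m : W → ι) {n : ℕ} (hn : 0 < n)
    (hfib : ∀ w, fiberSum m (fun _ => 1) w = n)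
    {S : (Fin L → Y) → ℕ} (hS : IsStopRule S) (hSL : ∀ y, S y ≤ L)
    (I : Fin L → (Fin L → Y) → ℝ)
    (hI : ∀ (r : Fin L) y, 0 < K.totalLk r y → ∑ w, ∑ b, K.lk r w y / K.totalLk r y * K.k w r y b *
      Real.logb 2 (K.k w r y b * fiberSum m (fun v => K.lk r v y / K.totalLk r y) w /
        fiberSum m (fun v => K.lk r v y / K.totalLk r y * K.k v r y b) w) ≤ I r y) :
    Real.logb 2 n + expect K.law (fun ω =>
      Real.logb 2 (K.lk (S ω.2) ω.1 ω.2 / fiberSum m (fun v => K.lk (S ω.2) v ω.2) ω.1)) ≤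
    expect K.law fun ω => ∑ r : Fin L, if (r : ℕ) < S ω.2 then I r ω.2 else 0 := by
  classical
  have hn' : (0 : ℝ) < n := Nat.cast_pos.2 hn
  set J : ℕ → W → (Fin L → Y) → ℝ := fun t w y =>
    Real.logb 2 (K.lk t w y / fiberSum m (fun v => K.lk t v y) w) with hJ
  have hJc : ∀ {t y y'}, Agree t y y' → ∀ w, J t w y = J t w y' := by
    intro t y y' h w
    simp only [hJ, K.lk_congr h]
  have e1 : ∀ ω : W × (Fin L → Y), J (S ω.2) ω.1 ω.2 + Real.logb 2 n =
      ∑ r : Fin L, if (r : ℕ) < S ω.2 then J (r + 1) ω.1 ω.2 - J r ω.1 ω.2 else 0 := by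
    intro ω
    -- Before any output, the message is uniform on its fibre; this supplies the term `log n`.
    have h0 : J 0 ω.1 ω.2 = -Real.logb 2 n := by
      simp only [hJ, lk_zero, hfib, one_div, Real.logb_inv]
    have := sum_ite_sub_eq (Nat.zero_le _) (hSL ω.2) fun t => J t ω.1 ω.2
    simp only [Nat.zero_le, true_and, h0, sub_neg_eq_add] at this
    exact this.symm
  change Real.logb 2 n + expect K.law (fun ω => J (S ω.2) ω.1 ω.2) ≤ _
  rw [add_comm, ← expect_const K.sum_law (Real.logb 2 n), ← expect_add]
  simp only [e1]
  rw [expect_sum, expect_sum]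
  refine Finset.sum_le_sum fun r _ => ?_
  have hind : ∀ {y y' : Fin L → Y}, Agree r y y' → ((r : ℕ) < S y ↔ (r : ℕ) < S y') := by
    intro y y' h
    rw [← not_le, ← not_le, hS.le_iff h]
  rw [K.expect_law_step r fun w y => if (r : ℕ) < S y then J (r + 1) w y - J r w y else 0]
  · have hu : ∀ (y : Fin L → Y) b, Agree r y (Function.update y r b) := fun y b => agree_update r y b
    have e2 : ∀ w y, ∑ b, K.k w r y b * (if (r : ℕ) < S (Function.update y r b) then
        J (r + 1) w (Function.update y r b) - J r w (Function.update y r b) else 0) =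
        if (r : ℕ) < S y then ∑ b, K.k w r y b *
          (Real.logb 2 (K.lk r w y * K.k w r y b /
            fiberSum m (fun v => K.lk r v y * K.k v r y b) w) - J r w y) else 0 := by
      intro w y
      simp only [← hind (hu y _), ← hJc (hu y _)]
      simp only [hJ, lk_succ_update]
      split_ifs <;> simp
    simp only [e2]
    -- The increment for a single message is not an information quantity; its average over the
    -- posterior law is, and that average is what `hI` controls.
    rw [K.expect_law_posterior r.2.le fun w y => if (r : ℕ) < S y then ∑ b, K.k w r y b *
          (Real.logb 2 (K.lk r w y * K.k w r y b /
            fiberSum m (fun v => K.lk r v y * K.k v r y b) w) - J r w y) else 0]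
    · refine expect_mono K.law_nonneg fun ω hω => ?_
      split_ifs with h
      · have hpos : ∀ v, 0 < K.lk r v ω.2 :=
          hs.lk_pos hl (K.lk_pos_of_le r.2.le (K.lk_pos_of_law_pos hω))
        have htot : 0 < K.totalLk r ω.2 := (hpos ω.1).trans_le (K.lk_le_totalLk _ _ _)
        refine le_trans (le_of_eq ?_) (hI r ω.2 htot)
        refine Finset.sum_congr rfl fun w _ => ?_
        rw [Finset.mul_sum]
        refine Finset.sum_congr rfl fun b _ => ?_
        rw [← mul_assoc]
        rcases (K.nonneg w r ω.2 b).eq_or_lt with h0 | h0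
        · simp [← h0]
        · congr 1
          have hk : ∀ v, 0 < K.k v r ω.2 b := fun v => hl.trans_le (hs w v r ω.2 b h0)
          have hA : 0 < fiberSum m (fun v => K.lk r v ω.2) w :=
            (hpos w).trans_le (le_fiberSum m (f := fun v => K.lk r v ω.2)
              (fun v => (hpos v).le) w)
          have hA' : 0 < fiberSum m (fun v => K.lk r v ω.2 * K.k v r ω.2 b) w :=
            (mul_pos (hpos w) (hk w)).trans_le
              (le_fiberSum m (f := fun v => K.lk r v ω.2 * K.k v r ω.2 b)
                (fun v => (mul_pos (hpos v) (hk v)).le) w)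
          have e3 : fiberSum m (fun v => K.lk r v ω.2 / K.totalLk r ω.2 * K.k v r ω.2 b) w =
              fiberSum m (fun v => K.lk r v ω.2 * K.k v r ω.2 b) w / K.totalLk r ω.2 := by
            rw [← fiberSum_div]
            simp only [div_mul_eq_mul_div]
          rw [e3, fiberSum_div]
          simp only [hJ]
          have := hpos w
          have := hk w
          rw [← Real.logb_div (by positivity) (by positivity)]
          congr 1
          field_simp
      · simp
    · intro w y y' h
      simp only [hind h, K.predictable w r y y' h, K.lk_congr h, hJc h,
        fun v => K.predictable v r y y' h]
  · intro w y y' h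
    simp only [hind (h.mono (Nat.le_succ _)), hJc h, hJc (h.mono (Nat.le_succ r))]

/-! ### The time at which the posterior law concentrates -/

/-- Some message has posterior probability larger than `1 - δ`. -/
def Concentrated (δ : ℝ) (t : ℕ) (y : Fin L → Y) : Prop :=
  ∃ w, (1 - δ) * K.totalLk t y < K.lk t w y

theorem concentrated_congr {δ : ℝ} {t : ℕ} {y y' : Fin L → Y} (h : Agree t y y') :
    K.Concentrated δ t y ↔ K.Concentrated δ t y' := by
  simp only [Concentrated, K.totalLk_congr h, K.lk_congr h]

/-- The first time in `{1, 2, …}` at which the posterior law is concentrated, but at most `T`. -/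
def concTime (δ : ℝ) (T : (Fin L → Y) → ℕ) (y : Fin L → Y) : ℕ :=
  sInf {t | 1 ≤ t ∧ (T y ≤ t ∨ K.Concentrated δ t y)}

variable {K} {δ : ℝ} {T : (Fin L → Y) → ℕ}

theorem concTime_le (hT1 : ∀ y, 1 ≤ T y) (y : Fin L → Y) : K.concTime δ T y ≤ T y :=
  Nat.sInf_le ⟨hT1 y, Or.inl le_rfl⟩

theorem concTime_mem (hT1 : ∀ y, 1 ≤ T y) (y : Fin L → Y) : 1 ≤ K.concTime δ T y ∧
    (T y ≤ K.concTime δ T y ∨ K.Concentrated δ (K.concTime δ T y) y) :=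
  Nat.sInf_mem (s := {t | 1 ≤ t ∧ (T y ≤ t ∨ K.Concentrated δ t y)}) ⟨T y, hT1 y, Or.inl le_rfl⟩

theorem isStopRule_concTime (hT1 : ∀ y, 1 ≤ T y) (hT : IsStopRule T) :
    IsStopRule (K.concTime δ T) := by
  have key : ∀ y y', Agree (K.concTime δ T y) y y' → K.concTime δ T y' ≤ K.concTime δ T y := by
    intro y y' h
    obtain ⟨h1, h2⟩ := concTime_mem (K := K) (δ := δ) hT1 y
    exact Nat.sInf_le ⟨h1, h2.imp (hT.le_iff h).1 (K.concentrated_congr h).1⟩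
  intro y y' h
  have h1 := key y y' h
  exact le_antisymm h1 (key y' y (h.symm.mono h1))

open Classical in
/-- The message on which the posterior law concentrates, or the decoded message `d` if it does
not. -/
def concMessage [Nonempty W] (K : FeedbackKernel W Y L) (δ : ℝ) (T : (Fin L → Y) → ℕ)
    (d : (Fin L → Y) → W) (y : Fin L → Y) : W :=
  if K.Concentrated δ (K.concTime δ T y) y then
    Classical.epsilon fun w =>
      (1 - δ) * K.totalLk (K.concTime δ T y) y < K.lk (K.concTime δ T y) w y
  else d y

theorem concMessage_congr [Nonempty W] (hT1 : ∀ y, 1 ≤ T y) (hT : IsStopRule T)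
    {d : (Fin L → Y) → W} (hd : ∀ y y', Agree (T y) y y' → d y = d y') (y y' : Fin L → Y)
    (h : Agree (K.concTime δ T y) y y') : K.concMessage δ T d y = K.concMessage δ T d y' := by
  unfold concMessage
  rw [isStopRule_concTime hT1 hT y y' h, ← K.totalLk_congr h]
  by_cases hc : K.Concentrated δ (K.concTime δ T y) y
  · rw [if_pos hc, if_pos ((K.concentrated_congr h).1 hc)]
    simp only [K.lk_congr h]
  · rw [if_neg hc, if_neg fun h' => hc ((K.concentrated_congr h).2 h')]
    exact hd y y' (h.mono ((concTime_mem (K := K) (δ := δ) hT1 y).2.resolve_right hc))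

/-- If the posterior is concentrated, the guess has conditional error probability below `δ`; if not,
the guess is the decoder's own. -/
theorem pr_concMessage_ne_le [Nonempty Y] [Nonempty W] (hδ : 0 ≤ δ) (hT1 : ∀ y, 1 ≤ T y)
    (hT : IsStopRule T) (hTL : ∀ y, T y ≤ L)
    {d : (Fin L → Y) → W} (hd : ∀ y y', Agree (T y) y y' → d y = d y') :
    pr K.law (fun ω => K.concMessage δ T d ω.2 ≠ ω.1) ≤
      δ + pr K.law (fun ω => d ω.2 ≠ ω.1) := by
  classical
  set S := K.concTime δ T with hSdef
  have hS : IsStopRule S := isStopRule_concTime hT1 hT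
  rw [pr_eq_expect, pr_eq_expect]
  have h1 : expect K.law (fun ω => if K.Concentrated δ (S ω.2) ω.2 ∧
      K.concMessage δ T d ω.2 ≠ ω.1 then 1 else 0) ≤ δ := by
    have h2 := K.expect_law_le_of_stopped hS (fun y => (concTime_le hT1 y).trans (hTL y))
      (fun w y => if K.Concentrated δ (S y) y ∧ K.concMessage δ T d y ≠ w then 1 else 0)
      (fun _ _ => δ) ?_ (fun _ _ _ _ => rfl) fun y => ?_
    · rwa [expect_const K.sum_law] at h2
    · intro w y y' h
      simp only [hS y y' h, ← K.concentrated_congr h, concMessage_congr hT1 hT hd y y' h]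
    · rw [← Finset.sum_mul]
      change _ ≤ K.totalLk (S y) y * δ
      by_cases hc : K.Concentrated δ (S y) y
      · have h3 : (1 - δ) * K.totalLk (S y) y < K.lk (S y) (K.concMessage δ T d y) y := by
          rw [concMessage, if_pos hc]
          exact Classical.epsilon_spec hc
        have h4 : ∑ w, K.lk (S y) w y * (if K.Concentrated δ (S y) y ∧
            K.concMessage δ T d y ≠ w then 1 else 0) =
            K.totalLk (S y) y - K.lk (S y) (K.concMessage δ T d y) y := by
          rw [eq_sub_iff_add_eq]
          have : K.lk (S y) (K.concMessage δ T d y) y =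
              ∑ w, if K.concMessage δ T d y = w then K.lk (S y) w y else 0 := by simp
          rw [this, ← Finset.sum_add_distrib]
          refine Finset.sum_congr rfl fun w _ => ?_
          by_cases h5 : K.concMessage δ T d y = w <;> simp [h5, hc]
        rw [h4]; linarith
      · simp only [hc, false_and, if_false, mul_zero, Finset.sum_const_zero]
        exact mul_nonneg (K.totalLk_nonneg _ _) hδ
  refine le_trans ?_ (add_le_add_left h1 _)
  rw [← expect_add]
  refine expect_mono K.law_nonneg fun ω _ => ?_
  by_cases hc : K.Concentrated δ (S ω.2) ω.2
  · by_cases h5 : K.concMessage δ T d ω.2 = ω.1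
    · simp only [h5, ne_eq, not_true_eq_false, if_false, and_false, zero_add]
      split_ifs <;> norm_num
    · simp only [h5, hc, ne_eq, not_false_eq_true, if_true, and_self]
      split_ifs <;> norm_num
  · have : K.concMessage δ T d ω.2 = d ω.2 := by rw [concMessage, if_neg hc]
    simp [this, hc]

/-- The overshoot is bounded: one step before the stopping time every message has posterior at most
`1 - δ`, and one output keeps at least the fraction `lam` of the mass of the wrong messages while
the total mass does not grow. -/
theorem expect_logOdds_concTime_le [Nonempty Y] [Nontrivial W] {lam : ℝ} (hl : 0 < lam)
    (hs : K.UniformSupport lam) (hδ : 0 < δ) (hδ2 : δ ≤ 1 / 2) (hT1 : ∀ y, 1 ≤ T y)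
    (hTL : ∀ y, T y ≤ L) :
    expect K.law (fun ω => K.logOdds (K.concTime δ T ω.2) ω.1 ω.2) ≤
      Real.logb 2 (1 / (lam * δ)) := by
  classical
  rw [← expect_const K.sum_law (Real.logb 2 (1 / (lam * δ)))]
  refine expect_mono K.law_nonneg fun ω hω => ?_
  obtain ⟨w, y⟩ := ω
  have hlkL : ∀ v, 0 < K.lk L v y := fun v => hs.lk_pos hl (K.lk_pos_of_law_pos hω) v
  dsimp only
  set S := K.concTime δ T y with hSdef
  obtain ⟨h1, -⟩ := concTime_mem (K := K) (δ := δ) hT1 y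
  obtain ⟨t, ht⟩ : ∃ t, S = t + 1 := ⟨S - 1, by omega⟩
  have htL : t < L := by
    have := (concTime_le (K := K) (δ := δ) hT1 y).trans (hTL y); omega
  have hlk : ∀ s ≤ L, ∀ v, 0 < K.lk s v y := fun s hs' v => K.lk_pos_of_le hs' (hlkL v)
  have hprev : δ * K.totalLk t y ≤ K.totalLk t y - K.lk t w y := by
    have : K.lk t w y ≤ (1 - δ) * K.totalLk t y := by
      -- The stopping time is at least 1, so nothing is known about concentration at time 0. There
      -- the prior is uniform on at least two messages, and `δ ≤ 1 / 2` suffices.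
      rcases Nat.eq_zero_or_pos t with h0 | h0
      · subst h0
        have h2 : (2 : ℝ) ≤ Fintype.card W := by exact_mod_cast Fintype.one_lt_card (α := W)
        simp only [totalLk, lk_zero, Finset.sum_const, nsmul_eq_mul, mul_one, Finset.card_univ]
        nlinarith
      · by_contra hlt
        have : S ≤ t := Nat.sInf_le ⟨h0, Or.inr ⟨w, not_le.1 hlt⟩⟩
        omega
    linarith
  have hsucc : ∀ v, K.lk (t + 1) v y = K.lk t v y * K.k v ⟨t, htL⟩ y (y ⟨t, htL⟩) :=
    fun v => K.lk_succ ⟨t, htL⟩ v y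
  have hk : ∀ v, lam ≤ K.k v ⟨t, htL⟩ y (y ⟨t, htL⟩) := fun v =>
    hs w v _ y _ (K.k_pos_of_lk_pos (hlkL w) htL)
  have hsub : ∀ s, K.totalLk s y - K.lk s w y = ∑ v ∈ Finset.univ.erase w, K.lk s v y := by
    intro s
    rw [totalLk, ← Finset.sum_erase_add _ _ (Finset.mem_univ w), add_sub_cancel_right]
  have h3 : lam * (K.totalLk t y - K.lk t w y) ≤ K.totalLk (t + 1) y - K.lk (t + 1) w y := by
    rw [hsub, hsub, Finset.mul_sum]
    refine Finset.sum_le_sum fun v _ => ?_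
    rw [hsucc, mul_comm]
    exact mul_le_mul_of_nonneg_left (hk v) (K.lk_nonneg _ _ _)
  have h4 : K.totalLk (t + 1) y ≤ K.totalLk t y := by
    refine Finset.sum_le_sum fun v _ => ?_
    rw [hsucc]
    exact mul_le_of_le_one_right (K.lk_nonneg _ _ _) (K.k_le_one _ _ _ _)
  have htot : 0 < K.totalLk (t + 1) y :=
    (hlk (t + 1) htL w).trans_le (K.lk_le_totalLk _ _ _)
  rw [ht, logOdds]
  have h5 : lam * δ * K.totalLk (t + 1) y ≤ K.totalLk (t + 1) y - K.lk (t + 1) w y := by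
    refine le_trans ?_ h3
    rw [mul_assoc]
    refine mul_le_mul_of_nonneg_left (le_trans ?_ hprev) hl.le
    exact mul_le_mul_of_nonneg_left h4 hδ.le
  have h6 : 0 < lam * δ * K.totalLk (t + 1) y := by positivity
  refine Real.logb_le_logb_of_le one_lt_two (div_pos htot (h6.trans_le h5)) ?_
  rw [div_le_div_iff₀ (h6.trans_le h5) (by positivity)]
  linarith

/-- The posterior law concentrates at most exponentially fast. -/
theorem logb_card_add_expect_le [Nonempty Y] [Nonempty W] {lam : ℝ} (hl : 0 < lam)
    (hs : K.UniformSupport lam) {S : (Fin L → Y) → ℕ} (hSL : ∀ y, S y ≤ L) :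
    Real.logb 2 (Fintype.card W) + expect K.law (fun ω => Real.logb 2
      (K.lk (S ω.2) ω.1 ω.2 / fiberSum (fun _ => ()) (fun v => K.lk (S ω.2) v ω.2) ω.1)) ≤
    expect K.law (fun ω => (S ω.2 : ℝ)) * Real.logb 2 (1 / lam) := by
  have hc : (0 : ℝ) < Fintype.card W := by exact_mod_cast Fintype.card_pos (α := W)
  rw [← expect_const K.sum_law (Real.logb 2 (Fintype.card W)), ← expect_add, ← expect_mul_const]
  refine expect_mono K.law_nonneg fun ω hω => ?_
  have hlkL := K.lk_pos_of_law_pos hω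
  have h1 : ∀ v, lam ^ S ω.2 ≤ K.lk (S ω.2) v ω.2 := fun v => hs.pow_le_lk hl hlkL v (hSL _)
  -- All likelihoods lie between `lam ^ S` and 1, so no posterior probability exceeds `lam ^ (-S) /
  -- card W`.
  have h2 : Fintype.card W * lam ^ S ω.2 ≤
      fiberSum (fun _ => ()) (fun v => K.lk (S ω.2) v ω.2) ω.1 := by
    simp only [fiberSum, if_true]
    refine le_trans (le_of_eq ?_) (Finset.sum_le_sum fun v _ => h1 v)
    simp
  have h0 : 0 < K.lk (S ω.2) ω.1 ω.2 := (pow_pos hl _).trans_le (h1 _)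
  have h3 : 0 < (Fintype.card W : ℝ) * lam ^ S ω.2 := by positivity
  rw [← Real.logb_mul hc.ne' (div_pos h0 (h3.trans_le h2)).ne', ← Real.logb_pow]
  refine Real.logb_le_logb_of_le one_lt_two (mul_pos hc (div_pos h0 (h3.trans_le h2))) ?_
  rw [one_div, inv_pow, ← mul_div_assoc, div_le_iff₀ (h3.trans_le h2), ← div_eq_inv_mul,
    le_div_iff₀ (by positivity)]
  calc _ ≤ Fintype.card W * 1 * lam ^ S ω.2 := by
        gcongr; exact K.lk_le_one _ _ _
    _ ≤ _ := by rw [mul_one]; exact h2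

end FeedbackKernel

/-! ### Images of laws and conditional laws -/

section Push

variable {Ω Ω' : Type*} [Fintype Ω] [Fintype Ω']

/-- The law of `φ` under `p`. -/
def pushLaw (p : Ω → ℝ) (φ : Ω → Ω') : Ω' → ℝ := fun τ => pr p fun ω => φ ω = τ

theorem expect_pushLaw (p : Ω → ℝ) (φ : Ω → Ω') (f : Ω' → ℝ) :
    expect (pushLaw p φ) f = expect p fun ω => f (φ ω) := by
  classical
  simp only [expect, pushLaw, pr, Finset.sum_mul, ite_mul, zero_mul]
  rw [Finset.sum_comm]
  simp

theorem pr_pushLaw (p : Ω → ℝ) (φ : Ω → Ω') (A : Ω' → Prop) :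
    pr (pushLaw p φ) A = pr p fun ω => A (φ ω) := by
  classical
  rw [pr_eq_expect, pr_eq_expect, expect_pushLaw]

theorem pr_condLaw (p : Ω → ℝ) (A B : Ω → Prop) :
    pr (condLaw p A) B = pr p (fun ω => A ω ∧ B ω) / pr p A := by
  classical
  rw [pr, pr, Finset.sum_div]
  refine Finset.sum_congr rfl fun ω _ => ?_
  by_cases hA : A ω <;> by_cases hB : B ω <;> simp [condLaw, hA, hB]

end Push

/-! ### Probabilities given past outputs, and the information lower bound -/

namespace FeedbackKernel

variable {W Y : Type*} [Fintype Y] [Fintype W] {L : ℕ} (K : FeedbackKernel W Y L)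

open Classical in
theorem pr_agree_and [Nonempty Y] (r : Fin L) (y₀ : Fin L → Y) (V : W × Y → Prop) :
    pr K.law (fun ω => Agree r y₀ ω.2 ∧ V (ω.1, ω.2 r)) = (Fintype.card W : ℝ)⁻¹ *
      ∑ w, K.lk r w y₀ * ∑ b, K.k w r y₀ b * if V (w, b) then 1 else 0 := by
  rw [pr_eq_expect,
    K.expect_law fun w y => if Agree r y₀ y ∧ V (w, y r) then 1 else 0]
  congr 1
  refine Finset.sum_congr rfl fun w _ => ?_
  rw [← K.sum_lk_agree_mul r w y₀ fun b => if V (w, b) then 1 else 0]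
  refine Finset.sum_congr rfl fun y _ => ?_
  by_cases h1 : Agree r y₀ y <;> by_cases h2 : V (w, y r) <;> simp [h1, h2]

theorem pr_agree [Nonempty Y] (r : Fin L) (y₀ : Fin L → Y) :
    pr K.law (fun ω => Agree r y₀ ω.2) = (Fintype.card W : ℝ)⁻¹ * K.totalLk r y₀ := by
  have := K.pr_agree_and r y₀ fun _ => True
  simpa [K.sum_eq_one, totalLk] using this

/-- Given its label, the message has uncertainty `log n` at the start and, by Fano, at most `1 +
P(error) log n` at `S`; the step at `r` removes at most `I r` on average. -/
theorem information_ge [Nonempty Y] [Nonempty W] {lam : ℝ} (hl : 0 < lam)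
    (hs : K.UniformSupport lam) {ι : Type*} (m : W → ι) {n : ℕ} (hn : 0 < n)
    (hfib : ∀ w, fiberSum m (fun _ => 1) w = n)
    {S : (Fin L → Y) → ℕ} (hS : IsStopRule S) (hSL : ∀ y, S y ≤ L) (d : (Fin L → Y) → W)
    (hd : ∀ y y', Agree (S y) y y' → d y = d y') (I : Fin L → (Fin L → Y) → ℝ)
    (hI : ∀ (r : Fin L) y, 0 < K.totalLk r y →
      ∑ w, ∑ b, K.lk r w y / K.totalLk r y * K.k w r y b *
      Real.logb 2 (K.k w r y b * fiberSum m (fun v => K.lk r v y / K.totalLk r y) w /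
        fiberSum m (fun v => K.lk r v y / K.totalLk r y * K.k v r y b) w) ≤ I r y) :
    (1 - pr K.law (fun ω => d ω.2 ≠ ω.1)) * Real.logb 2 n - 1 ≤
      expect K.law fun ω => ∑ r : Fin L, if (r : ℕ) < S ω.2 then I r ω.2 else 0 := by
  have h1 := expect_logb_fiber_ge hl hs m hn hfib hS hSL d hd
  have h2 := K.logb_add_expect_le hl hs m hn hfib hS hSL I hI
  linarith

end FeedbackKernel

/-! ### From codes to feedback distributions -/

/-- Multiplicative telescoping without division, because `g` may vanish. -/
theorem mul_prod_eq_of_step {L : ℕ} (f : Fin L → ℝ) (g : ℕ → ℝ)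
    (h : ∀ l : Fin L, g l * f l = g (l + 1)) : g 0 * ∏ l, f l = g L := by
  induction L with
  | zero => simp
  | succ L ih =>
    rw [Fin.prod_univ_castSucc, ← mul_assoc, ih (fun l => f l.castSucc) fun l => h l.castSucc]
    exact h (Fin.last L)

/-- A deterministic encoder with a uniform message is a randomized encoder without message. -/
theorem exists_randomized_encoder {M X Y : Type*} [Fintype M] [Nonempty M] [Fintype X]
    (enc : (t : ℕ) → M → (Fin t → Y) → X) :
    ∃ P : (l : ℕ) → (Fin l → X) → (Fin l → Y) → X → ℝ, (∀ l x y, P l x y ∈ stdSimplex ℝ X) ∧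
      ∀ (L : ℕ) (x : Fin L → X) (y : Fin L → Y),
        ∏ l : Fin L, P l (past x l l.2.le) (past y l l.2.le) (x l) =
          (Fintype.card M : ℝ)⁻¹ *
            pr (fun _ : M => 1) fun w => ∀ i : Fin L, enc i w (past y i i.2.le) = x i := by
  classical
  let C : (l : ℕ) → (Fin l → X) → (Fin l → Y) → M → Prop := fun l x y w =>
    ∀ i : Fin l, enc i w (past y i i.2.le) = x i
  -- `n` counts the messages compatible with the inputs so far, `n'` those that also send `a` next.
  -- The randomized encoder is `n' / n`; when no message is compatible any law will do, and a point
  -- mass is taken.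
  let n : (l : ℕ) → (Fin l → X) → (Fin l → Y) → ℝ := fun l x y => pr (fun _ : M => 1) (C l x y)
  let n' : (l : ℕ) → (Fin l → X) → (Fin l → Y) → X → ℝ := fun l x y a =>
    pr (fun _ : M => 1) fun w => C l x y w ∧ enc l w y = a
  have hn0 : ∀ l x y, 0 ≤ n l x y := fun l x y => pr_nonneg (fun _ => zero_le_one) _
  have hn'0 : ∀ l x y a, 0 ≤ n' l x y a := fun l x y a => pr_nonneg (fun _ => zero_le_one) _
  have hsum : ∀ l x y, ∑ a, n' l x y a = n l x y := by
    intro l x y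
    simp only [n, n', pr]
    rw [Finset.sum_comm]
    refine Finset.sum_congr rfl fun w _ => ?_
    by_cases h : C l x y w <;> simp [h]
  have hle : ∀ l x y a, n' l x y a ≤ n l x y := fun l x y a => by
    rw [← hsum]
    exact Finset.single_le_sum (fun a _ => hn'0 l x y a) (Finset.mem_univ a)
  let w₀ : M := Classical.arbitrary M
  refine ⟨fun l x y a => if n l x y = 0 then (if enc l w₀ y = a then 1 else 0)
    else n' l x y a / n l x y, ?_, ?_⟩
  · intro l x y
    constructor
    · intro a
      dsimp only
      split_ifs
      · exact zero_le_one
      · exact le_rfl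
      · exact div_nonneg (hn'0 _ _ _ _) (hn0 _ _ _)
    · by_cases h : n l x y = 0
      · simp [h]
      · simp only [h, if_false]
        rw [← Finset.sum_div, hsum, div_self h]
  · intro L x y
    set g : ℕ → ℝ := fun t => pr (fun _ : M => 1) fun w =>
      ∀ i : Fin L, (i : ℕ) < t → enc i w (past y i i.2.le) = x i with hg
    have hgn : ∀ l : Fin L, g l = n l (past x l l.2.le) (past y l l.2.le) := by
      intro l
      refine pr_congr fun w => ⟨fun h i => ?_, fun h i hi => ?_⟩
      · exact h (Fin.castLE l.2.le i) i.2
      · exact h ⟨i, hi⟩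
    have hgn' : ∀ l : Fin L, g (l + 1) = n' l (past x l l.2.le) (past y l l.2.le) (x l) := by
      intro l
      refine pr_congr fun w => ⟨fun h => ⟨fun i => ?_, ?_⟩, fun h i hi => ?_⟩
      · exact h (Fin.castLE l.2.le i) (i.2.trans (Nat.lt_succ_self _))
      · exact h l (Nat.lt_succ_self _)
      · rcases (Nat.lt_succ_iff.1 hi).lt_or_eq with h' | h'
        · exact h.1 ⟨i, h'⟩
        · obtain rfl := Fin.ext h'
          exact h.2
    have h0 : g 0 = Fintype.card M := by simp [hg, pr]
    have hL : g L = pr (fun _ : M => 1) fun w =>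
        ∀ i : Fin L, enc i w (past y i i.2.le) = x i :=
      pr_congr fun w => ⟨fun h i => h i i.2, fun h i _ => h i⟩
    rw [← hL, ← mul_prod_eq_of_step (fun l : Fin L => if n l (past x l l.2.le)
      (past y l l.2.le) = 0 then (if enc l w₀ (past y l l.2.le) = x l then 1 else 0)
      else n' l (past x l l.2.le) (past y l l.2.le) (x l) /
        n l (past x l l.2.le) (past y l l.2.le)) g, h0, inv_mul_cancel_left₀]
    · exact_mod_cast Fintype.card_ne_zero
    · intro l
      rw [hgn, hgn']
      split_ifs with h1 h2
      · rw [h1, zero_mul]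
        exact (le_antisymm (h1 ▸ hle _ _ _ _) (hn'0 _ _ _ _)).symm
      · rw [h1, zero_mul]
        exact (le_antisymm (h1 ▸ hle _ _ _ _) (hn'0 _ _ _ _)).symm
      · exact mul_div_cancel₀ _ h1

/-! ### The multi-letter law induced by a code -/

namespace VLC

variable {X₁ X₂ Y : Type*} {M₁ M₂ L : ℕ} (c : VLC X₁ X₂ Y M₁ M₂ L)

/-- The inputs of the first user. -/
def input₁ (w : Fin M₁) (y : Fin L → Y) (i : Fin L) : X₁ := c.enc₁ i w (past y i i.2.le)

/-- The inputs of the second user. -/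
def input₂ (w : Fin M₂) (y : Fin L → Y) (i : Fin L) : X₂ := c.enc₂ i w (past y i i.2.le)

theorem input₁_congr {y y' : Fin L → Y} {r : ℕ} (h : Agree r y y') (w : Fin M₁) {i : Fin L}
    (hi : (i : ℕ) ≤ r) : c.input₁ w y i = c.input₁ w y' i := by
  rw [input₁, input₁, (past_eq_past_iff _ y y').2 (h.mono hi)]

theorem input₂_congr {y y' : Fin L → Y} {r : ℕ} (h : Agree r y y') (w : Fin M₂) {i : Fin L}
    (hi : (i : ℕ) ≤ r) : c.input₂ w y i = c.input₂ w y' i := by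
  rw [input₂, input₂, (past_eq_past_iff _ y y').2 (h.mono hi)]

/-- Inputs and outputs as functions of messages and outputs. -/
def traj (ω : (Fin M₁ × Fin M₂) × (Fin L → Y)) : Traj X₁ X₂ Y L :=
  (c.input₁ ω.1.1 ω.2, c.input₂ ω.1.2 ω.2, ω.2)

theorem past_input₁_congr {r : Fin L} {y₀ y : Fin L → Y} (h : Agree r y₀ y) (w : Fin M₁) :
    past (c.input₁ w y) (r + 1) r.2 = past (c.input₁ w y₀) (r + 1) r.2 :=
  funext fun i => (c.input₁_congr h w (Nat.lt_succ_iff.1 i.2)).symm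

theorem past_input₂_congr {r : Fin L} {y₀ y : Fin L → Y} (h : Agree r y₀ y) (w : Fin M₂) :
    past (c.input₂ w y) (r + 1) r.2 = past (c.input₂ w y₀) (r + 1) r.2 :=
  funext fun i => (c.input₂_congr h w (Nat.lt_succ_iff.1 i.2)).symm

variable [Fintype Y]

/-- The channel from the pair of messages to the outputs. -/
def kernel {Q : X₁ → X₂ → Y → ℝ} (hQ : ∀ x₁ x₂, Q x₁ x₂ ∈ stdSimplex ℝ Y) :
    FeedbackKernel (Fin M₁ × Fin M₂) Y L where
  k w r y b := Q (c.input₁ w.1 y r) (c.input₂ w.2 y r) b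
  nonneg _ _ _ b := (hQ _ _).1 b
  sum_eq_one _ _ _ := (hQ _ _).2
  predictable w r y y' h := by
    rw [c.input₁_congr h w.1 le_rfl, c.input₂_congr h w.2 le_rfl]

variable {Q : X₁ → X₂ → Y → ℝ} (hQ : ∀ x₁ x₂, Q x₁ x₂ ∈ stdSimplex ℝ Y)

theorem law_eq : c.law Q = (c.kernel hQ).law := by
  funext ω
  simp only [law, FeedbackKernel.law, FeedbackKernel.lk, Fin.is_lt, if_true, Fintype.card_prod,
    Fintype.card_fin, Nat.cast_mul, one_div]
  rfl

variable [Fintype X₁] [Fintype X₂]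

/-- The joint law of the inputs and outputs. -/
def jointLaw (c : VLC X₁ X₂ Y M₁ M₂ L) (Q : X₁ → X₂ → Y → ℝ) : Traj X₁ X₂ Y L → ℝ :=
  pushLaw (c.law Q) c.traj

/-- Each encoder sees only its own message and the outputs, so the set of message pairs compatible
with a trajectory is a product. Its two factors are the products of the randomized encoders. -/
theorem jointLaw_mem_feedbackLaws [NeZero M₁] [NeZero M₂] :
    c.jointLaw Q ∈ feedbackLaws Q L := by
  classical
  obtain ⟨P₁, hP₁, e₁⟩ := exists_randomized_encoder c.enc₁
  obtain ⟨P₂, hP₂, e₂⟩ := exists_randomized_encoder c.enc₂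
  refine ⟨P₁, P₂, hP₁, hP₂, fun τ => ?_⟩
  obtain ⟨x₁, x₂, y⟩ := τ
  have h : c.jointLaw Q (x₁, x₂, y) = ∑ w₁, ∑ w₂,
      (if ∀ i : Fin L, c.enc₁ i w₁ (past y i i.2.le) = x₁ i then 1 else 0) *
        (if ∀ i : Fin L, c.enc₂ i w₂ (past y i i.2.le) = x₂ i then 1 else 0) *
        (1 / ((M₁ : ℝ) * M₂) * ∏ l, Q (x₁ l) (x₂ l) (y l)) := by
    rw [jointLaw, pushLaw, pr, Fintype.sum_prod_type, Fintype.sum_prod_type]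
    refine Finset.sum_congr rfl fun w₁ _ => Finset.sum_congr rfl fun w₂ _ => ?_
    rw [Finset.sum_eq_single y]
    · have ht : c.traj ((w₁, w₂), y) = (x₁, x₂, y) ↔
          (∀ i : Fin L, c.enc₁ i w₁ (past y i i.2.le) = x₁ i) ∧
          ∀ i : Fin L, c.enc₂ i w₂ (past y i i.2.le) = x₂ i := by
        simp only [traj, Prod.mk.injEq, and_true, funext_iff]
        rfl
      by_cases h1 : ∀ i : Fin L, c.enc₁ i w₁ (past y i i.2.le) = x₁ i
      · by_cases h2 : ∀ i : Fin L, c.enc₂ i w₂ (past y i i.2.le) = x₂ i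
        · rw [if_pos (ht.2 ⟨h1, h2⟩), if_pos h1, if_pos h2, one_mul, one_mul, law]
          simp only [h1, h2]
        · rw [if_neg fun h => h2 (ht.1 h).2, if_neg h2]; ring
      · rw [if_neg fun h => h1 (ht.1 h).1, if_neg h1]; ring
    · intro y' _ hy'
      rw [if_neg]
      simp [traj, hy']
    · simp
  rw [h, Finset.prod_mul_distrib, Finset.prod_mul_distrib, e₁, e₂, pr_eq_expect, pr_eq_expect]
  simp only [expect, one_mul, Fintype.card_fin, ← Finset.sum_mul, ← Finset.mul_sum]
  field_simp

variable {c} in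
theorem pr_jointLaw_past [Nonempty Y] (r : Fin L) (y₀ : Fin L → Y) (V : Traj X₁ X₂ Y L → Prop)
    (V' : (Fin M₁ × Fin M₂) × Y → Prop)
    (hV : ∀ w y, Agree r y₀ y → (V (c.traj (w, y)) ↔ V' (w, y r))) :
    pr (c.jointLaw Q) (fun τ => past τ.2.2 r r.2.le = past y₀ r r.2.le ∧ V τ) =
      pr (c.kernel hQ).law fun ω => Agree r y₀ ω.2 ∧ V' (ω.1, ω.2 r) := by
  rw [jointLaw, pr_pushLaw, law_eq c hQ]
  refine pr_congr fun ω => ?_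
  rw [past_eq_past_iff]
  constructor
  · rintro ⟨h1, h2⟩
    exact ⟨h1.symm, (hV _ _ h1.symm).1 h2⟩
  · rintro ⟨h1, h2⟩
    exact ⟨h1.symm, (hV _ _ h1).2 h2⟩

/-- Given the past outputs, the present inputs and output depend on the messages and the present
output only. -/
theorem entropy_condLaw_jointLaw [Nonempty Y] [NeZero M₁] [NeZero M₂] {α : Type*} [Fintype α]
    {r : Fin L} {y₀ : Fin L → Y} (U : Traj X₁ X₂ Y L → α)
    (U' : (Fin M₁ × Fin M₂) × Y → α)
    (hU : ∀ w y, Agree r y₀ y → U (c.traj (w, y)) = U' (w, y r)) :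
    entropy (condLaw (c.jointLaw Q) fun τ => past τ.2.2 r r.2.le = past y₀ r r.2.le) U =
      entropy (fun x : (Fin M₁ × Fin M₂) × Y => (c.kernel hQ).lk r x.1 y₀ /
        (c.kernel hQ).totalLk r y₀ * (c.kernel hQ).k x.1 r y₀ x.2) U' := by
  classical
  set K := c.kernel hQ
  refine entropy_congr fun a => ?_
  have h1 : pr (c.jointLaw Q) (fun τ => past τ.2.2 r r.2.le = past y₀ r r.2.le) =
      pr K.law fun ω => Agree r y₀ ω.2 := by
    have := pr_jointLaw_past (c := c) hQ r y₀ (fun _ => True) (fun _ => True) (by simp)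
    simpa using this
  have hc : (Fintype.card (Fin M₁ × Fin M₂) : ℝ) ≠ 0 := by
    exact_mod_cast Fintype.card_ne_zero
  rw [pr_condLaw, pr_jointLaw_past hQ r y₀ (fun τ => U τ = a) (fun x => U' x = a)
    (fun w y h => by rw [hU w y h]), h1, K.pr_agree_and r y₀ (fun x => U' x = a), K.pr_agree,
    mul_div_mul_left _ _ (inv_ne_zero hc), pr, Finset.sum_div]
  refine Eq.trans ?_ (Fintype.sum_prod_type _).symm
  refine Finset.sum_congr rfl fun w _ => ?_
  rw [mul_div_right_comm, Finset.mul_sum]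
  refine Finset.sum_congr rfl fun b _ => ?_
  split_ifs <;> simp

theorem condMutualInfo_condLaw_jointLaw [Nonempty Y] [NeZero M₁] [NeZero M₂]
    {α β γ : Type*} [Fintype α] [Fintype β] [Fintype γ] {r : Fin L} {y₀ : Fin L → Y}
    (U : Traj X₁ X₂ Y L → α) (V : Traj X₁ X₂ Y L → β)
    (C : Traj X₁ X₂ Y L → γ) (U' : (Fin M₁ × Fin M₂) × Y → α) (V' : (Fin M₁ × Fin M₂) × Y → β)
    (C' : (Fin M₁ × Fin M₂) × Y → γ)
    (hU : ∀ w y, Agree r y₀ y → U (c.traj (w, y)) = U' (w, y r))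
    (hV : ∀ w y, Agree r y₀ y → V (c.traj (w, y)) = V' (w, y r))
    (hC : ∀ w y, Agree r y₀ y → C (c.traj (w, y)) = C' (w, y r)) :
    condMutualInfo (condLaw (c.jointLaw Q) fun τ => past τ.2.2 r r.2.le = past y₀ r r.2.le)
        U V C =
      condMutualInfo (fun x : (Fin M₁ × Fin M₂) × Y => (c.kernel hQ).lk r x.1 y₀ /
        (c.kernel hQ).totalLk r y₀ * (c.kernel hQ).k x.1 r y₀ x.2) U' V' C' := by
  rw [condMutualInfo, condMutualInfo,
    c.entropy_condLaw_jointLaw hQ (fun τ => (U τ, C τ)) (fun x => (U' x, C' x))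
      fun w y h => by rw [hU w y h, hC w y h],
    c.entropy_condLaw_jointLaw hQ (fun τ => (V τ, C τ)) (fun x => (V' x, C' x))
      fun w y h => by rw [hV w y h, hC w y h],
    c.entropy_condLaw_jointLaw hQ (fun τ => (U τ, V τ, C τ)) (fun x => (U' x, V' x, C' x))
      fun w y h => by rw [hU w y h, hV w y h, hC w y h],
    c.entropy_condLaw_jointLaw hQ C C' hC]

/-- The label is the second message: given the past outputs it determines the second user's inputs,
as `condMutualInfo_ge` requires, and its fibres have `M₁` elements. -/
theorem directedInfoCausal_one_ge [Nonempty Y] [NeZero M₁] [NeZero M₂] {lam : ℝ} (hl : 0 < lam)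
    (hs : (c.kernel hQ).UniformSupport lam) {S : (Fin L → Y) → ℕ} (hS : IsStopRule S)
    (hSL : ∀ y, S y ≤ L) (d : (Fin L → Y) → Fin M₁ × Fin M₂)
    (hd : ∀ y y', Agree (S y) y y' → d y = d y') :
    (1 - pr (c.law Q) fun ω => d ω.2 ≠ ω.1) * Real.logb 2 M₁ - 1 ≤
      directedInfoCausal (c.jointLaw Q) (fun ω => ω.1) (fun ω => ω.2.2) (fun ω => ω.2.1) S := by
  classical
  rw [directedInfoCausal, jointLaw, expect_pushLaw, law_eq c hQ]
  refine (c.kernel hQ).information_ge hl hs Prod.snd (NeZero.pos M₁) (fun w => ?_) hS hSL d hd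
    (fun r y => condMutualInfo (condLaw (pushLaw (c.kernel hQ).law c.traj)
      fun τ => past τ.2.2 r r.2.le = past y r r.2.le) (fun τ => past τ.1 (r + 1) r.2)
      (fun τ => τ.2.2 r) (fun τ => past τ.2.1 (r + 1) r.2)) fun r y h0 => ?_
  · rw [fiberSum, Fintype.sum_prod_type]
    refine (Finset.sum_congr rfl fun x _ => Finset.sum_eq_single w.2 ?_ ?_).trans (by simp) <;>
      simp +contextual
  · rw [← law_eq c hQ]
    refine (condMutualInfo_ge (k := fun w b => (c.kernel hQ).k w r y b)
      (fun u v b => Q (u (Fin.last r)) (v (Fin.last r)) b)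
      (fun w => past (c.input₁ w.1 y) (r + 1) r.2) (fun w => past (c.input₂ w.2 y) (r + 1) r.2)
      Prod.snd (fun v w h => by rw [h]) (fun w b => rfl)
      (fun w => div_nonneg ((c.kernel hQ).lk_nonneg _ _ _) h0.le)
      (fun w b => (c.kernel hQ).nonneg _ _ _ _)
      (fun w => (c.kernel hQ).sum_eq_one _ _ _)).trans (le_of_eq ?_)
    exact (c.condMutualInfo_condLaw_jointLaw hQ _ _ _ _ _ _
      (fun w y' h => c.past_input₁_congr h w.1) (fun w y' h => rfl)
      fun w y' h => c.past_input₂_congr h w.2).symm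

theorem directedInfoCausal_two_ge [Nonempty Y] [NeZero M₁] [NeZero M₂] {lam : ℝ} (hl : 0 < lam)
    (hs : (c.kernel hQ).UniformSupport lam) {S : (Fin L → Y) → ℕ} (hS : IsStopRule S)
    (hSL : ∀ y, S y ≤ L) (d : (Fin L → Y) → Fin M₁ × Fin M₂)
    (hd : ∀ y y', Agree (S y) y y' → d y = d y') :
    (1 - pr (c.law Q) fun ω => d ω.2 ≠ ω.1) * Real.logb 2 M₂ - 1 ≤
      directedInfoCausal (c.jointLaw Q) (fun ω => ω.2.1) (fun ω => ω.2.2) (fun ω => ω.1) S := by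
  classical
  rw [directedInfoCausal, jointLaw, expect_pushLaw, law_eq c hQ]
  refine (c.kernel hQ).information_ge hl hs Prod.fst (NeZero.pos M₂) (fun w => ?_) hS hSL d hd
    (fun r y => condMutualInfo (condLaw (pushLaw (c.kernel hQ).law c.traj)
      fun τ => past τ.2.2 r r.2.le = past y r r.2.le) (fun τ => past τ.2.1 (r + 1) r.2)
      (fun τ => τ.2.2 r) (fun τ => past τ.1 (r + 1) r.2)) fun r y h0 => ?_
  · rw [fiberSum, Fintype.sum_prod_type_right]
    refine (Finset.sum_congr rfl fun x _ => Finset.sum_eq_single w.1 ?_ ?_).trans (by simp) <;>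
      simp +contextual
  · rw [← law_eq c hQ]
    refine (condMutualInfo_ge (k := fun w b => (c.kernel hQ).k w r y b)
      (fun u v b => Q (v (Fin.last r)) (u (Fin.last r)) b)
      (fun w => past (c.input₂ w.2 y) (r + 1) r.2) (fun w => past (c.input₁ w.1 y) (r + 1) r.2)
      Prod.fst (fun v w h => by rw [h]) (fun w b => rfl)
      (fun w => div_nonneg ((c.kernel hQ).lk_nonneg _ _ _) h0.le)
      (fun w b => (c.kernel hQ).nonneg _ _ _ _)
      (fun w => (c.kernel hQ).sum_eq_one _ _ _)).trans (le_of_eq ?_)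
    exact (c.condMutualInfo_condLaw_jointLaw hQ _ _ _ _ _ _
      (fun w y' h => c.past_input₂_congr h w.2) (fun w y' h => rfl)
      fun w y' h => c.past_input₁_congr h w.1).symm

/-- With a trivial label the message is the whole pair, and conditioning on a constant turns
conditional into plain mutual information. -/
theorem directedInfo_ge [Nonempty Y] [NeZero M₁] [NeZero M₂] {lam : ℝ} (hl : 0 < lam)
    (hs : (c.kernel hQ).UniformSupport lam) {S : (Fin L → Y) → ℕ} (hS : IsStopRule S)
    (hSL : ∀ y, S y ≤ L) (d : (Fin L → Y) → Fin M₁ × Fin M₂)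
    (hd : ∀ y y', Agree (S y) y y' → d y = d y') :
    (1 - pr (c.law Q) fun ω => d ω.2 ≠ ω.1) * Real.logb 2 (M₁ * M₂ : ℕ) - 1 ≤
      directedInfo (c.jointLaw Q) (fun ω i => (ω.1 i, ω.2.1 i)) (fun ω => ω.2.2) S := by
  classical
  rw [directedInfo, jointLaw, expect_pushLaw, law_eq c hQ]
  refine (c.kernel hQ).information_ge hl hs (fun _ => ()) (NeZero.pos (M₁ * M₂)) (fun w => ?_)
    hS hSL d hd (fun r y => mutualInfo (condLaw (pushLaw (c.kernel hQ).law c.traj)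
      fun τ => past τ.2.2 r r.2.le = past y r r.2.le)
      (fun τ => past (fun i => (τ.1 i, τ.2.1 i)) (r + 1) r.2)
      (fun τ => τ.2.2 r)) fun r y h0 => ?_
  · simp [fiberSum]
  · rw [← law_eq c hQ]
    refine (condMutualInfo_ge (k := fun w b => (c.kernel hQ).k w r y b)
      (fun u _ b => Q (u (Fin.last r)).1 (u (Fin.last r)).2 b)
      (fun w => past (fun i => (c.input₁ w.1 y i, c.input₂ w.2 y i)) (r + 1) r.2) (fun _ => ())
      (fun _ => ()) (fun _ _ _ => rfl) (fun w b => rfl)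
      (fun w => div_nonneg ((c.kernel hQ).lk_nonneg _ _ _) h0.le)
      (fun w b => (c.kernel hQ).nonneg _ _ _ _)
      (fun w => (c.kernel hQ).sum_eq_one _ _ _)).trans (le_of_eq ?_)
    have h1 := c.condMutualInfo_condLaw_jointLaw hQ
      (fun τ => past (fun i => (τ.1 i, τ.2.1 i)) (r + 1) r.2) (fun τ => τ.2.2 r) (fun _ => ())
      (fun x => past (fun i => (c.input₁ x.1.1 y i, c.input₂ x.1.2 y i)) (r + 1) r.2)
      (fun x => x.2) (fun _ => ())
      (fun w y' h => funext fun i => Prod.ext (congrFun (c.past_input₁_congr h w.1) i)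
        (congrFun (c.past_input₂_congr h w.2) i)) (fun w y' h => rfl) fun w y' h => rfl
    rw [← h1]
    refine (mutualInfo_eq_condMutualInfo_unit ?_ _ _).symm
    have h2 : ∀ p : Traj X₁ X₂ Y L → ℝ, ∑ ω, p ω = pr p fun _ => True := by simp [pr]
    have h3 : pr (c.jointLaw Q) (fun τ => past τ.2.2 r r.2.le = past y r r.2.le) ≠ 0 := by
      have h4 := pr_jointLaw_past (c := c) hQ r y (fun _ => True) (fun _ => True) (by simp)
      simp only [and_true] at h4
      rw [h4, (c.kernel hQ).pr_agree]
      refine mul_ne_zero (inv_ne_zero ?_) h0.ne'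
      exact_mod_cast Fintype.card_ne_zero
    rw [h2, pr_condLaw]
    simp only [and_true]
    exact div_self h3

end VLC

/-! ### Channels whose rows have finite divergence -/

section Channel

variable {X₁ X₂ Y : Type*} [Fintype Y] {Q : X₁ → X₂ → Y → ℝ}

theorem relEntropy_le_D₃ (x₁ x₁' : X₁) (x₂ x₂' : X₂) :
    relEntropy (Q x₁ x₂) (Q x₁' x₂') ≤ D₃ Q :=
  le_iSup_of_le x₁ <| le_iSup_of_le x₁' <| le_iSup_of_le x₂ <|
    le_iSup (fun x₂' => relEntropy (Q x₁ x₂) (Q x₁' x₂')) x₂'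

theorem eq_zero_of_D₃_lt_top (hD : D₃ Q < ⊤) (x₁ x₁' : X₁) (x₂ x₂' : X₂) {y : Y}
    (h : Q x₁' x₂' y = 0) : Q x₁ x₂ y = 0 := by
  by_contra hne
  have h1 : relEntropy (Q x₁ x₂) (Q x₁' x₂') = ⊤ := by
    rw [relEntropy, if_neg]
    exact fun h' => hne (h' y h)
  exact absurd (h1 ▸ relEntropy_le_D₃ x₁ x₁' x₂ x₂') (not_le.2 hD)

theorem sum_mul_logb_le_D₃ (hD : D₃ Q < ⊤) (x₁ x₁' : X₁) (x₂ x₂' : X₂) :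
    ∑ y, Q x₁ x₂ y * Real.logb 2 (Q x₁ x₂ y / Q x₁' x₂' y) ≤ (D₃ Q).toReal := by
  have h1 := relEntropy_le_D₃ (Q := Q) x₁ x₁' x₂ x₂'
  rw [relEntropy, if_pos fun y h => eq_zero_of_D₃_lt_top hD x₁ x₁' x₂ x₂' h] at h1
  exact (ENNReal.ofReal_le_iff_le_toReal hD.ne).1 h1

theorem exists_relEntropy_eq_D₃ [Finite X₁] [Finite X₂] [Nonempty X₁] [Nonempty X₂] :
    ∃ x₁ x₁' x₂ x₂', relEntropy (Q x₁ x₂) (Q x₁' x₂') = D₃ Q := by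
  obtain ⟨⟨x₁, x₁', x₂, x₂'⟩, h⟩ := Finite.exists_max
    fun x : X₁ × X₁ × X₂ × X₂ => relEntropy (Q x.1 x.2.2.1) (Q x.2.1 x.2.2.2)
  exact ⟨x₁, x₁', x₂, x₂', le_antisymm (relEntropy_le_D₃ _ _ _ _) <|
    iSup_le fun a => iSup_le fun a' => iSup_le fun b => iSup_le fun b' => h (a, a', b, b')⟩

/-- All rows share one support, and there are finitely many entries. -/
theorem exists_uniform_lower_bound [Finite X₁] [Finite X₂]
    (hQ : ∀ x₁ x₂, Q x₁ x₂ ∈ stdSimplex ℝ Y) (hD : D₃ Q < ⊤) :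
    ∃ lam : ℝ, 0 < lam ∧ lam ≤ 1 ∧ ∀ x₁ x₁' x₂ x₂' y, 0 < Q x₁ x₂ y → lam ≤ Q x₁' x₂' y := by
  classical
  rcases isEmpty_or_nonempty (X₁ × X₂ × Y) with he | he
  · exact ⟨1, one_pos, le_rfl, fun x₁ _ x₂ _ y _ => he.elim (x₁, x₂, y)⟩
  obtain ⟨m, hm⟩ := Finite.exists_min
    fun x : X₁ × X₂ × Y => if 0 < Q x.1 x.2.1 x.2.2 then min 1 (Q x.1 x.2.1 x.2.2) else 1
  refine ⟨if 0 < Q m.1 m.2.1 m.2.2 then min 1 (Q m.1 m.2.1 m.2.2) else 1, ?_, ?_,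
    fun x₁ x₁' x₂ x₂' y h => ?_⟩
  · split_ifs with h
    · exact lt_min one_pos h
    · exact one_pos
  · split_ifs with h
    · exact min_le_left _ _
    · exact le_rfl
  · have h' : 0 < Q x₁' x₂' y := ((hQ _ _).1 y).lt_of_ne' fun h0 =>
      h.ne' (eq_zero_of_D₃_lt_top hD x₁ x₁' x₂ x₂' h0)
    have := hm (x₁', x₂', y)
    simp only [h', if_true] at this
    exact this.trans (min_le_right _ _)

end Channel

/-! ### Codes followed by a deterministic tail -/

namespace VLC

variable {X₁ X₂ Y : Type*} {M₁ M₂ N : ℕ}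

/-- The code `c` with `n` more letters, during which the users send `x₁` and `x₂`. -/
def extend (c : VLC X₁ X₂ Y M₁ M₂ N) (n : ℕ) (x₁ : X₁) (x₂ : X₂) :
    VLC X₁ X₂ Y M₁ M₂ (N + n) where
  enc₁ t w h := if t < N then c.enc₁ t w h else x₁
  enc₂ t w h := if t < N then c.enc₂ t w h else x₂
  dec := c.dec
  T y := c.T (past y N (Nat.le_add_right N n))
  isStop := by
    refine IsStopRule.isStop (fun y y' h => ?_) fun y => c.isStop.one_le _
    exact c.isStop.isStopRule _ _ fun i hi => h (Fin.castLE _ i) hi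
  le_N y := (c.le_N _).trans (Nat.le_add_right N n)

variable (c : VLC X₁ X₂ Y M₁ M₂ N) (n : ℕ) (x₁ : X₁) (x₂ : X₂)

theorem extend_input₁ (w : Fin M₁) (y : Fin (N + n) → Y) {i : Fin (N + n)} (hi : N ≤ i) :
    (c.extend n x₁ x₂).input₁ w y i = x₁ := if_neg hi.not_gt

theorem extend_input₂ (w : Fin M₂) (y : Fin (N + n) → Y) {i : Fin (N + n)} (hi : N ≤ i) :
    (c.extend n x₁ x₂).input₂ w y i = x₂ := if_neg hi.not_gt

variable [Fintype Y] {Q : X₁ → X₂ → Y → ℝ}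

theorem extend_lk (hQ : ∀ x₁ x₂, Q x₁ x₂ ∈ stdSimplex ℝ Y)
    (w : Fin M₁ × Fin M₂) (y : Fin (N + n) → Y) :
    ((c.extend n x₁ x₂).kernel hQ).lk N w y =
      (c.kernel hQ).lk N w (past y N (Nat.le_add_right N n)) := by
  rw [FeedbackKernel.lk, FeedbackKernel.lk, Fin.prod_univ_add]
  simp only [Fin.val_castAdd, Fin.is_lt, if_true, Fin.val_natAdd, not_lt.2 (Nat.le_add_right _ _),
    if_false, Finset.prod_const_one, mul_one]
  refine Finset.prod_congr rfl fun i _ => ?_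
  have h1 : (c.extend n x₁ x₂).input₁ w.1 y (Fin.castAdd n i) =
      c.input₁ w.1 (past y N (Nat.le_add_right N n)) i := if_pos i.2
  have h2 : (c.extend n x₁ x₂).input₂ w.2 y (Fin.castAdd n i) =
      c.input₂ w.2 (past y N (Nat.le_add_right N n)) i := if_pos i.2
  change Q _ _ _ = Q _ _ _
  rw [h1, h2]
  rfl

theorem expect_extend [Nonempty Y] (hQ : ∀ x₁ x₂, Q x₁ x₂ ∈ stdSimplex ℝ Y)
    (g : Fin M₁ × Fin M₂ → (Fin N → Y) → ℝ) :
    expect ((c.extend n x₁ x₂).law Q)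
      (fun ω => g ω.1 (past ω.2 N (Nat.le_add_right N n))) =
      expect (c.law Q) fun ω => g ω.1 ω.2 := by
  classical
  rw [law_eq _ hQ, law_eq _ hQ, FeedbackKernel.expect_law,
    FeedbackKernel.expect_law _ fun w y => g w (past y N (Nat.le_add_right N n))]
  congr 1
  refine Finset.sum_congr rfl fun w _ => ?_
  have h1 : ∀ y : Fin (N + n) → Y, ((c.extend n x₁ x₂).kernel hQ).lk (N + n) w y *
      g w (past y N (Nat.le_add_right N n)) = ∑ u, if past y N (Nat.le_add_right N n) = u then
        ((c.extend n x₁ x₂).kernel hQ).lk (N + n) w y * g w u else 0 := by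
    intro y; simp
  simp only [h1]
  rw [Finset.sum_comm]
  refine Finset.sum_congr rfl fun u _ => ?_
  let y₀ : Fin (N + n) → Y := Fin.append u fun _ => Classical.arbitrary Y
  have hy₀ : past y₀ N (Nat.le_add_right N n) = u := funext fun i => Fin.append_left u _ i
  rw [← hy₀, ← c.extend_lk n x₁ x₂ hQ,
    ← FeedbackKernel.sum_lk_agree _ (Nat.le_add_right N n), Finset.sum_mul]
  refine Finset.sum_congr rfl fun y _ => ?_
  by_cases h : Agree N y₀ y
  · rw [if_pos h, if_pos ((past_eq_past_iff _ _ _).2 h.symm)]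
  · rw [if_neg h, if_neg fun h' => h ((past_eq_past_iff _ _ _).1 h').symm, zero_mul]

theorem extend_errorProb [Nonempty Y] (hQ : ∀ x₁ x₂, Q x₁ x₂ ∈ stdSimplex ℝ Y) :
    (c.extend n x₁ x₂).errorProb Q = c.errorProb Q := by
  classical
  rw [errorProb, errorProb, pr_eq_expect, pr_eq_expect]
  exact c.expect_extend n x₁ x₂ hQ fun w y => if c.decoded y ≠ w then 1 else 0

theorem extend_meanT [Nonempty Y] (hQ : ∀ x₁ x₂, Q x₁ x₂ ∈ stdSimplex ℝ Y) :
    (c.extend n x₁ x₂).meanT Q = c.meanT Q :=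
  c.expect_extend n x₁ x₂ hQ fun _ y => (c.T y : ℝ)

end VLC

/-- Only the `n` tail terms of the numerator are kept, each at least `D`; the mean gap in the
denominator is at most `N + n`. -/
theorem le_avgEffDiv {Ω α β γ : Type*} [Fintype Ω] [Fintype β] [Fintype γ] {N n : ℕ}
    {K : α → β → γ → ℝ} {P : Ω → ℝ} (hP : ∀ ω, 0 ≤ P ω)
    (hP1 : ∑ ω, P ω = 1) (A : Ω → Fin (N + n) → α) (B : Ω → Fin (N + n) → γ)
    {S : (Fin (N + n) → γ) → ℕ} (hS : ∀ y, S y ≤ N) {D : ℝ≥0∞}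
    (h : ∀ ω, 0 < P ω → ∀ r : Fin (N + n), N ≤ r →
      D ≤ effDiv K P A B r (past (B ω) r r.2.le)) :
    n * D / (N + n : ℕ) ≤ avgEffDiv K P A B S fun _ => N + n := by
  classical
  rw [avgEffDiv]
  refine ENNReal.div_le_div ?_ ?_
  · have h1 : ∀ ω, ENNReal.ofReal (P ω) * (n * D) ≤ ENNReal.ofReal (P ω) *
        ∑ r : Fin (N + n), if S (B ω) ≤ r ∧ (r : ℕ) < N + n then
          effDiv K P A B r (past (B ω) r r.2.le) else 0 := by
      intro ω
      rcases (hP ω).eq_or_lt with h0 | h0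
      · simp [← h0]
      · refine mul_le_mul_right ?_ _
        rw [Fin.sum_univ_add]
        refine le_trans ?_ le_add_self
        have h2 : (n : ℝ≥0∞) * D = ∑ _j : Fin n, D := by simp
        rw [h2]
        refine Finset.sum_le_sum fun j _ => ?_
        have h3 : N ≤ (Fin.natAdd N j : ℕ) := by simp
        rw [if_pos ⟨(hS _).trans h3, (Fin.natAdd N j).2⟩]
        exact h ω h0 _ h3
    refine le_trans (le_of_eq ?_) (Finset.sum_le_sum fun ω _ => h1 ω)
    rw [← Finset.sum_mul, ← ENNReal.ofReal_sum_of_nonneg fun ω _ => hP ω, hP1,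
      ENNReal.ofReal_one, one_mul]
  · rw [← ENNReal.ofReal_natCast]
    refine ENNReal.ofReal_le_ofReal ?_
    refine le_trans (expect_mono hP (g := fun _ => ((N + n : ℕ) : ℝ)) fun ω _ => ?_)
      (expect_const hP1 _).le
    have : (0 : ℝ) ≤ S (B ω) := Nat.cast_nonneg _
    linarith

/-- The supremum over laws of the other user's input is tested at the point mass at `b'`. -/
theorem le_effDiv {Ω α β γ : Type*} [Fintype Ω] [Fintype β] [Fintype γ] {N : ℕ}
    {K : α → β → γ → ℝ} {P : Ω → ℝ} {A : Ω → Fin N → α}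
    {B : Ω → Fin N → γ} {r : Fin N} {h : Fin r → γ} (a a' : α) (b' : β) (p : γ → ℝ)
    (ha : 0 < pr P fun ω => A ω r = a ∧ past (B ω) r r.2.le = h)
    (hp : ∀ y, pr P (fun ω => B ω r = y ∧ A ω r = a ∧ past (B ω) r r.2.le = h) =
      p y * pr P fun ω => A ω r = a ∧ past (B ω) r r.2.le = h) :
    relEntropy p (K a' b') ≤ effDiv K P A B r h := by
  classical
  rw [effDiv]
  refine le_iSup₂_of_le a ha (le_iSup_of_le a' (le_iSup₂_of_le (Pi.single b' 1)
    (single_mem_stdSimplex ℝ b') (le_of_eq ?_)))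
  congr 1
  · funext y
    rw [hp, mul_div_cancel_right₀ _ ha.ne']
  · funext y
    simp [Pi.single_apply]

namespace VLC

variable {X₁ X₂ Y : Type*} [Fintype Y] {M₁ M₂ : ℕ}
  {Q : X₁ → X₂ → Y → ℝ} {L : ℕ} (c : VLC X₁ X₂ Y M₁ M₂ L)

theorem jointLaw_nonneg (hQ : ∀ x₁ x₂, Q x₁ x₂ ∈ stdSimplex ℝ Y) (τ : Traj X₁ X₂ Y L) : 0 ≤ c.jointLaw Q τ := by
  rw [jointLaw, law_eq c hQ]
  exact pr_nonneg (c.kernel hQ).law_nonneg _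

theorem sum_jointLaw [Fintype X₁] [Fintype X₂] [NeZero M₁] [NeZero M₂] [Nonempty Y]
    (hQ : ∀ x₁ x₂, Q x₁ x₂ ∈ stdSimplex ℝ Y) : ∑ τ, c.jointLaw Q τ = 1 := by
  have := expect_pushLaw (c.law Q) c.traj fun _ => 1
  simp only [expect, mul_one] at this
  rw [jointLaw, this, law_eq c hQ, (c.kernel hQ).sum_law]

end VLC

/-! ### The converse for a code, and the divergences along its tail -/

namespace VLC

variable {X₁ X₂ Y : Type*} [Fintype Y] {M₁ M₂ : ℕ} [Nonempty Y] {Q : X₁ → X₂ → Y → ℝ}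

/-- An output sequence of positive probability is possible under every message pair, and the decoder
is right for only one of them. Hence the error exponent is finite. -/
theorem errorProb_pos {L : ℕ} (c : VLC X₁ X₂ Y M₁ M₂ L)
    (hQ : ∀ x₁ x₂, Q x₁ x₂ ∈ stdSimplex ℝ Y) {lam : ℝ} (hl : 0 < lam)
    (hs : (c.kernel hQ).UniformSupport lam) [Nontrivial (Fin M₁ × Fin M₂)] :
    0 < c.errorProb Q := by
  classical
  obtain ⟨ω, hω⟩ : ∃ ω, 0 < (c.kernel hQ).law ω := by
    by_contra! h
    have := Finset.sum_nonpos fun ω (_ : ω ∈ Finset.univ) => h ω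
    rw [(c.kernel hQ).sum_law] at this
    linarith
  obtain ⟨v, hv⟩ := exists_ne (c.decoded ω.2)
  have h1 := hs.lk_pos hl ((c.kernel hQ).lk_pos_of_law_pos hω) v
  have h2 : 0 < (c.kernel hQ).law (v, ω.2) := by
    rw [FeedbackKernel.law]
    refine mul_pos (inv_pos.2 ?_) h1
    exact_mod_cast Fintype.card_pos
  rw [errorProb, law_eq c hQ]
  exact h2.trans_le (le_pr (c.kernel hQ).law_nonneg (A := fun ω => c.decoded ω.2 ≠ ω.1) hv.symm)

variable [Fintype X₁] [Fintype X₂]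

/-- The converse: at a stopping time `S` before the decoding time, the messages are almost known,
and from then on the error probability decreases with exponent at most `D`. -/
theorem exists_stopping_time [NeZero M₁] [NeZero M₂] {L : ℕ} (c : VLC X₁ X₂ Y M₁ M₂ L)
    (hQ : ∀ x₁ x₂, Q x₁ x₂ ∈ stdSimplex ℝ Y) {lam D δ : ℝ} (hl : 0 < lam)
    (hs : (c.kernel hQ).UniformSupport lam)
    (hD : ∀ x₁ x₁' x₂ x₂', ∑ y, Q x₁ x₂ y * Real.logb 2 (Q x₁ x₂ y / Q x₁' x₂' y) ≤ D)
    [Nontrivial (Fin M₁ × Fin M₂)] (hδ : 0 < δ) (hδ2 : δ ≤ 1 / 2) :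
    ∃ S : (Fin L → Y) → ℕ, IsStop S ∧ (∀ y, S y ≤ c.T y) ∧
      (1 - c.errorProb Q) * -Real.logb 2 (c.errorProb Q) - 2 ≤ Real.logb 2 (1 / (lam * δ)) +
        (c.meanT Q - meanOut (c.jointLaw Q) fun y => (S y : ℝ)) * D ∧
      (1 - δ - c.errorProb Q) * Real.logb 2 M₁ - 1 ≤
        directedInfoCausal (c.jointLaw Q) (fun ω => ω.1) (fun ω => ω.2.2) (fun ω => ω.2.1) S ∧
      (1 - δ - c.errorProb Q) * Real.logb 2 M₂ - 1 ≤
        directedInfoCausal (c.jointLaw Q) (fun ω => ω.2.1) (fun ω => ω.2.2) (fun ω => ω.1) S ∧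
      (1 - δ - c.errorProb Q) * Real.logb 2 (M₁ * M₂ : ℕ) - 1 ≤
        directedInfo (c.jointLaw Q) (fun ω i => (ω.1 i, ω.2.1 i)) (fun ω => ω.2.2) S ∧
      (1 - δ - c.errorProb Q) * Real.logb 2 (M₁ * M₂ : ℕ) - 1 ≤
        (meanOut (c.jointLaw Q) fun y => (S y : ℝ)) * Real.logb 2 (1 / lam) := by
  set K := c.kernel hQ with hK
  have hlaw : c.law Q = K.law := law_eq c hQ
  have hT := c.isStop.isStopRule
  have hT1 := c.isStop.one_le
  have hS : IsStopRule (K.concTime δ c.T) := FeedbackKernel.isStopRule_concTime hT1 hT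
  have hST := FeedbackKernel.concTime_le (K := K) (δ := δ) hT1
  have hSL : ∀ y, K.concTime δ c.T y ≤ L := fun y => (hST y).trans (c.le_N y)
  have hdec : ∀ y y', Agree (c.T y) y y' → c.decoded y = c.decoded y' := by
    intro y y' h
    have h1 : ∀ t (ht : t ≤ L) (ht' : t ≤ L), Agree t y y' →
        c.dec t (past y t ht) = c.dec t (past y' t ht') := fun t ht _ ha => by
      rw [(past_eq_past_iff ht y y').2 ha]
    have h2 : ∀ t (ht : t ≤ L), t = c.T y' → c.dec t (past y' t ht) = c.decoded y' := by
      rintro t ht rfl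
      rfl
    exact (h1 _ (c.le_N y) (c.le_N y) h).trans (h2 _ _ (hT y y' h).symm)
  have hd := FeedbackKernel.concMessage_congr (K := K) (δ := δ) hT1 hT hdec
  have hbad := FeedbackKernel.pr_concMessage_ne_le (K := K) hδ.le hT1 hT c.le_N hdec
  have hpe : pr K.law (fun ω => c.decoded ω.2 ≠ ω.1) = c.errorProb Q := by
    rw [errorProb, hlaw]
  rw [hpe] at hbad
  have hmean : meanOut (c.jointLaw Q) (fun y => (K.concTime δ c.T y : ℝ)) =
      expect K.law fun ω => (K.concTime δ c.T ω.2 : ℝ) := by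
    rw [meanOut, jointLaw, expect_pushLaw, hlaw]; rfl
  -- Replaces the error probability of the guess at the stopping time by its bound `δ + pe`.
  have hweak : ∀ {n : ℕ} {x : ℝ}, (1 - pr K.law fun ω => K.concMessage δ c.T c.decoded ω.2 ≠
      ω.1) * Real.logb 2 n - 1 ≤ x → (1 - δ - c.errorProb Q) * Real.logb 2 n - 1 ≤ x := by
    intro n x h
    refine le_trans ?_ h
    have hn : 0 ≤ Real.logb 2 (n : ℝ) := by
      rcases Nat.eq_zero_or_pos n with rfl | hn
      · simp
      · exact Real.logb_nonneg one_lt_two (by exact_mod_cast hn)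
    have := mul_le_mul_of_nonneg_right
      (show 1 - δ - c.errorProb Q ≤ 1 - pr K.law fun ω =>
        K.concMessage δ c.T c.decoded ω.2 ≠ ω.1 by linarith) hn
    exact sub_le_sub_right this 1
  refine ⟨K.concTime δ c.T, hS.isStop fun y => (FeedbackKernel.concTime_mem hT1 y).1, hST,
    ?_, ?_, ?_, ?_, ?_⟩
  · have h1 := FeedbackKernel.le_expect_logOdds hl hs hT c.le_N c.decoded hdec hpe
      (c.errorProb_pos hQ hl hs)
    have h2 := FeedbackKernel.expect_logOdds_le (D := D) hl hs
      (fun w v r y => hD _ _ _ _) hS hT hST c.le_N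
    have h3 := FeedbackKernel.expect_logOdds_concTime_le hl hs hδ hδ2 hT1 c.le_N
    rw [expect_sub] at h2
    rw [hmean, meanT, hlaw]
    linarith
  · refine hweak ?_
    rw [← hlaw]
    exact c.directedInfoCausal_one_ge hQ hl hs hS hSL _ hd
  · refine hweak ?_
    rw [← hlaw]
    exact c.directedInfoCausal_two_ge hQ hl hs hS hSL _ hd
  · refine hweak ?_
    rw [← hlaw]
    exact c.directedInfo_ge hQ hl hs hS hSL _ hd
  · refine hweak ?_
    rw [hmean]
    have h1 := FeedbackKernel.logb_card_add_expect_le hl hs hSL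
    have h2 := FeedbackKernel.expect_logb_fiber_ge hl hs (fun _ => ()) (NeZero.pos (M₁ * M₂))
      (fun w => by simp [fiberSum]) hS hSL _ hd
    rw [Fintype.card_prod, Fintype.card_fin, Fintype.card_fin] at h1
    linarith

section Extend

variable {N : ℕ} (c : VLC X₁ X₂ Y M₁ M₂ N) {n : ℕ} {x₁ x₁' : X₁} {x₂ x₂' : X₂} {S : (Fin (N + n) → Y) → ℕ}

/-- During the tail, the output depends on nothing but the fixed inputs. -/
theorem pr_extend_tail (hQ : ∀ x₁ x₂, Q x₁ x₂ ∈ stdSimplex ℝ Y)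
    {α : Type*} (A : Traj X₁ X₂ Y (N + n) → Fin (N + n) → α) (a : α)
    (r : Fin (N + n)) (hr : N ≤ r)
    (hA : ∀ ω, A ((c.extend n x₁ x₂).traj ω) r = a) {τ : Traj X₁ X₂ Y (N + n)}
    (hτ : 0 < (c.extend n x₁ x₂).jointLaw Q τ) :
    (0 < pr ((c.extend n x₁ x₂).jointLaw Q) fun ω =>
      A ω r = a ∧ past ω.2.2 r r.2.le = past τ.2.2 r r.2.le) ∧
    ∀ y, pr ((c.extend n x₁ x₂).jointLaw Q) (fun ω =>
        ω.2.2 r = y ∧ A ω r = a ∧ past ω.2.2 r r.2.le = past τ.2.2 r r.2.le) =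
      Q x₁ x₂ y * pr ((c.extend n x₁ x₂).jointLaw Q) fun ω =>
        A ω r = a ∧ past ω.2.2 r r.2.le = past τ.2.2 r r.2.le := by
  classical
  set c' := c.extend n x₁ x₂
  set K := c'.kernel hQ
  have e1 : pr (c'.jointLaw Q) (fun ω =>
      A ω r = a ∧ past ω.2.2 r r.2.le = past τ.2.2 r r.2.le) =
      (Fintype.card (Fin M₁ × Fin M₂) : ℝ)⁻¹ * K.totalLk r τ.2.2 := by
    rw [← K.pr_agree, jointLaw, pr_pushLaw, law_eq c' hQ]
    refine pr_congr fun ω => ?_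
    rw [past_eq_past_iff, and_iff_right (hA ω)]
    exact ⟨Agree.symm, Agree.symm⟩
  have e2 : ∀ y, pr (c'.jointLaw Q) (fun ω =>
      ω.2.2 r = y ∧ A ω r = a ∧ past ω.2.2 r r.2.le = past τ.2.2 r r.2.le) =
      (Fintype.card (Fin M₁ × Fin M₂) : ℝ)⁻¹ * (K.totalLk r τ.2.2 * Q x₁ x₂ y) := by
    intro y
    have h1 := K.pr_agree_and r τ.2.2 fun x => x.2 = y
    have h2 : ∀ w b, K.k w r τ.2.2 b = Q x₁ x₂ b := by
      intro w b
      change Q (c'.input₁ w.1 τ.2.2 r) (c'.input₂ w.2 τ.2.2 r) b = _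
      rw [c.extend_input₁ n x₁ x₂ w.1 _ hr, c.extend_input₂ n x₁ x₂ w.2 _ hr]
    simp only [h2, mul_ite, mul_one, mul_zero, Finset.sum_ite_eq', Finset.mem_univ, if_true,
      ← Finset.sum_mul] at h1
    change _ = (Fintype.card (Fin M₁ × Fin M₂) : ℝ)⁻¹ * ((∑ w, K.lk r w τ.2.2) * Q x₁ x₂ y)
    rw [← h1, jointLaw, pr_pushLaw, law_eq c' hQ]
    refine pr_congr fun ω => ?_
    rw [past_eq_past_iff, and_iff_right (hA ω), and_comm]
    exact and_congr_left fun _ => ⟨Agree.symm, Agree.symm⟩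
  refine ⟨?_, fun y => by rw [e1, e2]; ring⟩
  have hA' : A τ r = a := by
    by_contra hne
    refine hτ.ne' (Finset.sum_eq_zero fun ω _ => if_neg ?_)
    rintro rfl
    exact hne (hA ω)
  exact hτ.trans_le (le_pr (c'.jointLaw_nonneg hQ)
    (A := fun ω => A ω r = a ∧ past ω.2.2 r r.2.le = past τ.2.2 r r.2.le) ⟨hA', rfl⟩)

/-- In the tail the first user's effective channel is the row at `(x₁, x₂)`, and the row at `(x₁',
x₂')` is an allowed second argument. -/
theorem le_D₁_extend [NeZero M₁] [NeZero M₂]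
    (hQ : ∀ x₁ x₂, Q x₁ x₂ ∈ stdSimplex ℝ Y)
    (hS : ∀ y, S y ≤ N) (h : relEntropy (Q x₁ x₂) (Q x₁' x₂') = D₃ Q) :
    n * D₃ Q / (N + n : ℕ) ≤ D₁ Q ((c.extend n x₁ x₂).jointLaw Q) S fun _ => N + n := by
  refine le_avgEffDiv ((c.extend n x₁ x₂).jointLaw_nonneg hQ)
    ((c.extend n x₁ x₂).sum_jointLaw hQ) _ _ hS fun τ hτ r hr => ?_
  obtain ⟨h1, h2⟩ := c.pr_extend_tail hQ (fun ω => ω.1) x₁ r hr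
    (fun ω => c.extend_input₁ n x₁ x₂ _ _ hr) hτ
  rw [← h]
  exact le_effDiv (K := Q) x₁ x₁' x₂' (Q x₁ x₂) h1 h2

theorem le_D₂_extend [NeZero M₁] [NeZero M₂]
    (hQ : ∀ x₁ x₂, Q x₁ x₂ ∈ stdSimplex ℝ Y)
    (hS : ∀ y, S y ≤ N) (h : relEntropy (Q x₁ x₂) (Q x₁' x₂') = D₃ Q) :
    n * D₃ Q / (N + n : ℕ) ≤ D₂ Q ((c.extend n x₁ x₂).jointLaw Q) S fun _ => N + n := by
  refine le_avgEffDiv ((c.extend n x₁ x₂).jointLaw_nonneg hQ)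
    ((c.extend n x₁ x₂).sum_jointLaw hQ) _ _ hS fun τ hτ r hr => ?_
  obtain ⟨h1, h2⟩ := c.pr_extend_tail hQ (fun ω => ω.2.1) x₂ r hr
    (fun ω => c.extend_input₂ n x₁ x₂ _ _ hr) hτ
  rw [← h]
  exact le_effDiv (K := fun x₂ x₁ => Q x₁ x₂) x₂ x₂' x₁' (Q x₁ x₂) h1 h2

end Extend

end VLC

/-! ### The upper bound on the reliability function -/

/-- Eliminates `σ / τ`: up to slack, `R τ ≤ σ I` and `σ D ≤ (D - E) τ` give `D R ≤ (D - E) I`. -/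
theorem sub_le_mul_one_sub_div {D E R σ τ I s η : ℝ} (hE : 0 ≤ E) (hR : 0 ≤ R) (hD : 0 ≤ D)
    (hs : 0 < s) (hσ : 0 < σ) (hστ : σ ≤ τ) (hI0 : 0 < I)
    (hσD : σ * D ≤ (D - E + s * (E + 2)) * τ)
    (hI : (R - s * (2 * R + 3)) * τ ≤ σ * I) (h1 : s * (E + 2) ≤ η / 2)
    (h2 : 0 < R → s * (2 * R + 3) ≤ R / 2 ∧ 2 * D * (s * (2 * R + 3)) ≤ η / 2 * R) :
    E - η ≤ D * (1 - R / I) := by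
  have hτ : 0 < τ := hσ.trans_le hστ
  have hη : 0 ≤ η := by nlinarith
  rcases hR.eq_or_lt with rfl | hR
  · have : 0 ≤ D - E + s * (E + 2) := by
      by_contra! h
      have h3 : (D - E + s * (E + 2)) * τ < 0 := mul_neg_of_neg_of_pos h hτ
      have h4 : 0 ≤ σ * D := by positivity
      linarith
    rw [zero_div, sub_zero, mul_one]
    linarith
  · obtain ⟨h3, h4⟩ := h2 hR
    set θ := s * (2 * R + 3)
    have hθ : R / 2 ≤ R - θ := by linarith
    -- Since `R ≤ 2 I`, the rate loss is absorbed: `D θ ≤ (η / 4) R ≤ (η / 2) I`. The other half of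
    -- `η` pays for `s (E + 2)`.
    have hIR : R / 2 ≤ I := by
      refine hθ.trans (le_of_mul_le_mul_right ?_ hτ)
      calc (R - θ) * τ ≤ σ * I := hI
        _ ≤ I * τ := by rw [mul_comm]; exact mul_le_mul_of_nonneg_left hστ hI0.le
    have h5 : D * (R - θ) ≤ (D - E + s * (E + 2)) * I := by
      refine le_of_mul_le_mul_right ?_ hτ
      calc D * (R - θ) * τ = D * ((R - θ) * τ) := by ring
        _ ≤ D * (σ * I) := mul_le_mul_of_nonneg_left hI hD
        _ = σ * D * I := by ring
        _ ≤ (D - E + s * (E + 2)) * τ * I := mul_le_mul_of_nonneg_right hσD hI0.le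
        _ = _ := by ring
    have h6 : D * R ≤ (D - E + η) * I := by nlinarith
    have h7 : D * R / I ≤ D - E + η := (div_le_iff₀ hI0).2 h6
    have h8 : D * (1 - R / I) = D - D * R / I := by ring
    linarith

theorem le_slope {D : ℝ≥0∞} {D' : ℝ} {R I x : ℝ} (hD' : 0 ≤ D') (hD : ENNReal.ofReal D' ≤ D)
    (hx : 0 ≤ 1 - R / I) (h : x ≤ D' * (1 - R / I)) : (x : EReal) ≤ slope D R I := by
  calc (x : EReal) ≤ ((D' * (1 - R / I) : ℝ) : EReal) := EReal.coe_le_coe_iff.2 h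
    _ = ((ENNReal.ofReal D' : ℝ≥0∞) : EReal) * ((1 - R / I : ℝ) : EReal) := by
        rw [EReal.coe_mul, EReal.coe_ennreal_ofReal, max_eq_left hD']
    _ ≤ _ := by
        refine mul_le_mul_of_nonneg_right (EReal.coe_ennreal_le_coe_ennreal_iff.2 hD) ?_
        exact EReal.coe_nonneg.2 hx

open Filter Topology in
theorem eventually_mul_le (a : ℝ) {b : ℝ} (hb : 0 < b) : ∀ᶠ s : ℝ in 𝓝[>] 0, s * a ≤ b := by
  have : Tendsto (fun s : ℝ => s * a) (𝓝[>] 0) (𝓝 (0 * a)) :=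
    ((continuous_id.mul continuous_const).tendsto 0).mono_left nhdsWithin_le_nhds
  rw [zero_mul] at this
  exact (this.eventually (gt_mem_nhds hb)).mono fun s hs => hs.le

open Filter Topology in
theorem eventually_rate_slack (D R : ℝ) {η : ℝ} (hη : 0 < η) : ∀ᶠ s : ℝ in 𝓝[>] 0,
    0 < R → s * (2 * R + 3) ≤ R / 2 ∧ 2 * D * (s * (2 * R + 3)) ≤ η / 2 * R := by
  by_cases hR : 0 < R
  · filter_upwards [eventually_mul_le (2 * R + 3) (half_pos hR),
      eventually_mul_le (2 * D * (2 * R + 3)) (mul_pos (half_pos hη) hR)] with s h1 h2 _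
    exact ⟨h1, by linarith⟩
  · exact Eventually.of_forall fun s h => absurd h hR

section UpperBound

variable {X₁ X₂ Y : Type*} [Fintype Y] {Q : X₁ → X₂ → Y → ℝ}

theorem Achievable.exists_code {E R₁ R₂ : ℝ} (h : Achievable Q E R₁ R₂) {ε : ℝ} (h0 : 0 < ε)
    (h1 : ε < 1) (M : ℕ) : ∃ (M₁ M₂ N : ℕ) (c : VLC X₁ X₂ Y M₁ M₂ N), M ≤ M₁ ∧ M ≤ M₂ ∧
      ((E - ε : ℝ) : EReal) ≤ c.errorExponent Q ∧ R₁ - ε ≤ c.rate₁ Q ∧ R₂ - ε ≤ c.rate₂ Q := by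
  obtain ⟨m, hm⟩ := h
  obtain ⟨n, M₁, M₂, N, c, -, hc⟩ := (hm ε h0 h1 M).exists
  exact ⟨M₁, M₂, N, c, hc⟩

theorem Achievable.nonempty {E R₁ R₂ : ℝ} (h : Achievable Q E R₁ R₂) :
    Nonempty X₁ ∧ Nonempty X₂ := by
  obtain ⟨M₁, M₂, N, c, h1, h2, -⟩ := h.exists_code one_half_pos one_half_lt_one 1
  exact ⟨⟨c.enc₁ 0 ⟨0, h1⟩ Fin.elim0⟩, ⟨c.enc₂ 0 ⟨0, h2⟩ Fin.elim0⟩⟩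

theorem exists_logb_ge (a : ℝ) : ∃ M : ℕ, 2 ≤ M ∧ ∀ m : ℕ, M ≤ m → a ≤ Real.logb 2 m := by
  obtain ⟨k, hk⟩ := exists_nat_ge (max a 1)
  have hk1 : 1 ≤ k := by exact_mod_cast (le_max_right a 1).trans hk
  refine ⟨2 ^ k, by simpa using Nat.pow_le_pow_right two_pos hk1, fun m hm => ?_⟩
  calc a ≤ k := (le_max_left a 1).trans hk
    _ = Real.logb 2 ((2 : ℝ) ^ k) := by
        rw [Real.logb_pow, Real.logb_self_eq_one one_lt_two, mul_one]
    _ ≤ _ := Real.logb_le_logb_of_le one_lt_two (by positivity) (by exact_mod_cast hm)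

theorem errorProb_le_rpow {E s τ pe : ℝ} (hpe : 0 < pe) (hs : s * 2 ≤ E) (hτ : 0 ≤ τ)
    (h : (E - s) * τ ≤ -Real.logb 2 pe) {x : ℝ} (hx : x ≤ E / 2 * τ) : pe ≤ 2 ^ (-x) := by
  refine (Real.logb_le_iff_le_rpow one_lt_two hpe).1 ?_
  nlinarith

/-- The mean decoding time is large as soon as there are many messages. -/
theorem meanT_large {s τ σ pe c₀ Λ ℓ τ₀ : ℝ} (hστ : σ ≤ τ) (hΛ : 0 ≤ Λ) (hℓ0 : 0 ≤ ℓ)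
    (hpe : pe ≤ c₀) (hs : s * 2 ≤ 1 - c₀) (h : (1 - s - pe) * ℓ - 1 ≤ σ * Λ)
    (hℓ : τ₀ * Λ + 1 < (1 - c₀) / 2 * ℓ) : τ₀ ≤ τ := by
  by_contra! hlt
  have h1 : τ * Λ ≤ τ₀ * Λ := mul_le_mul_of_nonneg_right hlt.le hΛ
  have h2 : σ * Λ ≤ τ * Λ := mul_le_mul_of_nonneg_right hστ hΛ
  have h3 : (1 - c₀) / 2 * ℓ ≤ (1 - s - pe) * ℓ :=
    mul_le_mul_of_nonneg_right (by linarith) hℓ0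
  linarith

/-- The slack `s (E + 2)` is made of `s` for the achieved exponent, `s E` for the factor `1 - pe`,
and `s` for the constant `C + 2`. -/
theorem drift_bound {E s τ σ pe B C D : ℝ} (hs : 0 ≤ s) (hs1 : s ≤ 1)
    (hpe : pe ≤ s) (hB0 : 0 ≤ B) (hB : (E - s) * τ ≤ B) (hτ : 0 ≤ τ)
    (hC : C + 2 ≤ s * τ) (h : (1 - pe) * B - 2 ≤ C + (τ - σ) * D) :
    σ * D ≤ (D - E + s * (E + 2)) * τ := by
  have h1 : (1 - s) * ((E - s) * τ) ≤ (1 - s) * B :=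
    mul_le_mul_of_nonneg_left hB (by linarith)
  have h2 : (1 - s) * B ≤ (1 - pe) * B := mul_le_mul_of_nonneg_right (by linarith) hB0
  have h3 : 0 ≤ s * s * τ := by positivity
  nlinarith

/-- The slack is `2 s R` for the error of the guess, `2 s` for the rate (the sum rate loses `s` from
each user), and `s` for the bit lost in Fano's inequality. -/
theorem rate_bound {s τ pe R ℓ I : ℝ} (hs : 0 ≤ s) (hs1 : s ≤ 1 / 4) (hpe : pe ≤ s)
    (hℓ0 : 0 ≤ ℓ) (hτ1 : 1 ≤ s * τ) (hτ : 0 ≤ τ) (hℓ : (R - 2 * s) * τ ≤ ℓ)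
    (h : (1 - s - pe) * ℓ - 1 ≤ I) : (R - s * (2 * R + 3)) * τ ≤ I := by
  have h1 : (1 - 2 * s) * ((R - 2 * s) * τ) ≤ (1 - 2 * s) * ℓ :=
    mul_le_mul_of_nonneg_left hℓ (by linarith)
  have h2 : (1 - 2 * s) * ℓ ≤ (1 - s - pe) * ℓ := mul_le_mul_of_nonneg_right (by linarith) hℓ0
  have h3 : 0 ≤ s * s * τ := by positivity
  nlinarith

variable [Fintype X₁] [Fintype X₂]

/-- One `η` pays for the imperfections of the code, the other for the finite length of the tail. -/
theorem sub_le_upperBound (hQ : ∀ x₁ x₂, Q x₁ x₂ ∈ stdSimplex ℝ Y) (hD : D₃ Q < ⊤)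
    {E R₁ R₂ η : ℝ} (hR₁ : 0 ≤ R₁) (hR₂ : 0 ≤ R₂) (hη : 0 < η) (hηE : η < E)
    (hach : Achievable Q E R₁ R₂) : ((E - 2 * η : ℝ) : EReal) ≤ upperBound Q R₁ R₂ := by
  classical
  have hE : 0 < E := hη.trans hηE
  obtain ⟨hX₁, hX₂⟩ := hach.nonempty
  have hY : Nonempty Y := by
    by_contra he
    rw [not_nonempty_iff] at he
    have := (hQ hX₁.some hX₂.some).2
    simp at this
  set D := (D₃ Q).toReal with hDdef
  have hD0 : 0 ≤ D := ENNReal.toReal_nonneg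
  obtain ⟨x₁, x₁', x₂, x₂', hmax⟩ := exists_relEntropy_eq_D₃ (Q := Q)
  obtain ⟨lam, hl, hl1, hlam⟩ := exists_uniform_lower_bound hQ hD
  -- A bound on the error probability that needs only a mean decoding time of at least 1. It avoids
  -- a circle: a small error probability is deduced from a large decoding time, whose proof needs
  -- the error probability to stay away from 1.
  set c₀ : ℝ := 2 ^ (-(E / 2)) with hc₀
  have hc₀1 : c₀ < 1 := Real.rpow_lt_one_of_one_lt_of_neg one_lt_two (by linarith)
  obtain ⟨s, ⟨hs4, hsη, hsE, hsc, hsR₁, hsR₂, hsR₃⟩, hs0⟩ :=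
    ((eventually_mul_le 1 (b := 1 / 4) (by norm_num)).and <|
      (eventually_mul_le (E + 2) (half_pos hη)).and <| (eventually_mul_le 2 hE).and <|
      (eventually_mul_le 2 (sub_pos.2 hc₀1)).and <| (eventually_rate_slack D R₁ hη).and <|
      (eventually_rate_slack D R₂ hη).and (eventually_rate_slack D (R₁ + R₂) hη)).and
      self_mem_nhdsWithin |>.exists
  replace hs0 : 0 < s := hs0
  rw [mul_one] at hs4
  set Λ := Real.logb 2 (1 / lam) with hΛdef
  have hΛ : 0 ≤ Λ := Real.logb_nonneg one_lt_two (by rwa [le_div_iff₀ hl, one_mul])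
  set C := Real.logb 2 (1 / (lam * s)) with hC
  -- The three thresholds make `C + 2` and `1` at most `s τ`, and the error probability at most `s`.
  set τ₀ := max ((C + 2) / s) (max (1 / s) (Real.logb 2 (1 / s) / (E / 2))) with hτ₀
  -- The 3 makes the Fano bound positive, as `1 - s - pe ≥ 1 / 2`; the 2 in place of 1 makes the
  -- last hypothesis of `meanT_large` strict.
  obtain ⟨M, hM2, hM⟩ := exists_logb_ge (max 3 ((τ₀ * Λ + 2) / ((1 - c₀) / 2)))
  obtain ⟨M₁, M₂, N, c, hM₁, hM₂, hexp, hr₁, hr₂⟩ := hach.exists_code hs0 (by linarith) M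
  have hM₁2 := hM2.trans hM₁
  have hM₂2 := hM2.trans hM₂
  have : NeZero M₁ := ⟨by omega⟩
  have : NeZero M₂ := ⟨by omega⟩
  have : Nontrivial (Fin M₁) := Fin.nontrivial_iff_two_le.2 hM₁2
  have hsupp : ∀ {L : ℕ} (c : VLC X₁ X₂ Y M₁ M₂ L), (c.kernel hQ).UniformSupport lam :=
    fun c _ _ _ _ _ h => hlam _ _ _ _ _ h
  -- The tail is so long that the factor `n / (N + n)` costs at most another `η`.
  obtain ⟨n, hn⟩ := exists_nat_ge (max 1 (N * E / η))
  have hn1 : (1 : ℝ) ≤ n := (le_max_left _ _).trans hn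
  have hnN : N * E ≤ η * n := by
    have := (le_max_right _ _).trans hn
    rwa [div_le_iff₀ hη, mul_comm (n : ℝ)] at this
  set c' := c.extend n x₁ x₂ with hc'
  set P := c'.jointLaw Q with hP
  have hP0 : ∀ τ, 0 ≤ P τ := c'.jointLaw_nonneg hQ
  have hP1 : ∑ τ, P τ = 1 := c'.sum_jointLaw hQ
  obtain ⟨S, hS, hST, hpe', hi₁, hi₂, hi₃, hlen⟩ := c'.exists_stopping_time hQ hl (hsupp c')
    (fun a a' b b' => sum_mul_logb_le_D₃ hD a a' b b') hs0 (by linarith)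
  have hmT : c'.meanT Q = c.meanT Q := c.extend_meanT n x₁ x₂ hQ
  have hpe_pos : 0 < c.errorProb Q := by
    rw [← c.extend_errorProb n x₁ x₂ hQ]
    exact c'.errorProb_pos hQ hl (hsupp c')
  rw [hmT, c.extend_errorProb n x₁ x₂ hQ] at hpe'
  rw [c.extend_errorProb n x₁ x₂ hQ] at hi₁ hi₂ hi₃ hlen
  set τ := c.meanT Q with hτ
  set pe := c.errorProb Q with hpe
  set σ := meanOut P fun y => (S y : ℝ) with hσ
  have hσ1 : 1 ≤ σ := by
    rw [← expect_const hP1 1]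
    exact expect_mono hP0 fun ω _ => Nat.one_le_cast.2 (hS.one_le ω.2.2)
  have hστ : σ ≤ τ := by
    rw [← hmT, hσ, meanOut, hP, VLC.jointLaw, expect_pushLaw, VLC.meanT, VLC.law_eq c' hQ]
    exact expect_mono (c'.kernel hQ).law_nonneg fun ω _ => by exact_mod_cast hST _
  have hτ1 : 1 ≤ τ := hσ1.trans hστ
  have hτ0 : 0 < τ := one_pos.trans_le hτ1
  -- the performance of the code
  have hB : (E - s) * τ ≤ -Real.logb 2 pe := by
    rw [VLC.errorExponent, if_neg hpe_pos.ne', EReal.coe_le_coe_iff] at hexp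
    exact (le_div_iff₀ hτ0).1 hexp
  have hℓ₁ : (R₁ - s) * τ ≤ Real.logb 2 M₁ := (le_div_iff₀ hτ0).1 hr₁
  have hℓ₂ : (R₂ - s) * τ ≤ Real.logb 2 M₂ := (le_div_iff₀ hτ0).1 hr₂
  have hℓ₃ : Real.logb 2 (M₁ * M₂ : ℕ) = Real.logb 2 M₁ + Real.logb 2 M₂ := by
    rw [Nat.cast_mul, Real.logb_mul (NeZero.ne _) (NeZero.ne _)]
  rw [hℓ₃] at hi₃ hlen
  have h3₁ := (le_max_left _ _).trans (hM M₁ hM₁)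
  have h3₂ := (le_max_left _ _).trans (hM M₂ hM₂)
  have hlarge := (le_max_right _ _).trans (hM M₁ hM₁)
  rw [div_le_iff₀ (by linarith), mul_comm] at hlarge
  -- the mean decoding time is large and the error probability is small
  have hτ₀τ : τ₀ ≤ τ := by
    refine meanT_large hστ hΛ (by linarith)
      (errorProb_le_rpow hpe_pos hsE hτ0.le hB 
        (le_mul_of_one_le_right (by linarith) hτ1)) hsc hlen ?_
    have : 0 ≤ (1 - c₀) / 2 * Real.logb 2 M₂ := mul_nonneg (by linarith) (by linarith)
    linarith
  have hτC : C + 2 ≤ s * τ := by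
    have := (le_max_left _ _).trans hτ₀τ
    rwa [div_le_iff₀ hs0, mul_comm] at this
  have hτs : 1 ≤ s * τ := by
    have := ((le_max_left _ _).trans (le_max_right _ _)).trans hτ₀τ
    rwa [div_le_iff₀ hs0, mul_comm] at this
  have hpes : pe ≤ s := by
    have h1 := ((le_max_right _ _).trans (le_max_right _ _)).trans hτ₀τ
    rw [div_le_iff₀ (by linarith), mul_comm] at h1
    have h2 := errorProb_le_rpow hpe_pos hsE hτ0.le hB h1
    rwa [one_div, Real.logb_inv, neg_neg, Real.rpow_logb two_pos (by norm_num) hs0] at h2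
  have hB0 : 0 ≤ -Real.logb 2 pe := le_trans (mul_nonneg (by linarith) hτ0.le) hB
  have hdrift := drift_bound hs0.le (by linarith) hpes hB0 hB hτ0.le hτC hpe'
  -- the information of the three users
  have hfinal : ∀ {R ℓ J : ℝ}, 0 ≤ R → 3 ≤ ℓ → (R - 2 * s) * τ ≤ ℓ →
      (1 - s - pe) * ℓ - 1 ≤ J →
      (0 < R → s * (2 * R + 3) ≤ R / 2 ∧ 2 * D * (s * (2 * R + 3)) ≤ η / 2 * R) →
      0 < J / σ ∧ E - η ≤ D * (1 - R / (J / σ)) := by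
    intro R ℓ J hR hℓ hRℓ hJ hsR
    have hJ0 : 0 < J := by
      have : 1 / 2 * ℓ ≤ (1 - s - pe) * ℓ :=
        mul_le_mul_of_nonneg_right (by linarith) (by linarith)
      linarith
    have hJσ : 0 < J / σ := div_pos hJ0 (by linarith)
    refine ⟨hJσ, sub_le_mul_one_sub_div hE.le hR hD0 hs0 (by linarith) hστ hJσ hdrift ?_ hsη hsR⟩
    rw [mul_div_cancel₀ J (by linarith)]
    exact rate_bound hs0.le hs4 hpes (by linarith) hτs hτ0.le hRℓ hJ
  have hsτ : 0 ≤ s * τ := by positivity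
  obtain ⟨hI₁, hb₁⟩ := hfinal hR₁ h3₁ (by linarith) hi₁ hsR₁
  obtain ⟨hI₂, hb₂⟩ := hfinal hR₂ h3₂ (by linarith) hi₂ hsR₂
  obtain ⟨hI₃, hb₃⟩ := hfinal (add_nonneg hR₁ hR₂)
    (show 3 ≤ Real.logb 2 M₁ + Real.logb 2 M₂ by linarith) (by linarith) hi₃ hsR₃
  have hSN : ∀ y, S y ≤ N := fun y => (hST y).trans (c.le_N _)
  have hTS : 0 < meanOut P fun y => ((N + n : ℕ) : ℝ) - (S y : ℝ) := by
    refine lt_of_lt_of_le (one_pos.trans_le hn1) ?_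
    rw [← expect_const hP1 (n : ℝ)]
    refine expect_mono hP0 fun ω _ => ?_
    have : (S ω.2.2 : ℝ) ≤ N := by exact_mod_cast hSN _
    push_cast
    linarith
  have hn0 : 1 ≤ n := by exact_mod_cast hn1
  have hadm : Admissible Q P (fun _ => N + n) S S S :=
    { law := c'.jointLaw_mem_feedbackLaws
      isStop := IsStopRule.isStop (fun _ _ _ => rfl) fun _ => by omega
      isStop₁ := hS
      isStop₂ := hS
      isStop₃ := hS
      le_N := fun _ => le_rfl
      le₁ := fun y => (hSN y).trans (Nat.le_add_right N n)
      le₂ := fun y => (hSN y).trans (Nat.le_add_right N n)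
      le₃ := fun y => (hSN y).trans (Nat.le_add_right N n)
      gap₁ := hTS
      gap₂ := hTS
      info₁ := hI₁
      info₂ := hI₂
      info₃ := hI₃ }
  -- Here `η < E` is needed: the factors `1 - R / I` must be nonnegative for a lower bound on the
  -- divergence to give one on the product.
  have hpos : ∀ {x : ℝ}, E - η ≤ D * x → 0 ≤ x := by
    intro x hx
    by_contra! h
    have := mul_nonpos_of_nonneg_of_nonpos hD0 h.le
    linarith
  have hNn : (0 : ℝ) < N + n := by positivity
  set D' : ℝ := n * D / (N + n) with hD'
  have hD'0 : 0 ≤ D' := by positivity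
  have hD'e : ENNReal.ofReal D' = n * D₃ Q / (N + n : ℕ) := by
    rw [hD', ENNReal.ofReal_div_of_pos hNn, ENNReal.ofReal_mul (by positivity),
      ENNReal.ofReal_natCast, ENNReal.ofReal_toReal hD.ne, ← Nat.cast_add,
      ENNReal.ofReal_natCast]
  have htail : ∀ {x : ℝ}, E - η ≤ D * x → E - 2 * η ≤ D' * x := by
    intro x hx
    have h1 : D' * x = n * (D * x) / (N + n) := by rw [hD']; ring
    rw [h1, le_div_iff₀ hNn]
    have h2 : (n : ℝ) * (E - η) ≤ n * (D * x) := mul_le_mul_of_nonneg_left hx (by positivity)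
    have h3 : 0 ≤ (N : ℝ) * η := by positivity
    linarith
  refine le_trans ?_ (le_sSup ⟨N + n, P, fun _ => N + n, S, S, S, hadm, rfl⟩)
  refine le_min ?_ (le_min ?_ ?_)
  · exact le_slope hD'0 (hD'e.le.trans (c.le_D₁_extend hQ hSN hmax)) (hpos hb₁) (htail hb₁)
  · exact le_slope hD'0 (hD'e.le.trans (c.le_D₂_extend hQ hSN hmax)) (hpos hb₂) (htail hb₂)
  · refine le_slope hD0 (ENNReal.ofReal_toReal hD.ne).le (hpos hb₃) (le_trans ?_ hb₃)
    linarith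

theorem le_upperBound_of_pos (hQ : ∀ x₁ x₂, Q x₁ x₂ ∈ stdSimplex ℝ Y) (hD : D₃ Q < ⊤)
    {E R₁ R₂ : ℝ} (hR₁ : 0 ≤ R₁) (hR₂ : 0 ≤ R₂) (hE : 0 < E)
    (hach : Achievable Q E R₁ R₂) : (E : EReal) ≤ upperBound Q R₁ R₂ := by
  by_contra! h
  obtain ⟨z, hz, hzE⟩ := EReal.lt_iff_exists_real_btwn.1 h
  rw [EReal.coe_lt_coe_iff] at hzE
  -- Keeping `z'` above `E / 2` ensures `η = (E - z') / 2 < E`, and `E - 2 η = z'`.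
  set z' := max z (E / 2)
  have h1 : z' < E := max_lt hzE (by linarith)
  have h2 : E / 2 ≤ z' := le_max_right _ _
  have h3 := sub_le_upperBound hQ hD hR₁ hR₂ (η := (E - z') / 2) (by linarith) (by linarith) hach
  refine (h3.trans_lt hz).not_ge (EReal.coe_le_coe_iff.2 ?_)
  have : z ≤ z' := le_max_left _ _
  linarith

end UpperBound

end MAC

end

theorem theorem3 {X₁ X₂ Y : Type*} [Fintype X₁] [Fintype X₂] [Fintype Y]
    (Q : X₁ → X₂ → Y → ℝ) (hQ : ∀ x₁ x₂, Q x₁ x₂ ∈ stdSimplex ℝ Y)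
    (hD : MAC.D₃ Q < ⊤) (R₁ R₂ : ℝ) (hR₁ : 0 ≤ R₁) (hR₂ : 0 ≤ R₂)
    (hE : 0 < MAC.reliability Q R₁ R₂) :
    MAC.reliability Q R₁ R₂ ≤ MAC.upperBound Q R₁ R₂ := by
  obtain ⟨-, ⟨E', hE', rfl⟩, hpos⟩ := lt_sSup_iff.1 hE
  have hpos' : 0 < E' := EReal.coe_pos.1 hpos
  refine sSup_le ?_
  rintro - ⟨E, hach, rfl⟩
  -- An achievable `E` may be nonpositive; it is then dominated by the positive achievable `E'`.
  rcases le_or_gt E E' with h | h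
  · exact (EReal.coe_le_coe_iff.2 h).trans
      (MAC.le_upperBound_of_pos hQ hD hR₁ hR₂ hpos' hE')
  · exact MAC.le_upperBound_of_pos hQ hD hR₁ hR₂ (hpos'.trans h) hach
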